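/- Let $\mathcal G=(V,E)$ be a finite connected block graph, that is, a finite connected undirected graph in which every block (maximal subgraph that is connected and stays connected after removal of any single node) is complete; "clique" means maximal clique. For $u,v\in V$ let $\mathrm{pth}(u,v)$ be the set of directed edges of the unique shortest path from $u$ to $v$. Let $\mathcal S$ be the set of nodes $s$ such that $\{s\}$ is a minimal separator between two distinct cliques. Let $X=(X_v)_{v\in V}$ be a random vector in $[0,\infty)^V$ with the global Markov property: $X_A$ and $X_B$ are conditionally independent given $X_S$ whenever $A,B,S\subset V$ are non-empty, disjoint, and every path from $A$ to $B$ meets $S$. For each clique $C$ and $s\in C$ fix a version of the conditional law of $(X_v)_{v\in C\setminus s}$ given $X_s=x$, $x\in[0,\infty)$. Assume: (i) for every clique $C$ and $s\in C$ there is a probability distribution $\nu_{C,s}$ on $[0,\infty)^{C\setminus s}$ such that the law of $(X_v/t)_{v\in C\setminus s}$ given $X_s=t$ converges weakly to $\nu_{C,s}$ as $t\to\infty$; (ii) whenever $u\in V$, $s\in\mathcal S$, $C$ is a clique containing $s$ but no other node of the shortest path from $u$ to $s$, and for some edge $(a,b)\in\mathrm{pth}(u,s)$, contained in the clique $C'$,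 the $b$-th marginal of $\nu_{C',a}$ has an atom at $0$, then for every $\eta>0$ $$\limsup_{\delta\downarrow0}\ \limsup_{t\to\infty}\ \sup_{x_s\in[0,\delta]}P\big(\exists v\in C\setminus s: X_v/t>\eta \,\big|\, X_s/t=x_s\big)=0;$$ (iii) $t\,P(X_v>t)\to1$ as $t\to\infty$ for every $v\in V$. For each $u\in V$ let $Z=Z^{(u)}$ be the random vector of increments with source $u$: for each clique $C$ let $s=s(u,C)$ be $u$ if $u\in C$, and otherwise the node of $C$ through which every path from $u$ to a node of $C$ passes; the vectors $(Z_{sv})_{v\in C\setminus s}$ have law $\nu_{C,s}$ and are mutually independent as $C$ varies. Put $A_{uv}=\prod_{e\in\mathrm{pth}(u,v)}Z_e$, $A_{uu}=1$, $A_u=(A_{uv})_{v\in V}$. Let $\mathcal M_0$ be the set of Borel measures on $[0,\infty)^V\setminus\{0\}$ that are finite on $\{x:\max_v x_v\ge\varepsilon\}$ for all $\varepsilon>0$, with the smallest topology making $\mu\mapsto\int f\,d\mu$ continuous for all bounded continuous real $f$ vanishing in a neighbourhood of the origin. Then there is $\mu\in\mathcal M_0$ with $t\,P(t^{-1}X\in\cdot\,)\to\mu$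 in $\mathcal M_0$ as $t\to\infty$ such that, for every $u\in V$ and Borel $f:[0,\infty)^V\setminus\{0\}\to[0,\infty]$, $$\int f(x)\,\mathbf 1\{x_u>0\}\,d\mu(x)=E\Big[\int_0^\infty f(zA_u)\,z^{-2}\,dz\Big],$$ and, with $G(x)=\exp[-\mu(\{y:\exists v\in V,\ y_v>x_v\})]$ for $x\in(0,\infty]^V$, we have $\lim_{n\to\infty}P(X_v\le nx_v,\ v\in V)^n=G(x)$ for $x\in(0,\infty)^V$. Moreover: (a) If $u\in V$ is such that $E[Z_e]=1$ for every $e\in\mathrm{pth}(u,v)$ and every $v\in V\setminus u$ (increments with source $u$), then $\mu(\{x:x_u=0\})=0$; for every Borel $f:[0,\infty)^V\setminus\{0\}\to[0,\infty]$, $$\int f(x)\,d\mu(x)=E\Big[\int_0^\infty f(zA_u)\,z^{-2}\,dz\Big];$$ and the stable tail dependence function of $G$ is $$\ell(x)=-\log G(1/x_v,\ v\in V)=E\big[\max\{x_vA_{uv}: v\in V\}\big],\qquad x\in[0,\infty)^V,$$ where $1/0=\infty$. (b) For every edge $(a,b)$, the condition $E[Z_{ab}]=1$ is equivalent to $P(Z_{ba}>0)=1$;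 here $Z_{ab}$ and $Z_{ba}$ are increments for any source nodes $u$ and $u'$ such that $(a,b)$ and $(b,a)$, respectively, lie on a shortest path starting at that source. -/

import Mathlib

open MeasureTheory ProbabilityTheory Filter Topology
open scoped NNReal ENNReal

namespace MarkovBlock

noncomputable section

/-! ### Block graphs, separators, shortest paths -/

section Graph

variable {V : Type*}

/-- The subgraph induced by `B` is connected and remains connected after removal of any
single node. -/
def IsBiconnected (G : SimpleGraph V) (B : Set V) : Prop :=
  (G.induce B).Connected ∧ ∀ v ∈ B, (G.induce (B \ {v})).Preconnected

/-- Every block (maximal biconnected node set) is a clique. -/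
def IsBlockGraph (G : SimpleGraph V) : Prop :=
  ∀ B : Set V, Maximal (IsBiconnected G) B → G.IsClique B

/-- `C` is a maximal clique. -/
def IsMaxClique (G : SimpleGraph V) (C : Set V) : Prop :=
  Maximal G.IsClique C

/-- Every path from a node of `A` to a node of `B` passes through a node of `S`. -/
def IsSeparator (G : SimpleGraph V) (A B S : Set V) : Prop :=
  ∀ a ∈ A, ∀ b ∈ B, ∀ p : G.Walk a b, p.IsPath → ∃ s ∈ S, s ∈ p.support

/-- The nodes `s` such that `{s}` is a minimal separator of two distinct maximal cliques. -/
def cliqueSeparators (G : SimpleGraph V) : Set V :=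
  {s | ∃ C D : Set V, IsMaxClique G C ∧ IsMaxClique G D ∧ C ≠ D ∧
    Minimal (IsSeparator G C D) {s}}

/-- The nodes on the shortest path from `u` to `v` (unique in a connected block graph),
end points included. -/
def pathNodes (G : SimpleGraph V) (u v : V) : Set V :=
  {w | ∃ p : G.Walk u v, p.IsPath ∧ p.length = G.dist u v ∧ w ∈ p.support}

/-- The directed edges `(a, b)`, in the direction of travel, on the shortest path from `u` to
`v` (unique in a connected block graph). It is empty if `u = v`. -/
def pathEdges (G : SimpleGraph V) (u v : V) : Set (V × V) :=
  {e | ∃ p : G.Walk u v, p.IsPath ∧ p.length = G.dist u v ∧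
    ∃ d ∈ p.darts, d.fst = e.1 ∧ d.snd = e.2}

/-- `s` is the separator node in the clique `C` between `u` and the nodes of `C`:
it is `u` itself if `u ∈ C`, and otherwise the node of `C` through which all paths from `u` to
nodes of `C` pass. -/
def IsEntryNode (G : SimpleGraph V) (u : V) (C : Set V) (s : V) : Prop :=
  (u ∈ C ∧ s = u) ∨
    (u ∉ C ∧ s ∈ C ∧ ∀ v ∈ C, ∀ p : G.Walk u v, p.IsPath → s ∈ p.support)

/-- Pairs `(C, s)` of a maximal clique `C` and its separator node `s` as seen from `u`. -/
def EntryPair (G : SimpleGraph V) (u : V) : Type _ :=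
  {q : Set V × V // IsMaxClique G q.1 ∧ IsEntryNode G u q.1 q.2}

end Graph

/-! ### Markov random fields -/

section Markov

variable {V : Type*} [Fintype V]

/-- Global Markov property of a law `L` on `[0, ∞)^V`: for non-empty, pairwise disjoint
`A, B, S` such that `S` separates `A` and `B`, the coordinates in `A` and those in `B` are
conditionally independent given those in `S`. -/
def GlobalMarkov (G : SimpleGraph V) (L : Measure (V → ℝ≥0)) [IsFiniteMeasure L] : Prop :=
  ∀ A B S : Set V, A.Nonempty → B.Nonempty → S.Nonempty →
    Disjoint A B → Disjoint A S → Disjoint B S → IsSeparator G A B S →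
    CondIndepFun
      (MeasurableSpace.comap (fun (x : V → ℝ≥0) (v : ↥S) => x v) inferInstance)
      (Measurable.comap_le (by fun_prop))
      (fun (x : V → ℝ≥0) (v : ↥A) => x v) (fun (x : V → ℝ≥0) (v : ↥B) => x v) L

variable {Ω : Type*} [MeasurableSpace Ω]

/-- `X` is a non-negative Markov random field with respect to `G`
(conditional independence being a property of the joint law). -/
def IsMarkovField (G : SimpleGraph V) (P : Measure Ω) [IsProbabilityMeasure P]
    (X : Ω → V → ℝ≥0) : Prop :=
  Measurable X ∧ GlobalMarkov G (P.map X)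

/-- For every maximal clique `C` and every `s ∈ C`, the kernel `κ C s` is a version of the
conditional law of `(X_v, v ∈ C \ s)` given `X_s`. -/
def IsCliqueCondLaw (G : SimpleGraph V) (P : Measure Ω) [IsProbabilityMeasure P]
    (X : Ω → V → ℝ≥0)
    (κ : (C : Set V) → (s : V) → Kernel ℝ≥0 (↥(C \ {s}) → ℝ≥0))
    [∀ C s, IsMarkovKernel (κ C s)] : Prop :=
  ∀ C : Set V, IsMaxClique G C → ∀ s ∈ C,
    HasCondDistrib (fun ω (v : ↥(C \ {s})) => X ω v) (fun ω => X ω s) (κ C s) P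

/-- For every maximal clique `C` and every `s ∈ C`, the law of `(X_v / t, v ∈ C \ s)` given
`X_s = t` converges weakly to `ν C s` as `t → ∞`. -/
def CliqueTailLimit (G : SimpleGraph V)
    (κ : (C : Set V) → (s : V) → Kernel ℝ≥0 (↥(C \ {s}) → ℝ≥0))
    [∀ C s, IsMarkovKernel (κ C s)]
    (ν : (C : Set V) → (s : V) → ProbabilityMeasure (↥(C \ {s}) → ℝ≥0)) : Prop :=
  ∀ C : Set V, IsMaxClique G C → ∀ s ∈ C,
    TendstoInDistribution (fun (t : ℝ≥0) (y : ↥(C \ {s}) → ℝ≥0) (v : ↥(C \ {s})) => y v / t)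
      atTop id (fun t => κ C s t) (ν C s : Measure (↥(C \ {s}) → ℝ≥0))

/-- The condition that prevents the field from becoming large again after it has been small:
for a node `u` and a clique separator `s`, and a maximal clique `C` that contains `s` but no
other node of the shortest path from `u` to `s`, if some limit increment on an edge `(a, b)` of
that path has an atom at zero, then for all `η > 0`
`limsup_{δ ↓ 0} limsup_{t → ∞} sup_{x ∈ [0, δ]} P(∃ v ∈ C \ s, X_v / t > η | X_s / t = x) = 0`. -/
def ZeroCondition (G : SimpleGraph V)
    (κ : (C : Set V) → (s : V) → Kernel ℝ≥0 (↥(C \ {s}) → ℝ≥0))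
    (ν : (C : Set V) → (s : V) → ProbabilityMeasure (↥(C \ {s}) → ℝ≥0)) : Prop :=
  ∀ u : V, ∀ s ∈ cliqueSeparators G, ∀ C : Set V, IsMaxClique G C →
    C ∩ pathNodes G u s = {s} →
    (∃ a b : V, (a, b) ∈ pathEdges G u s ∧ ∃ C' : Set V, IsMaxClique G C' ∧ a ∈ C' ∧
      ∃ hb : b ∈ C' \ {a},
        0 < (ν C' a : Measure (↥(C' \ {a}) → ℝ≥0)) {y | y ⟨b, hb⟩ = 0}) →
    ∀ η : ℝ≥0, 0 < η →
      limsup (fun δ : ℝ≥0 =>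
        limsup (fun t : ℝ≥0 =>
          ⨆ x ∈ Set.Icc (0 : ℝ≥0) δ, κ C s (t * x) {y | ∃ v, η < y v / t}) atTop)
        (𝓝[>] 0) = 0

end Markov

/-! ### Increments and the limiting field -/

section Increments

variable {V : Type*} [Fintype V] {Ω : Type*} [MeasurableSpace Ω]

/-- `Z` is the vector of increments for the source node `u`: for each maximal clique `C` with
separator node `s` as seen from `u`, the vector `(Z_{sv}, v ∈ C \ s)` has law `ν C s`, and these
vectors are independent as `C` varies. Only the entries `Z s v` with `s` the separator node of a
clique `C` and `v ∈ C \ s` are meaningful. -/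
structure IsIncrement (G : SimpleGraph V)
    (ν : (C : Set V) → (s : V) → ProbabilityMeasure (↥(C \ {s}) → ℝ≥0))
    (u : V) (Q : Measure Ω) (Z : V → V → Ω → ℝ≥0) : Prop where
  hasLaw : ∀ q : EntryPair G u,
    HasLaw (fun ω (v : ↥(q.1.1 \ {q.1.2})) => Z q.1.2 v ω)
      (ν q.1.1 q.1.2 : Measure (↥(q.1.1 \ {q.1.2}) → ℝ≥0)) Q
  indep : iIndepFun
    (fun (q : EntryPair G u) ω (v : ↥(q.1.1 \ {q.1.2})) => Z q.1.2 v ω) Q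

open Classical in
/-- `A_{uv} = ∏_{e ∈ path(u, v)} Z_e`; in particular `A_{uu} = 1`. -/
def limitField (G : SimpleGraph V) (Z : V → V → Ω → ℝ≥0) (u : V) (ω : Ω) (v : V) : ℝ≥0 :=
  ∏ e ∈ (pathEdges G u v).toFinset, Z e.1 e.2 ω

end Increments

/-! ### Measures on the punctured orthant, exponent measures -/

section Punctured

variable {V : Type*} [Fintype V]

/-- `[0, ∞)^V \ {0}`. -/
abbrev Punctured (V : Type*) : Type _ := {x : V → ℝ≥0 // x ≠ 0}

/-- Borel measures on the punctured orthant that are finite on sets bounded away from `0`. -/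
structure M0 (V : Type*) [Fintype V] where
  toMeasure : Measure (Punctured V)
  finite_away : ∀ ε : ℝ≥0, 0 < ε → toMeasure {x | ∃ v, ε ≤ x.1 v} < ∞

/-- Bounded continuous functions on the punctured orthant that vanish near the origin. -/
def TestFun (V : Type*) [Fintype V] : Type _ :=
  {f : BoundedContinuousFunction (Punctured V) ℝ //
    ∃ ε : ℝ≥0, 0 < ε ∧ ∀ x : Punctured V, (∀ v, x.1 v < ε) → f x = 0}

/-- The smallest topology that makes all maps `μ ↦ ∫ f dμ`, `f` a test function, continuous. -/
instance : TopologicalSpace (M0 V) :=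
  ⨅ f : TestFun V, TopologicalSpace.induced (fun μ : M0 V => ∫ x, f.1 x ∂μ.toMeasure) inferInstance

/-- The measure `t P(t⁻¹ X ∈ ·)` on the punctured orthant. -/
def scaledTail {Ω : Type*} [MeasurableSpace Ω] (P : Measure Ω) [IsProbabilityMeasure P]
    (X : Ω → V → ℝ≥0) (t : ℝ≥0) : M0 V where
  toMeasure := t • (P.map (fun ω v => X ω v / t)).comap Subtype.val
  finite_away := fun ε _ => by
    have h : (P.map (fun ω v => X ω v / t)).comap (Subtype.val : Punctured V → V → ℝ≥0)
        {x | ∃ v, ε ≤ x.1 v} < ∞ := by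
      have e : MeasurableEmbedding (Subtype.val : Punctured V → V → ℝ≥0) :=
        MeasurableEmbedding.subtype_coe (measurableSet_singleton (0 : V → ℝ≥0)).compl
      rw [e.comap_apply]
      exact measure_lt_top _ _
    rw [Measure.smul_apply]
    exact ENNReal.mul_lt_top ENNReal.coe_lt_top h

/-- The max-stable distribution function with exponent measure `μ`:
`G(z) = exp(-μ{x : ∃ v, x_v > z_v})` for `z ∈ (0, ∞]^V`. -/
def maxStableCdf (μ : M0 V) (z : V → ℝ≥0∞) : ℝ :=
  Real.exp (-(μ.toMeasure {x | ∃ v, z v < (x.1 v : ℝ≥0∞)}).toReal)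

/-- The stable tail dependence function `ℓ(x) = -log G(1 / x_v, v ∈ V)` for `x ∈ [0, ∞)^V`,
where `1 / 0 = ∞`. -/
def stdf (μ : M0 V) (x : V → ℝ≥0) : ℝ :=
  -Real.log (maxStableCdf μ fun v => (x v : ℝ≥0∞)⁻¹)

/-- `E[∫₀^∞ f(z A) z⁻² dz]` for a random vector `A`. -/
def radialIntegral {Ω : Type*} [MeasurableSpace Ω] (Q : Measure Ω) (A : Ω → V → ℝ≥0)
    (f : (V → ℝ≥0) → ℝ≥0∞) : ℝ≥0∞ :=
  ∫⁻ ω, (∫⁻ z in Set.Ioi (0 : ℝ),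
    f (fun v => z.toNNReal * A ω v) * ENNReal.ofReal (z ^ 2)⁻¹) ∂Q

end Punctured

end

end MarkovBlock

/-!
For a fixed source `u`, the law of `X` is studied where `x_u` is bounded away from zero. The claim
(`tailLimit_limitField`) is that `t P(X / t ∈ ·)` converges there to the law `radialMeasure` of
`z A_u`, where `z` has "law" `z⁻² dz` and is independent of `A_u`. It is proved by induction over
the block graph: a connected block graph is obtained from `{u}` by attaching maximal cliques `C`
one at a time, each in a single node `s`, through which every path from `C` to the older part runs
(`IsBlockGraph.clique_induction`). By the global Markov property the new coordinates depend on the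
older ones through `X_s` only (`map_keep_union`), while the limit field multiplies `A_{us}` by an
independent vector of increments (`map_limitField_union`). So the induction step is a statement
about one transition kernel (`TailLimit.attach`): the conditional mean of `f(X / t)` given the older
coordinates converges to its limit, uniformly where `x_s ≥ δ`, by weak convergence of the kernel.
The part `x_s < δ` is harmless for one of two reasons. If no increment between `u` and `s` has an
atom at zero, then `A_{us} > 0`, and this part has small mass; if one does, the condition on the
kernels keeps the new coordinates small when `x_s` is small.

The limits for two sources `u` and `v` agree on `{x_u > 0, x_v > 0}`, both being limits of the same
measures. Hence they are the restrictions of one measure `N` (`exists_limitMeasure`), and a partition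
of unity turns the convergence on the sets `{x_u ≥ ε}` into convergence away from the origin
(`tendsto_integral_limitMeasure`). The set `{x | ∃ v, z_v < x_v}` has an `N`-null boundary, so its
rescaled probabilities converge, which gives the domain of attraction (`tendsto_cdf_pow`).

The simplifications rest on the identity `N{x_v > c} = c⁻¹`, in which the part of the mass with
`x_u > 0` is `c⁻¹ E[A_{uv}]` (`limitMeasure_split`). If `E[A_{uv}] = 1` for every `v`, nothing is left
for `{x_u = 0}`. For an edge `(a, b)` the rest at `c = 1` is `P(A_{ba} = 0)`, whence
`E[A_{ab}] + P(A_{ba} = 0) = 1` (`lintegral_add_measure_zero_eq_one`); as `A_{ab} = Z_{ab}` on an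
edge, and as the law of an increment does not depend on the source, this is the last claim.
-/

namespace MarkovBlock

noncomputable section

set_option linter.unusedSectionVars false

/-! ### Block graphs -/

section Graph

variable {V : Type*} {G : SimpleGraph V}

theorem IsBlockGraph.isClique_of_isBiconnected [Finite V] (hG : IsBlockGraph G) {B : Set V}
    (hB : IsBiconnected G B) : G.IsClique B := by
  obtain ⟨M, hBM, hM⟩ := (Set.toFinite {B | IsBiconnected G B}).exists_le_maximal hB
  exact (hG M hM).subset hBM

theorem exists_isMaxClique_superset [Finite V] {B : Set V} (hB : G.IsClique B) :
    ∃ C, B ⊆ C ∧ IsMaxClique G C :=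
  (Set.toFinite {B | G.IsClique B}).exists_le_maximal hB

/-- The only consequence of the block property that is used: two neighbours of `s` that are
joined by a path avoiding `s` are adjacent. The path and `s` form a cycle, which is
biconnected. -/
theorem IsBlockGraph.adj_of_isPath [Finite V] (hG : IsBlockGraph G) {s x y : V}
    (hx : G.Adj s x) (hy : G.Adj s y) (hxy : x ≠ y) (p : G.Walk x y) (hp : p.IsPath)
    (hs : s ∉ p.support) : G.Adj x y := by
  classical
  -- a node other than `w` lies on at most one of the two parts into which `w` splits the path
  have key : ∀ v w : V, ∀ hw : w ∈ p.support, v ≠ w →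
      v ∉ (p.takeUntil w hw).support ∨ v ∉ (p.dropUntil w hw).support := by
    intro v w hw hvw
    by_contra! h
    have hn : (p.takeUntil w hw |>.append (p.dropUntil w hw)).support.Nodup := by
      rw [p.take_spec hw]; exact hp.support_nodup
    rw [SimpleGraph.Walk.support_append] at hn
    have h2 : v ∈ (p.dropUntil w hw).support.tail := by
      have := h.2
      rw [SimpleGraph.Walk.mem_support_iff] at this
      exact this.resolve_left hvw
    exact (List.disjoint_of_nodup_append hn) h.1 h2
  have hc : ∀ {a b : V} (q : G.Walk a b) (c : V), c ∈ q.support → G.Adj s c →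
      (G.induce ({s} ∪ {v | v ∈ q.support})).Connected := fun q c hc hsc =>
    SimpleGraph.connected_induce_union
      (by rintro ⟨a, rfl⟩ ⟨b, rfl⟩; rfl)
      q.connected_induce_support.preconnected (Set.mem_singleton s) hc hsc
  have hB : IsBiconnected G ({s} ∪ {v | v ∈ p.support}) := by
    refine ⟨hc p x p.start_mem_support hx, fun v hv => ?_⟩
    by_cases hvs : v = s
    · subst hvs
      have : ({v} ∪ {w | w ∈ p.support}) \ {v} = {w | w ∈ p.support} := by
        ext w; simp only [Set.mem_sdiff, Set.mem_union, Set.mem_singleton_iff, Set.mem_ofPred_eq]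
        constructor
        · tauto
        · intro h; exact ⟨Or.inr h, fun e => hs (e ▸ h)⟩
      rw [this]
      exact p.connected_induce_support.preconnected
    -- after removal of `v ≠ s`, each node `w` of the path is joined to `s` through that part of
    -- the path, from `w` to `x` or from `w` to `y`, which avoids `v`
    · have hvp : v ∈ p.support := hv.resolve_left hvs
      have hsB : s ∈ ({s} ∪ {v | v ∈ p.support}) \ {v} := ⟨Or.inl rfl, fun e => hvs e.symm⟩
      refine (SimpleGraph.induce_connected_of_patches s hsB ?_).preconnected
      rintro w ⟨hw | hw, hwv⟩
      · have hws : w = s := hw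
        subst hws
        exact ⟨{w}, by simpa using Ne.symm hvs, rfl, rfl, SimpleGraph.Reachable.refl _⟩
      · have hw' : w ∈ p.support := hw
        rcases key v w hw' (fun e => hwv (by simp [e])) with h | h
        · refine ⟨{s} ∪ {a | a ∈ (p.takeUntil w hw').support}, ?_, Or.inl rfl,
            Or.inr (SimpleGraph.Walk.end_mem_support _),
            (hc (p.takeUntil w hw') x (SimpleGraph.Walk.start_mem_support _) hx).preconnected _ _⟩
          rintro a (ha | ha)
          · exact ⟨Or.inl ha, fun e => hvs (by rw [← ha]; exact e.symm)⟩
          · exact ⟨Or.inr (p.support_takeUntil_subset_support _ ha), fun e => h (by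
              have e' : a = v := e
              rwa [← e'])⟩
        · refine ⟨{s} ∪ {a | a ∈ (p.dropUntil w hw').support}, ?_, Or.inl rfl,
            Or.inr (SimpleGraph.Walk.start_mem_support _),
            (hc (p.dropUntil w hw') y (SimpleGraph.Walk.end_mem_support _) hy).preconnected _ _⟩
          rintro a (ha | ha)
          · exact ⟨Or.inl ha, fun e => hvs (by rw [← ha]; exact e.symm)⟩
          · exact ⟨Or.inr (p.support_dropUntil_subset_support _ ha), fun e => h (by
              have e' : a = v := e
              rwa [← e'])⟩
  exact hG.isClique_of_isBiconnected hB (Or.inr p.start_mem_support) (Or.inr p.end_mem_support) hxy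

theorem IsBlockGraph.adj_of_walk [Finite V] (hG : IsBlockGraph G) {s x y : V}
    (hx : G.Adj s x) (hy : G.Adj s y) (hxy : x ≠ y) (p : G.Walk x y)
    (hs : s ∉ p.support) : G.Adj x y := by
  classical
  exact hG.adj_of_isPath hx hy hxy p.bypass p.bypass_isPath
    (fun h => hs (p.support_bypass_subset_support h))

/-- Two maximal cliques of a block graph share at most one node. -/
theorem IsBlockGraph.eq_of_isMaxClique [Finite V] (hG : IsBlockGraph G) {C D : Set V}
    (hC : IsMaxClique G C) (hD : IsMaxClique G D) {x y : V} (hxy : x ≠ y)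
    (hxC : x ∈ C) (hyC : y ∈ C) (hxD : x ∈ D) (hyD : y ∈ D) : C = D := by
  have key : ∀ c ∈ C, ∀ d ∈ D, c ≠ d → G.Adj c d := by
    intro c hc d hd hcd
    by_cases h1 : c = x
    · subst h1; exact hD.prop hxD hd hcd
    by_cases h2 : d = x
    · subst h2; exact hC.prop hc hxC hcd
    by_cases h3 : c = y
    · subst h3; exact hD.prop hyD hd hcd
    by_cases h4 : d = y
    · subst h4; exact hC.prop hc hyC hcd
    have a1 := hC.prop hc hyC h3
    have a2 := hD.prop hyD hd (Ne.symm h4)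
    refine hG.adj_of_walk (hC.prop hxC hc (Ne.symm h1)) (hD.prop hxD hd (Ne.symm h2)) hcd
      (.cons a1 (.cons a2 .nil)) ?_
    simp [Ne.symm h1, Ne.symm h2, hxy]
  have hU : G.IsClique (C ∪ D) := by
    rintro a (ha | ha) b (hb | hb) hab
    · exact hC.prop ha hb hab
    · exact key a ha b hb hab
    · exact (key b hb a ha hab.symm).symm
    · exact hD.prop ha hb hab
  have e1 : C = C ∪ D := hC.eq_of_subset hU Set.subset_union_left
  have e2 : D = C ∪ D := hD.eq_of_subset hU Set.subset_union_right
  exact e1.trans e2.symm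

theorem pathEdges_self (u : V) : pathEdges G u u = ∅ := by
  ext e
  simp only [pathEdges, Set.mem_ofPred_eq, Set.mem_empty_iff_false, iff_false]
  rintro ⟨p, -, hl, d, hd, -⟩
  rw [SimpleGraph.dist_self, SimpleGraph.Walk.length_eq_zero_iff] at hl
  rw [hl.eq_nil] at hd
  simp at hd

theorem self_mem_pathNodes (hG : G.Connected) (u s : V) : s ∈ pathNodes G u s := by
  obtain ⟨p, hp, hl⟩ := hG.exists_path_of_dist u s
  exact ⟨p, hp, hl, p.end_mem_support⟩

/-- If every path from `u` to a neighbour `v` of `s` passes through `s`, then the shortest paths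
from `u` to `v` are those to `s`, followed by the edge `(s, v)`. -/
theorem dist_eq_and_pathEdges_eq_insert (hG : G.Connected) {u s v : V} (hsv : G.Adj s v)
    (h : ∀ p : G.Walk u v, p.IsPath → s ∈ p.support) :
    (s, v) ∉ pathEdges G u s ∧ pathEdges G u v = insert (s, v) (pathEdges G u s) := by
  classical
  have hge : ∀ p : G.Walk u v, p.IsPath → G.dist u s + 1 ≤ p.length := by
    intro p hp
    have hs := h p hp
    have h1 := congrArg SimpleGraph.Walk.length (p.take_spec hs)
    rw [SimpleGraph.Walk.length_append] at h1
    have h2 : G.dist u s ≤ (p.takeUntil s hs).length := SimpleGraph.dist_le _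
    have h3 : G.dist s v ≤ (p.dropUntil s hs).length := SimpleGraph.dist_le _
    have h4 : G.dist s v = 1 := SimpleGraph.dist_eq_one_iff_adj.2 hsv
    omega
  have hd : G.dist u v = G.dist u s + 1 := by
    apply le_antisymm
    · have h4 : G.dist s v = 1 := SimpleGraph.dist_eq_one_iff_adj.2 hsv
      rw [← h4]; exact hG.dist_triangle
    · obtain ⟨p, hp, hl⟩ := hG.exists_path_of_dist u v
      rw [← hl]; exact hge p hp
  refine ⟨?_, ?_⟩
  · rintro ⟨p, hp, hl, d, hd', -, h2⟩
    have hv : v ∈ p.support := by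
      have := p.dart_snd_mem_support_of_mem_darts hd'
      simpa [h2] using this
    have h1 := congrArg SimpleGraph.Walk.length (p.take_spec hv)
    rw [SimpleGraph.Walk.length_append] at h1
    have h2 : G.dist u v ≤ (p.takeUntil v hv).length := SimpleGraph.dist_le _
    omega
  · ext ⟨a, b⟩
    simp only [Set.mem_insert_iff, Prod.mk.injEq]
    constructor
    · rintro ⟨p, hp, hl, d, hdp, rfl, rfl⟩
      have hs := h p hp
      have h1 := congrArg SimpleGraph.Walk.length (p.take_spec hs)
      rw [SimpleGraph.Walk.length_append] at h1
      have h2 : G.dist u s ≤ (p.takeUntil s hs).length := SimpleGraph.dist_le _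
      have h3 : G.dist s v ≤ (p.dropUntil s hs).length := SimpleGraph.dist_le _
      have h4 : G.dist s v = 1 := SimpleGraph.dist_eq_one_iff_adj.2 hsv
      have h5 : (p.takeUntil s hs).length = G.dist u s := by omega
      have h6 : (p.dropUntil s hs).length = 1 := by omega
      rw [← p.take_spec hs, SimpleGraph.Walk.darts_append, List.mem_append] at hdp
      rcases hdp with hdp | hdp
      · exact Or.inr ⟨_, hp.takeUntil hs, h5, d, hdp, rfl, rfl⟩
      · left
        generalize p.dropUntil s hs = q at hdp h6
        cases q with
        | nil => simp at h6
        | cons hadj r =>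
          cases r with
          | nil =>
            simp only [SimpleGraph.Walk.darts_cons, SimpleGraph.Walk.darts_nil,
              List.mem_singleton] at hdp
            subst hdp; simp
          | cons _ _ => simp at h6
    · have hext : ∀ q : G.Walk u s, q.length = G.dist u s →
          (q.concat hsv).length = G.dist u v := by
        intro q hq; rw [SimpleGraph.Walk.length_concat, hq, hd]
      rintro (⟨rfl, rfl⟩ | ⟨p, hp, hl, d, hdp, h1, h2⟩)
      · obtain ⟨q, hq, hl⟩ := hG.exists_path_of_dist u a
        refine ⟨q.concat hsv, SimpleGraph.Walk.isPath_of_length_eq_dist _ (hext q hl), hext q hl,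
          ⟨(a, b), hsv⟩, by simp [SimpleGraph.Walk.darts_concat], rfl, rfl⟩
      · exact ⟨p.concat hsv, SimpleGraph.Walk.isPath_of_length_eq_dist _ (hext p hl), hext p hl,
          d, by simp [SimpleGraph.Walk.darts_concat, hdp], h1, h2⟩

theorem pathEdges_of_adj (hG : G.Connected) {a b : V} (hab : G.Adj a b) :
    pathEdges G a b = {(a, b)} := by
  rw [(dist_eq_and_pathEdges_eq_insert hG hab fun p _ => p.start_mem_support).2, pathEdges_self]
  simp

/-- `W` is `{u}` or a connected union of maximal cliques that contains `u`. What matters is stated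
directly: a maximal clique that shares two nodes with `W` is contained in `W`, and every edge on a
shortest path from `u` into `W` starts at the entry node of a maximal clique inside `W`. -/
structure IsCliqueUnion (G : SimpleGraph V) (u : V) (W : Set V) : Prop where
  mem : u ∈ W
  preconnected : (G.induce W).Preconnected
  subset_of_isMaxClique : ∀ D, IsMaxClique G D → ∀ x ∈ D, ∀ y ∈ D, x ∈ W → y ∈ W → x ≠ y → D ⊆ W
  exists_entry : ∀ w ∈ W, ∀ e ∈ pathEdges G u w, ∃ C' : Set V, C' ⊆ W ∧ IsMaxClique G C' ∧
    IsEntryNode G u C' e.1 ∧ e.1 ∈ C' ∧ e.2 ∈ C' \ {e.1}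

/-- The maximal clique `C` can be attached to `W`: it meets `W` in the node `s` only, it contains
further nodes, and every walk from `W` to `C` passes through `s`. -/
structure IsCliqueExtension (G : SimpleGraph V) (u : V) (W C : Set V) (s : V) : Prop where
  isCliqueUnion : IsCliqueUnion G u W
  isMaxClique : IsMaxClique G C
  inter_eq : C ∩ W = {s}
  nonempty : (C \ {s}).Nonempty
  mem_support : ∀ w ∈ W, ∀ v ∈ C, ∀ p : G.Walk w v, s ∈ p.support

namespace IsCliqueExtension

variable {u s : V} {W C : Set V}

theorem mem_left (h : IsCliqueExtension G u W C s) : s ∈ W :=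
  (h.inter_eq.ge rfl).2

theorem mem_right (h : IsCliqueExtension G u W C s) : s ∈ C :=
  (h.inter_eq.ge rfl).1

theorem notMem_of_mem_diff (h : IsCliqueExtension G u W C s) {v : V} (hv : v ∈ C \ {s}) :
    v ∉ W := fun hw => hv.2 (h.inter_eq.le ⟨hv.1, hw⟩)

theorem not_subset (h : IsCliqueExtension G u W C s) : ¬ C ⊆ W := fun hs =>
  let ⟨_, hv⟩ := h.nonempty
  h.notMem_of_mem_diff hv (hs hv.1)

theorem adj (h : IsCliqueExtension G u W C s) {v : V} (hv : v ∈ C \ {s}) : G.Adj s v :=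
  h.isMaxClique.prop h.mem_right hv.1 (fun e => hv.2 e.symm)

theorem isSeparator (h : IsCliqueExtension G u W C s) :
    IsSeparator G (W \ {s}) (C \ {s}) {s} :=
  fun a ha b hb p _ => ⟨s, rfl, h.mem_support a ha.1 b hb.1 p⟩

theorem isEntryNode (h : IsCliqueExtension G u W C s) : IsEntryNode G u C s := by
  by_cases hu : u ∈ C
  · exact Or.inl ⟨hu, (h.inter_eq.le ⟨hu, h.isCliqueUnion.mem⟩).symm⟩
  · exact Or.inr ⟨hu, h.mem_right, fun v hv p _ => h.mem_support u h.isCliqueUnion.mem v hv p⟩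

theorem pathEdges_eq (h : IsCliqueExtension G u W C s) (hG : G.Connected) {v : V}
    (hv : v ∈ C \ {s}) :
    (s, v) ∉ pathEdges G u s ∧ pathEdges G u v = insert (s, v) (pathEdges G u s) :=
  dist_eq_and_pathEdges_eq_insert hG (h.adj hv)
    fun p _ => h.mem_support u h.isCliqueUnion.mem v hv.1 p

/-- Otherwise a shortest path from `u` to `s` would meet `s` before another node of `C`, and once
more at its end. -/
theorem inter_pathNodes (h : IsCliqueExtension G u W C s) (hG : G.Connected) :
    C ∩ pathNodes G u s = {s} := by
  classical
  ext w
  constructor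
  · rintro ⟨hwC, p, hp, -, hw⟩
    by_contra hws
    have h1 := h.mem_support u h.isCliqueUnion.mem w hwC (p.takeUntil w hw)
    have hn : (p.takeUntil w hw |>.append (p.dropUntil w hw)).support.Nodup := by
      rw [p.take_spec hw]; exact hp.support_nodup
    rw [SimpleGraph.Walk.support_append] at hn
    have h2 : s ∈ (p.dropUntil w hw).support.tail := by
      have := (p.dropUntil w hw).end_mem_support
      rw [SimpleGraph.Walk.mem_support_iff] at this
      exact this.resolve_left (fun e => hws e.symm)
    exact (List.disjoint_of_nodup_append hn) h1 h2
  · rintro rfl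
    exact ⟨h.mem_right, self_mem_pathNodes hG u w⟩

/-- Unless `s = u`, the node `s` lies in a maximal clique inside `W`, which it separates from
`C`. -/
theorem mem_cliqueSeparators [Finite V] (h : IsCliqueExtension G u W C s) (hsu : s ≠ u) :
    s ∈ cliqueSeparators G := by
  have hW := h.isCliqueUnion
  obtain ⟨w, hw, hsw⟩ : ∃ w ∈ W, G.Adj s w := by
    obtain ⟨q⟩ := hW.preconnected ⟨s, h.mem_left⟩ ⟨u, hW.mem⟩
    cases q with
    | nil => exact absurd rfl hsu
    | @cons _ w _ ha _ => exact ⟨w, w.2, ha⟩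
  obtain ⟨D, hD, hDm⟩ := exists_isMaxClique_superset (G := G) (B := {s, w})
    (by rw [SimpleGraph.isClique_pair]; exact fun _ => hsw)
  have hsD : s ∈ D := hD (by simp)
  have hwD : w ∈ D := hD (by simp)
  have hDW := hW.subset_of_isMaxClique D hDm s hsD w hwD h.mem_left hw hsw.ne
  refine ⟨D, C, hDm, h.isMaxClique, fun e => h.not_subset (e ▸ hDW), ?_, ?_⟩
  · exact fun a ha b hb p _ => ⟨s, rfl, h.mem_support a (hDW ha) b hb p⟩
  · intro T hT _
    obtain ⟨t, ht, hts⟩ := hT s hsD s h.mem_right .nil (by simp)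
    have : t = s := by simpa using hts
    subst this
    simpa using ht

theorem isCliqueUnion_union [Finite V] (h : IsCliqueExtension G u W C s) (hG : G.Connected)
    (hb : IsBlockGraph G) : IsCliqueUnion G u (W ∪ C) := by
  have hW := h.isCliqueUnion
  refine ⟨Or.inl hW.mem, ?_, ?_, ?_⟩
  · refine (SimpleGraph.induce_union_connected hW.preconnected ?_
      ⟨s, h.mem_left, h.mem_right⟩).preconnected
    intro a b
    by_cases hab : a = b
    · subst hab; rfl
    · exact SimpleGraph.Adj.reachable (h.isMaxClique.prop a.2 b.2 (fun e => hab (Subtype.ext e)))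
  · have mixed : ∀ x ∈ W, ∀ y ∈ C, G.Adj x y → x = s ∨ y = s := by
      intro x hx y hy ha
      have := h.mem_support x hx y hy (.cons ha .nil)
      simp only [SimpleGraph.Walk.support_cons, SimpleGraph.Walk.support_nil, List.mem_cons,
        List.not_mem_nil, or_false] at this
      exact this.imp Eq.symm Eq.symm
    have bothC : ∀ D, IsMaxClique G D → ∀ x ∈ D, ∀ y ∈ D, x ∈ C → y ∈ C → x ≠ y → D ⊆ W ∪ C :=
      fun D hD x hxD y hyD hx hy hxy =>
        (hb.eq_of_isMaxClique hD h.isMaxClique hxy hxD hyD hx hy).le.trans Set.subset_union_right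
    have bothW : ∀ D, IsMaxClique G D → ∀ x ∈ D, ∀ y ∈ D, x ∈ W → y ∈ W → x ≠ y → D ⊆ W ∪ C :=
      fun D hD x hxD y hyD hx hy hxy =>
        (hW.subset_of_isMaxClique D hD x hxD y hyD hx hy hxy).trans Set.subset_union_left
    have hmix : ∀ D, IsMaxClique G D → ∀ x ∈ D, ∀ y ∈ D, x ∈ W → y ∈ C → x ≠ y → D ⊆ W ∪ C := by
      intro D hD x hxD y hyD hx hy hxy
      rcases mixed x hx y hy (hD.prop hxD hyD hxy) with e | e
      · exact bothC D hD x hxD y hyD (e ▸ h.mem_right) hy hxy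
      · exact bothW D hD x hxD y hyD hx (e ▸ h.mem_left) hxy
    rintro D hD x hxD y hyD (hx | hx) (hy | hy) hxy
    · exact bothW D hD x hxD y hyD hx hy hxy
    · exact hmix D hD x hxD y hyD hx hy hxy
    · exact hmix D hD y hyD x hxD hy hx hxy.symm
    · exact bothC D hD x hxD y hyD hx hy hxy
  · have hold : ∀ w ∈ W, ∀ e ∈ pathEdges G u w, ∃ C' : Set V, C' ⊆ W ∪ C ∧ IsMaxClique G C' ∧
        IsEntryNode G u C' e.1 ∧ e.1 ∈ C' ∧ e.2 ∈ C' \ {e.1} := fun w hw e he =>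
      let ⟨C', h1, h2⟩ := hW.exists_entry w hw e he
      ⟨C', h1.trans Set.subset_union_left, h2⟩
    intro w hw e he
    by_cases hwW : w ∈ W
    · exact hold w hwW e he
    · have hwC : w ∈ C \ {s} :=
        ⟨hw.resolve_left hwW, fun e => hwW (by rw [Set.mem_singleton_iff.1 e]; exact h.mem_left)⟩
      rw [(h.pathEdges_eq hG hwC).2] at he
      rcases he with rfl | he
      · exact ⟨C, Set.subset_union_right, h.isMaxClique, h.isEntryNode, h.mem_right, hwC⟩
      · exact hold s h.mem_left e he

end IsCliqueExtension

theorem isCliqueUnion_singleton (u : V) : IsCliqueUnion G u {u} where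
  mem := rfl
  preconnected := by rintro ⟨a, rfl⟩ ⟨b, rfl⟩; rfl
  subset_of_isMaxClique := by
    intro D _ x _ y _ hx hy hxy
    exact absurd (hx.trans hy.symm) hxy
  exists_entry := by
    intro w hw e he
    rw [Set.mem_singleton_iff.1 hw, pathEdges_self] at he
    exact absurd he (Set.notMem_empty _)

/-- A clique union that is not everything can be enlarged by a maximal clique: take an edge `(s, v)`
that leaves `W`, and a maximal clique `C` that contains it. A walk from `W` to `C` that avoids `s`
would make a neighbour of `s` in `W` adjacent to a node of `C` outside `W`. -/
theorem IsCliqueUnion.exists_extension [Finite V] (hG : G.Connected) (hb : IsBlockGraph G) {u : V}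
    {W : Set V} (hW : IsCliqueUnion G u W) (hne : W ≠ Set.univ) :
    ∃ C s, IsCliqueExtension G u W C s := by
  classical
  obtain ⟨v₀, hv₀⟩ := (Set.ne_univ_iff_exists_notMem W).1 hne
  obtain ⟨p⟩ := hG.preconnected u v₀
  obtain ⟨d, -, hs, hv⟩ := p.exists_boundary_dart W hW.mem hv₀
  obtain ⟨⟨s, v⟩, hsv⟩ := d
  simp only at hs hv
  obtain ⟨C, hC, hCm⟩ := exists_isMaxClique_superset (G := G) (B := {s, v})
    (by rw [SimpleGraph.isClique_pair]; exact fun _ => hsv)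
  have hsC : s ∈ C := hC (by simp)
  have hvC : v ∈ C := hC (by simp)
  have hCW : C ∩ W = {s} := by
    ext w
    refine ⟨fun hw => ?_, fun hw => by rw [Set.mem_singleton_iff.1 hw]; exact ⟨hsC, hs⟩⟩
    by_contra hws
    exact hv (hW.subset_of_isMaxClique C hCm w hw.1 s hsC hw.2 hs hws hvC)
  refine ⟨C, s, hW, hCm, hCW, ⟨v, hvC, fun e => hv ?_⟩, ?_⟩
  · rw [Set.mem_singleton_iff.1 e]; exact hs
  intro w hw c hc p
  by_contra hsp
  have hws : w ≠ s := fun e => hsp (e ▸ p.start_mem_support)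
  have hcs : c ≠ s := fun e => hsp (e ▸ p.end_mem_support)
  have hcW : c ∉ W := fun h => hcs (hCW.le ⟨hc, h⟩)
  -- the first edge of a path in `W` from `s` to `w` leads to a neighbour of `s` in `W`
  obtain ⟨q, hq⟩ := (hW.preconnected ⟨s, hs⟩ ⟨w, hw⟩).exists_isPath
  cases q with
  | nil => exact hws rfl
  | @cons _ x _ ha r =>
    rw [SimpleGraph.Walk.cons_isPath_iff] at hq
    let r' : G.Walk x w := r.map (SimpleGraph.Embedding.induce W).toHom
    have hr' : s ∉ r'.support := by
      intro h
      change s ∈ (r.map (SimpleGraph.Embedding.induce W).toHom).support at h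
      rw [SimpleGraph.Walk.support_map, List.mem_map] at h
      obtain ⟨z, hz, hzs⟩ := h
      have : z = ⟨s, hs⟩ := Subtype.ext hzs
      exact hq.2 (this ▸ hz)
    have hsx : G.Adj s x := ha
    have hsc : G.Adj s c := hCm.prop hsC hc hcs.symm
    have hxc : (x : V) ≠ c := fun e => hcW (e ▸ x.2)
    have hadj : G.Adj x c := hb.adj_of_walk hsx hsc hxc (r'.append p) (by
      rw [SimpleGraph.Walk.mem_support_append_iff]; tauto)
    obtain ⟨D, hD, hDm⟩ := exists_isMaxClique_superset (G := G) (B := {s, (x : V), c}) (by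
      intro a ha' b hb' hab
      simp only [Set.mem_insert_iff, Set.mem_singleton_iff] at ha' hb'
      rcases ha' with rfl | rfl | rfl <;> rcases hb' with rfl | rfl | rfl <;>
        first
        | exact absurd rfl hab
        | assumption
        | (apply SimpleGraph.Adj.symm; assumption))
    exact hcW (hW.subset_of_isMaxClique D hDm s (hD (by simp)) x (hD (by simp)) hs x.2 hsx.ne
      (hD (by simp)))

/-- Induction over a connected block graph: start at `u` and attach maximal cliques one by
one. -/
theorem IsBlockGraph.clique_induction [Finite V] (hb : IsBlockGraph G) (hG : G.Connected) (u : V)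
    {motive : Set V → Prop} (base : motive {u})
    (step : ∀ W C s, IsCliqueExtension G u W C s → motive W → motive (W ∪ C)) :
    motive Set.univ := by
  classical
  have key : ∀ n : ℕ, ∀ W : Set V, IsCliqueUnion G u W → motive W → (Wᶜ).ncard = n →
      motive Set.univ := by
    intro n
    induction n using Nat.strong_induction_on with
    | _ n ih =>
      intro W hW hm hn
      by_cases hne : W = Set.univ
      · exact hne ▸ hm
      obtain ⟨C, s, h⟩ := hW.exists_extension hG hb hne
      refine ih _ ?_ (W ∪ C) (h.isCliqueUnion_union hG hb) (step W C s h hm) rfl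
      rw [← hn]
      obtain ⟨v, hv⟩ := h.nonempty
      refine Set.ncard_lt_ncard ⟨Set.compl_subset_compl.2 Set.subset_union_left, fun hs => ?_⟩
        (Set.toFinite _)
      exact hs (h.notMem_of_mem_diff hv) (Or.inr hv.1)
  exact key _ {u} (isCliqueUnion_singleton u) base rfl

/-- Each edge `(a, b)` on a shortest path from `u` lies in a maximal clique with entry node
`a`. -/
theorem IsBlockGraph.exists_entry [Finite V] (hb : IsBlockGraph G) (hG : G.Connected) {u v : V}
    {e : V × V} (he : e ∈ pathEdges G u v) :
    ∃ C : Set V, IsMaxClique G C ∧ IsEntryNode G u C e.1 ∧ e.1 ∈ C ∧ e.2 ∈ C \ {e.1} := by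
  have : IsCliqueUnion G u Set.univ := hb.clique_induction hG u (isCliqueUnion_singleton u)
    fun W C s h _ => h.isCliqueUnion_union hG hb
  obtain ⟨C, -, h⟩ := this.exists_entry v trivial e he
  exact ⟨C, h⟩

end Graph

/-! ### The measure `z⁻² dz` and radial measures -/

/-- The measure `z⁻² dz` on `(0, ∞)`, as a measure on `ℝ≥0`. -/
def paretoMeasure : Measure ℝ≥0 :=
  ((volume.restrict (Set.Ioi (0 : ℝ))).withDensity fun z => ENNReal.ofReal (z ^ 2)⁻¹).map
    Real.toNNReal

instance : SFinite paretoMeasure := by unfold paretoMeasure; infer_instance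

theorem lintegral_paretoMeasure {f : ℝ≥0 → ℝ≥0∞} (hf : Measurable f) :
    ∫⁻ z, f z ∂paretoMeasure =
      ∫⁻ z in Set.Ioi (0 : ℝ), f z.toNNReal * ENNReal.ofReal (z ^ 2)⁻¹ := by
  rw [paretoMeasure, lintegral_map hf measurable_real_toNNReal,
    lintegral_withDensity_eq_lintegral_mul _ (by fun_prop) (by fun_prop)]
  simp only [Pi.mul_apply, mul_comm]

theorem paretoMeasure_Ioi {a : ℝ≥0} (ha : 0 < a) :
    paretoMeasure (Set.Ioi a) = (a : ℝ≥0∞)⁻¹ := by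
  have ha' : (0 : ℝ) < a := ha
  have hpre : Real.toNNReal ⁻¹' Set.Ioi a = Set.Ioi (a : ℝ) := by
    ext z; simp [Real.lt_toNNReal_iff_coe_lt]
  rw [paretoMeasure, Measure.map_apply measurable_real_toNNReal measurableSet_Ioi, hpre,
    withDensity_apply _ measurableSet_Ioi, Measure.restrict_restrict measurableSet_Ioi,
    Set.inter_eq_left.2 (Set.Ioi_subset_Ioi ha'.le)]
  have h1 : Set.EqOn (fun z : ℝ => z ^ (-2 : ℝ)) (fun z : ℝ => (z ^ 2)⁻¹) (Set.Ioi (a : ℝ)) := by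
    intro z hz
    have : 0 < z := ha'.trans hz
    simp only
    rw [Real.rpow_neg this.le]; norm_num
  have hi : IntegrableOn (fun z : ℝ => (z ^ 2)⁻¹) (Set.Ioi (a : ℝ)) :=
    (integrableOn_Ioi_rpow_of_lt (by norm_num : (-2 : ℝ) < -1) ha').congr_fun h1 measurableSet_Ioi
  rw [← ofReal_integral_eq_lintegral_ofReal hi (ae_of_all _ fun z => by positivity),
    ← setIntegral_congr_fun measurableSet_Ioi h1, integral_Ioi_rpow_of_lt (by norm_num) ha']
  norm_num
  rw [Real.rpow_neg_one, ENNReal.ofReal_inv_of_pos ha', ENNReal.ofReal_coe_nnreal]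

instance : NullSingletonClass paretoMeasure := by
  constructor
  intro a
  rw [paretoMeasure, Measure.map_apply measurable_real_toNNReal (measurableSet_singleton a)]
  refine withDensity_absolutelyContinuous _ _ ?_
  rw [Measure.restrict_apply (measurable_real_toNNReal (measurableSet_singleton a))]
  refine measure_mono_null (t := {(a : ℝ)}) ?_ (measure_singleton _)
  rintro z ⟨hz, hz0⟩
  have hz1 : z.toNNReal = a := hz
  rw [Set.mem_singleton_iff, ← hz1, Real.coe_toNNReal z (le_of_lt hz0)]

theorem paretoMeasure_lt_mul {a c : ℝ≥0} (hc : 0 < c) :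
    paretoMeasure {z | c < z * a} = (c : ℝ≥0∞)⁻¹ * a := by
  rcases eq_or_ne a 0 with rfl | ha
  · simp
  have ha' : 0 < a := pos_iff_ne_zero.2 ha
  have : {z : ℝ≥0 | c < z * a} = Set.Ioi (c / a) := by
    ext z; simp [div_lt_iff₀ ha']
  rw [this, paretoMeasure_Ioi (div_pos hc ha'), ENNReal.coe_div ha,
    ENNReal.inv_div (Or.inl ENNReal.coe_ne_top) (Or.inl (by simpa using ha)),
    ENNReal.div_eq_inv_mul]

theorem paretoMeasure_mul_eq {a c : ℝ≥0} (hc : c ≠ 0) :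
    paretoMeasure {z | z * a = c} = 0 := by
  rcases eq_or_ne a 0 with rfl | ha
  · simp [hc.symm]
  refine measure_mono_null (t := {c / a}) ?_ (measure_singleton _)
  intro z hz
  rw [Set.mem_singleton_iff, eq_div_iff ha]; exact hz

section Radial

variable {V : Type*} [Fintype V]

/-- The law of `z A`, for `A` with law `α` and an independent `z` distributed according to the
infinite measure `z⁻² dz`. -/
def radialMeasure (α : Measure (V → ℝ≥0)) : Measure (V → ℝ≥0) :=
  (α.prod paretoMeasure).map fun p v => p.2 * p.1 v

theorem lintegral_radialMeasure (α : Measure (V → ℝ≥0)) {f : (V → ℝ≥0) → ℝ≥0∞}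
    (hf : Measurable f) :
    ∫⁻ x, f x ∂radialMeasure α = ∫⁻ a, ∫⁻ z, f (fun v => z * a v) ∂paretoMeasure ∂α := by
  rw [radialMeasure, lintegral_map hf (by fun_prop),
    lintegral_prod _ (by fun_prop)]

theorem radialMeasure_apply (α : Measure (V → ℝ≥0)) {s : Set (V → ℝ≥0)} (hs : MeasurableSet s) :
    radialMeasure α s = ∫⁻ a, paretoMeasure {z | (fun v => z * a v) ∈ s} ∂α := by
  rw [← lintegral_indicator_one hs, lintegral_radialMeasure _ (by fun_prop (disch := exact hs))]
  refine lintegral_congr fun a => ?_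
  have hm : Measurable fun (z : ℝ≥0) (v : V) => z * a v := by fun_prop
  exact lintegral_indicator_one (μ := paretoMeasure) (hm hs)

theorem radialIntegral_eq {Ω : Type*} [MeasurableSpace Ω] (Q : Measure Ω) {A : Ω → V → ℝ≥0}
    (hA : AEMeasurable A Q) {f : (V → ℝ≥0) → ℝ≥0∞} (hf : Measurable f) :
    radialIntegral Q A f = ∫⁻ x, f x ∂radialMeasure (Q.map A) := by
  have hm : Measurable fun p : (V → ℝ≥0) × ℝ≥0 => f fun v => p.2 * p.1 v := by fun_prop
  rw [lintegral_radialMeasure _ hf,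
    lintegral_map' (Measurable.lintegral_prod_right' hm).aemeasurable hA]
  refine lintegral_congr fun ω => ?_
  rw [lintegral_paretoMeasure (by fun_prop)]

variable {α : Measure (V → ℝ≥0)}

theorem radialMeasure_lt (α : Measure (V → ℝ≥0)) {c : ℝ≥0} (hc : 0 < c) (v : V) :
    radialMeasure α {x | c < x v} = (c : ℝ≥0∞)⁻¹ * ∫⁻ a, (a v : ℝ≥0∞) ∂α := by
  rw [radialMeasure_apply _ (measurableSet_lt (by fun_prop) (by fun_prop)),
    ← lintegral_const_mul _ (by fun_prop)]
  exact lintegral_congr fun a => paretoMeasure_lt_mul hc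

theorem radialMeasure_eq (α : Measure (V → ℝ≥0)) {c : ℝ≥0} (hc : c ≠ 0) (v : V) :
    radialMeasure α {x | x v = c} = 0 := by
  rw [radialMeasure_apply _ (measurableSet_eq_fun (by fun_prop) (by fun_prop))]
  simp only [Set.mem_ofPred_eq, paretoMeasure_mul_eq hc, lintegral_zero]

theorem radialMeasure_source_lt [IsProbabilityMeasure α] {u : V} (hu : ∀ᵐ a ∂α, a u = 1)
    {c : ℝ≥0} (hc : 0 < c) : radialMeasure α {x | c < x u} = (c : ℝ≥0∞)⁻¹ := by
  rw [radialMeasure_lt α hc, lintegral_congr_ae (g := fun _ => 1)]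
  · simp
  · filter_upwards [hu] with a ha
    simp [ha]

/-- The radial measure of `A` is concentrated on `{x_v > 0}` as soon as `A_v > 0` almost
surely. -/
theorem radialMeasure_eq_zero_of_pos {v : V} (hv : ∀ᵐ a ∂α, 0 < a v) :
    radialMeasure α {x | x v = 0} = 0 := by
  rw [radialMeasure_apply _ (measurableSet_eq_fun (by fun_prop) (by fun_prop)),
    lintegral_congr_ae (g := fun _ => 0), lintegral_zero]
  filter_upwards [hv] with a ha
  refine measure_mono_null (t := {0}) ?_ (measure_singleton _)
  intro z hz
  have : z * a v = 0 := hz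
  simpa [ha.ne'] using this

end Radial

/-- Convergence of the tails `m_t(c, ∞)` for all `c > 0` implies convergence of integrals of
continuous functions supported by a compact subset of `(0, ∞)`: these are uniform limits of step
functions. -/
theorem tendsto_integral_of_tendsto_Ioi {ι : Type*} {l : Filter ι} {m : ι → Measure ℝ≥0}
    {m' : Measure ℝ≥0} (hm : ∀ i c, 0 < c → m i (Set.Ioi c) ≠ ∞)
    (hm' : ∀ c, 0 < c → m' (Set.Ioi c) ≠ ∞)
    (h : ∀ c, 0 < c → Tendsto (fun i => (m i).real (Set.Ioi c)) l (𝓝 (m'.real (Set.Ioi c))))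
    {φ : ℝ≥0 → ℝ} (hφ : Continuous φ) {ε R : ℝ≥0} (hε : 0 < ε) (h0 : ∀ z < ε, φ z = 0)
    (hR : ∀ z, R < z → φ z = 0) :
    Tendsto (fun i => ∫ z, φ z ∂m i) l (𝓝 (∫ z, φ z ∂m')) := by
  have hsupp : HasCompactSupport φ := HasCompactSupport.intro' (K := Set.Icc 0 R) isCompact_Icc
    isClosed_Icc (fun z hz => hR z (by simpa using hz))
  have huc : UniformContinuous φ := hsupp.uniformContinuous_of_continuous hφ
  obtain ⟨a, ha0, haε⟩ := exists_between hε
  rw [Metric.tendsto_nhds]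
  intro η hη
  obtain ⟨K, hK0, hK⟩ : ∃ K : ℝ, 0 < K ∧ m'.real (Set.Ioi a) < K :=
    ⟨m'.real (Set.Ioi a) + 1, by positivity, by linarith⟩
  obtain ⟨δ, hδ, hδφ⟩ := Metric.uniformContinuous_iff.1 huc (η / (4 * K)) (by positivity)
  lift δ to ℝ≥0 using hδ.le
  obtain ⟨d, hd0, hdδ⟩ := exists_between (show (0 : ℝ≥0) < δ by exact_mod_cast hδ)
  obtain ⟨n, hn⟩ := exists_nat_ge (R / d)
  have hn' : R ≤ n * d := by rwa [div_le_iff₀ hd0] at hn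
  -- the step function `S` takes the value `φ (p i)` on `(p i, p (i + 1)]`, for `i < n`
  let p : ℕ → ℝ≥0 := fun i => a + i * d
  have hp0 : ∀ i, 0 < p i := fun i => by positivity
  let S : ℝ≥0 → ℝ := fun z => ∑ i ∈ Finset.range n,
    (φ (p i) * (Set.Ioi (p i)).indicator 1 z - φ (p i) * (Set.Ioi (p (i + 1))).indicator 1 z)
  have hpm : StrictMono p := fun i j hij => by
    have : (i : ℝ≥0) < j := by exact_mod_cast hij
    simp only [p]; gcongr
  have hS : ∀ z, ∀ i < n, p i < z → z ≤ p (i + 1) → S z = φ (p i) := by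
    intro z i hi h1 h2
    simp only [S]
    rw [Finset.sum_eq_single_of_mem i (Finset.mem_range.2 hi)]
    · rw [Set.indicator_of_mem (show z ∈ Set.Ioi (p i) from h1),
        Set.indicator_of_notMem (show z ∉ Set.Ioi (p (i + 1)) from not_lt.2 h2)]; simp
    · intro j _ hji
      rcases lt_or_gt_of_ne hji with hj | hj
      · rw [Set.indicator_of_mem (show z ∈ Set.Ioi (p j) from (hpm hj).trans h1),
          Set.indicator_of_mem (show z ∈ Set.Ioi (p (j + 1)) from
            (hpm.monotone (Nat.succ_le_of_lt hj)).trans_lt h1)]; simp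
      · rw [Set.indicator_of_notMem (show z ∉ Set.Ioi (p j) from
            not_lt.2 (h2.trans (hpm.monotone (Nat.succ_le_of_lt hj)))),
          Set.indicator_of_notMem (show z ∉ Set.Ioi (p (j + 1)) from
            not_lt.2 (h2.trans (hpm.monotone (Nat.succ_le_of_lt (Nat.lt_succ_of_lt hj)))))]; simp
  have hSlow : ∀ z ≤ a, S z = 0 := by
    intro z hz
    refine Finset.sum_eq_zero fun i _ => ?_
    have : ∀ j, z ∉ Set.Ioi (p j) := fun j => not_lt.2 (hz.trans (by simp [p]))
    rw [Set.indicator_of_notMem (this _), Set.indicator_of_notMem (this _)]; simp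
  have hShigh : ∀ z, p n < z → S z = 0 := by
    intro z hz
    refine Finset.sum_eq_zero fun i hi => ?_
    have hi' := Finset.mem_range.1 hi
    rw [Set.indicator_of_mem (show z ∈ Set.Ioi (p i) from (hpm hi').trans hz),
      Set.indicator_of_mem (show z ∈ Set.Ioi (p (i + 1)) from
        (hpm.monotone (Nat.succ_le_of_lt hi')).trans_lt hz)]; simp
  have hbd : ∀ z, |φ z - S z| ≤ (Set.Ioi a).indicator (fun _ => η / (4 * K)) z := by
    intro z
    by_cases hza : z ≤ a
    · rw [hSlow z hza, h0 z (hza.trans_lt haε)]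
      rw [Set.indicator_of_notMem (show z ∉ Set.Ioi a from not_lt.2 hza)]; simp
    rw [Set.indicator_of_mem (show z ∈ Set.Ioi a from not_le.1 hza)]
    by_cases hzn : p n < z
    · rw [hShigh z hzn, hR z (by
        refine lt_of_le_of_lt (hn'.trans ?_) hzn
        simp [p])]
      simp; positivity
    -- the cell of the partition that contains `z`
    have hex : ∃ i, z ≤ p i := ⟨n, not_lt.1 hzn⟩
    classical
    have hi := Nat.find_spec hex
    have hi0 : Nat.find hex ≠ 0 := by
      intro e
      rw [e] at hi
      exact hza (by simpa [p] using hi)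
    obtain ⟨i, hi'⟩ := Nat.exists_eq_succ_of_ne_zero hi0
    have hlt : p i < z := not_le.1 (Nat.find_min hex (by omega))
    have hin : i < n := by
      have := Nat.find_min' hex (not_lt.1 hzn)
      omega
    rw [hi'] at hi
    rw [hS z i hin hlt hi, ← Real.dist_eq]
    refine (hδφ ?_).le
    rw [NNReal.dist_eq, abs_of_nonneg (sub_nonneg.2 (by exact_mod_cast hlt.le))]
    have h2 : (z : ℝ) ≤ a + (i + 1) * d := by
      have := NNReal.coe_le_coe.2 hi
      simpa [p] using this
    have h3 : ((p i : ℝ≥0) : ℝ) = a + i * d := by simp [p]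
    have h4 : (d : ℝ) < δ := by exact_mod_cast hdδ
    rw [h3]; linarith
  -- all integrals below are over functions supported by `(a, ∞)`
  have hint : ∀ (k : Measure ℝ≥0), (∀ c, 0 < c → k (Set.Ioi c) ≠ ∞) →
      Integrable S k ∧ Integrable φ k ∧
      ∫ z, S z ∂k = ∑ i ∈ Finset.range n,
        (φ (p i) * k.real (Set.Ioi (p i)) - φ (p i) * k.real (Set.Ioi (p (i + 1)))) ∧
      |∫ z, φ z ∂k - ∫ z, S z ∂k| ≤ η / (4 * K) * k.real (Set.Ioi a) := by
    intro k hk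
    have hi1 : ∀ c, 0 < c → Integrable ((Set.Ioi c).indicator (1 : ℝ≥0 → ℝ)) k := fun c hc =>
      (integrable_indicator_iff measurableSet_Ioi).2 (integrableOn_const (hk c hc))
    have hSi : Integrable S k := integrable_finsetSum _ fun i _ =>
      ((hi1 _ (hp0 _)).const_mul _).sub ((hi1 _ (hp0 _)).const_mul _)
    have hb : Integrable ((Set.Ioi a).indicator fun _ => η / (4 * K)) k :=
      (integrable_indicator_iff measurableSet_Ioi).2 (integrableOn_const (hk a ha0))
    have hd' : Integrable (fun z => φ z - S z) k :=
      hb.mono' (hφ.aestronglyMeasurable.sub hSi.aestronglyMeasurable) (ae_of_all _ hbd)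
    have hφi : Integrable φ k := by
      have := hd'.add hSi
      refine this.congr (ae_of_all _ fun z => by simp)
    refine ⟨hSi, hφi, ?_, ?_⟩
    · simp only [S]
      rw [integral_finsetSum]
      swap
      · exact fun i _ => ((hi1 _ (hp0 _)).const_mul _).sub ((hi1 _ (hp0 _)).const_mul _)
      refine Finset.sum_congr rfl fun i _ => ?_
      rw [integral_sub ((hi1 _ (hp0 _)).const_mul _) ((hi1 _ (hp0 _)).const_mul _),
        integral_const_mul, integral_const_mul, integral_indicator_one measurableSet_Ioi,
        integral_indicator_one measurableSet_Ioi]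
    · rw [← integral_sub hφi hSi]
      refine (abs_integral_le_integral_abs).trans ?_
      refine (integral_mono hd'.abs hb hbd).trans ?_
      rw [integral_indicator_const _ measurableSet_Ioi, smul_eq_mul, mul_comm]
  have hlim : Tendsto (fun i => ∫ z, S z ∂m i) l (𝓝 (∫ z, S z ∂m')) := by
    rw [(hint m' hm').2.2.1]
    simp_rw [fun i => (hint (m i) (hm i)).2.2.1]
    exact tendsto_finsetSum _ fun i _ =>
      ((h _ (hp0 _)).const_mul _).sub ((h _ (hp0 _)).const_mul _)
  filter_upwards [Metric.tendsto_nhds.1 hlim (η / 2) (by positivity),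
    (h a ha0).eventually_lt_const hK] with i hi hiK
  have e1 := (hint (m i) (hm i)).2.2.2
  have e2 := (hint m' hm').2.2.2
  have e3 : η / (4 * K) * (m i).real (Set.Ioi a) < η / 4 := by
    calc _ < η / (4 * K) * K := by gcongr
      _ = η / 4 := by field_simp
  have e4 : η / (4 * K) * m'.real (Set.Ioi a) < η / 4 := by
    calc _ < η / (4 * K) * K := by gcongr
      _ = η / 4 := by field_simp
  rw [Real.dist_eq] at hi ⊢
  rw [abs_lt] at hi ⊢
  rw [abs_le] at e1 e2
  constructor <;> linarith [hi.1, hi.2, e1.1, e1.2, e2.1, e2.2]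

/-! ### Convergence of scaled laws on sets where one coordinate is large -/

section TailLimit

variable {V : Type*} [Fintype V]

/-- The measure `t L(t ·)`, i.e. `t P(X / t ∈ ·)` for `X` with law `L`. -/
def scaledLaw (L : Measure (V → ℝ≥0)) (t : ℝ≥0) : Measure (V → ℝ≥0) :=
  t • L.map fun x v => x v / t

instance (L : Measure (V → ℝ≥0)) [IsFiniteMeasure L] (t : ℝ≥0) :
    IsFiniteMeasure (scaledLaw L t) := by unfold scaledLaw; infer_instance

theorem integral_scaledLaw (L : Measure (V → ℝ≥0)) (t : ℝ≥0) {f : (V → ℝ≥0) → ℝ}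
    (hf : Measurable f) : ∫ x, f x ∂scaledLaw L t = t * ∫ x, f (fun v => x v / t) ∂L := by
  rw [scaledLaw, integral_smul_nnreal_measure, integral_map (Measurable.aemeasurable (by fun_prop))
    hf.aestronglyMeasurable]
  rfl

theorem scaledLaw_lt (L : Measure (V → ℝ≥0)) {t : ℝ≥0} (ht : 0 < t) (c : ℝ≥0) (v : V) :
    scaledLaw L t {x | c < x v} = t * L {x | c * t < x v} := by
  rw [scaledLaw, Measure.smul_apply, Measure.map_apply (by fun_prop)
    (measurableSet_lt (by fun_prop) (by fun_prop)), ENNReal.smul_def, smul_eq_mul]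
  congr 2
  ext x
  simp [lt_div_iff₀ ht]

theorem tendsto_scaledLaw_lt {L : Measure (V → ℝ≥0)} {v : V}
    (h : Tendsto (fun t : ℝ≥0 => (t : ℝ≥0∞) * L {x | t < x v}) atTop (𝓝 1)) {c : ℝ≥0}
    (hc : 0 < c) : Tendsto (fun t => scaledLaw L t {x | c < x v}) atTop (𝓝 (c : ℝ≥0∞)⁻¹) := by
  have h1 : Tendsto (fun t : ℝ≥0 => c * t) atTop atTop := tendsto_id.const_mul_atTop hc
  have h2 := ENNReal.Tendsto.const_mul (a := (c : ℝ≥0∞)⁻¹) (h.comp h1)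
    (Or.inr (by simpa using hc.ne'))
  rw [mul_one] at h2
  refine h2.congr' ?_
  filter_upwards [eventually_gt_atTop 0] with t ht
  rw [scaledLaw_lt L ht]
  simp only [Function.comp, ENNReal.coe_mul]
  rw [← mul_assoc, ← mul_assoc, ENNReal.inv_mul_cancel (by simpa using hc.ne')
    ENNReal.coe_ne_top, one_mul]

/-- Bounded continuous functions that vanish where the coordinate `u` is small. -/
structure IsTailTest (u : V) (f : (V → ℝ≥0) → ℝ) : Prop where
  continuous : Continuous f
  bounded : ∃ B : ℝ, 0 < B ∧ ∀ x, |f x| ≤ B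
  vanish : ∃ ε : ℝ≥0, 0 < ε ∧ ∀ x : V → ℝ≥0, x u < ε → f x = 0

/-- `t L(t ·)` converges to the radial measure of `α` on sets where the coordinate `u` is bounded
away from zero. -/
def TailLimit (u : V) (L α : Measure (V → ℝ≥0)) : Prop :=
  ∀ f : (V → ℝ≥0) → ℝ, IsTailTest u f →
    Tendsto (fun t => ∫ x, f x ∂scaledLaw L t) atTop (𝓝 (∫ x, f x ∂radialMeasure α))

theorem IsTailTest.integrable {u : V} {f : (V → ℝ≥0) → ℝ} (hf : IsTailTest u f)
    {m : Measure (V → ℝ≥0)} (hm : ∀ c : ℝ≥0, 0 < c → m {x | c < x u} ≠ ∞) : Integrable f m := by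
  obtain ⟨B, -, hB⟩ := hf.bounded
  obtain ⟨ε, hε, h0⟩ := hf.vanish
  obtain ⟨c, hc, hcε⟩ := exists_between hε
  have hms : MeasurableSet {x : V → ℝ≥0 | c < x u} :=
    measurableSet_lt (by fun_prop) (by fun_prop)
  have hb : Integrable ({x : V → ℝ≥0 | c < x u}.indicator fun _ => B) m :=
    (integrable_indicator_iff hms).2 (integrableOn_const (hm c hc))
  refine hb.mono' hf.continuous.aestronglyMeasurable (ae_of_all _ fun x => ?_)
  by_cases hx : c < x u
  · rw [Set.indicator_of_mem (show x ∈ {x : V → ℝ≥0 | c < x u} from hx)]; exact hB x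
  · rw [Set.indicator_of_notMem (show x ∉ {x : V → ℝ≥0 | c < x u} from hx),
      h0 x ((not_lt.1 hx).trans_lt hcε)]; simp

theorem IsTailTest.mul {u : V} {f g : (V → ℝ≥0) → ℝ} (hf : IsTailTest u f) (hg : Continuous g)
    {K : ℝ} (hgb : ∀ x, |g x| ≤ K) : IsTailTest u fun x => f x * g x := by
  obtain ⟨B, hB0, hB⟩ := hf.bounded
  obtain ⟨ε, hε, h0⟩ := hf.vanish
  have hK : 0 ≤ K := (abs_nonneg _).trans (hgb 0)
  refine ⟨hf.continuous.mul hg, ⟨B * (K + 1), by positivity, fun x => ?_⟩, ε, hε,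
    fun x hx => by rw [h0 x hx, zero_mul]⟩
  rw [abs_mul]
  exact mul_le_mul (hB x) ((hgb x).trans (by linarith)) (abs_nonneg _) hB0.le

/-- A continuous function on `ℝ≥0` with values in `[0, 1]` that vanishes below `ε / 2` and equals
one above `ε`. -/
def ramp (ε : ℝ≥0) (z : ℝ≥0) : ℝ := min 1 (max 0 (2 * z / ε - 1))

theorem continuous_ramp (ε : ℝ≥0) : Continuous (ramp ε) := by unfold ramp; fun_prop

theorem ramp_nonneg (ε z : ℝ≥0) : 0 ≤ ramp ε z := by unfold ramp; positivity

theorem ramp_le_one (ε z : ℝ≥0) : ramp ε z ≤ 1 := min_le_left _ _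

theorem abs_ramp_le_one (ε z : ℝ≥0) : |ramp ε z| ≤ 1 := by
  rw [abs_of_nonneg (ramp_nonneg _ _)]; exact ramp_le_one _ _

theorem ramp_eq_zero {ε z : ℝ≥0} (hz : z ≤ ε / 2) : ramp ε z = 0 := by
  have h : (z : ℝ) ≤ ε / 2 := by exact_mod_cast hz
  have : 2 * (z : ℝ) / ε - 1 ≤ 0 := by
    rw [sub_nonpos]
    exact div_le_one_of_le₀ (by linarith) ε.2
  rw [ramp, max_eq_left this]; simp

theorem ramp_eq_one {ε z : ℝ≥0} (hε : 0 < ε) (hz : ε ≤ z) : ramp ε z = 1 := by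
  have h : (ε : ℝ) ≤ z := by exact_mod_cast hz
  have h' : (0 : ℝ) < ε := hε
  have : 1 ≤ 2 * (z : ℝ) / ε - 1 := by
    rw [le_sub_iff_add_le, le_div_iff₀ h']; linarith
  rw [ramp, min_eq_left (this.trans (le_max_right _ _))]

theorem isTailTest_ramp (u : V) {ε : ℝ≥0} (hε : 0 < ε) : IsTailTest u fun x => ramp ε (x u) where
  continuous := (continuous_ramp ε).comp (continuous_apply u)
  bounded := ⟨1, one_pos, fun _ => abs_ramp_le_one _ _⟩
  vanish := ⟨ε / 2, by positivity, fun _ hx => ramp_eq_zero hx.le⟩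

/-- Integrals over the scaled laws of functions that live far from the origin are uniformly
small, so that in `TailLimit` it suffices to consider functions of compact support. The bound `2`
stands for any constant. -/
theorem tailLimit_of_hasCompactSupport {u : V} {L α : Measure (V → ℝ≥0)} [IsFiniteMeasure L]
    (hL : ∀ v, ∀ᶠ t : ℝ≥0 in atTop, (t : ℝ≥0∞) * L {x | t < x v} ≤ 2)
    (hα : ∀ c : ℝ≥0, 0 < c → radialMeasure α {x | c < x u} ≠ ∞)
    (h : ∀ f : (V → ℝ≥0) → ℝ, IsTailTest u f → HasCompactSupport f →
      Tendsto (fun t => ∫ x, f x ∂scaledLaw L t) atTop (𝓝 (∫ x, f x ∂radialMeasure α))) :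
    TailLimit u L α := by
  intro f hf
  obtain ⟨B, hB0, hB⟩ := hf.bounded
  -- a continuous cut-off at distance between `R` and `R + 1` from the origin
  let ψ : ℕ → (V → ℝ≥0) → ℝ := fun R x => max 0 (min 1 (R + 1 - dist x 0))
  have hψc : ∀ R, Continuous (ψ R) := fun R => by fun_prop
  have hψ0 : ∀ R x, 0 ≤ ψ R x := fun R x => le_max_left _ _
  have hψ1 : ∀ R x, ψ R x ≤ 1 := fun R x => max_le zero_le_one (min_le_left _ _)
  have hψa : ∀ R x, |ψ R x| ≤ 1 := fun R x => by rw [abs_of_nonneg (hψ0 R x)]; exact hψ1 R x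
  have hψe : ∀ (R : ℕ) x, dist x 0 ≤ R → ψ R x = 1 := fun R x hx => by
    simp only [ψ]; rw [min_eq_left (by linarith)]; simp
  have hψs : ∀ R, HasCompactSupport (ψ R) := fun R =>
    HasCompactSupport.intro (isCompact_closedBall (0 : V → ℝ≥0) (R + 1)) fun x hx => by
      rw [Metric.mem_closedBall, not_le] at hx
      simp only [ψ]
      rw [max_eq_left]
      exact (min_le_right _ _).trans (by linarith)
  have hft : ∀ R, IsTailTest u fun x => f x * ψ R x := fun R => hf.mul (hψc R) (hψa R)
  have hlimR : Tendsto (fun R => ∫ x, f x * ψ R x ∂radialMeasure α) atTop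
      (𝓝 (∫ x, f x ∂radialMeasure α)) := by
    refine tendsto_integral_of_dominated_convergence (fun x => |f x|)
      (fun R => (hft R).continuous.aestronglyMeasurable) (hf.integrable hα).abs
      (fun R => ae_of_all _ fun x => ?_) (ae_of_all _ fun x => ?_)
    · rw [Real.norm_eq_abs, abs_mul]
      exact mul_le_of_le_one_right (abs_nonneg _) (hψa R x)
    · refine tendsto_const_nhds.congr' ?_
      obtain ⟨N, hN⟩ := exists_nat_ge (dist x 0)
      filter_upwards [eventually_ge_atTop N] with R hR
      rw [hψe R x (hN.trans (by exact_mod_cast hR)), mul_one]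
  rw [Metric.tendsto_nhds]
  intro η hη
  obtain ⟨R, hR1, hR2, hR3⟩ : ∃ R : ℕ, |∫ x, f x * ψ R x ∂radialMeasure α -
      ∫ x, f x ∂radialMeasure α| < η / 3 ∧ 0 < R ∧ B * (Fintype.card V * (2 / R)) < η / 3 := by
    have h1 := Metric.tendsto_nhds.1 hlimR (η / 3) (by positivity)
    have h2 : Tendsto (fun R : ℕ => B * (Fintype.card V * (2 / (R : ℝ)))) atTop (𝓝 0) := by
      have := ((tendsto_const_div_atTop_nhds_zero_nat (2 : ℝ)).const_mul
        (Fintype.card V : ℝ)).const_mul B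
      simpa using this
    obtain ⟨R, h⟩ := (h1.and ((eventually_gt_atTop 0).and
      (h2.eventually_lt_const (by positivity : (0 : ℝ) < η / 3)))).exists
    exact ⟨R, h⟩
  have hR0 : (0 : ℝ≥0) < R := by exact_mod_cast hR2
  have hRt : Tendsto (fun t : ℝ≥0 => (R : ℝ≥0) * t) atTop atTop := tendsto_id.const_mul_atTop hR0
  have hcc := h _ (hft R) ((hψs R).mul_left)
  filter_upwards [Metric.tendsto_nhds.1 hcc (η / 3) (by positivity), eventually_gt_atTop 0,
    eventually_all.2 fun v => hRt.eventually (hL v)] with t h1 ht h2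
  have hfin : ∀ c : ℝ≥0, 0 < c → scaledLaw L t {x | c < x u} ≠ ∞ := fun c _ => measure_ne_top _ _
  have hms : MeasurableSet {x : V → ℝ≥0 | ∃ v, (R : ℝ≥0) < x v} := by
    rw [Set.ofPred_exists]
    exact MeasurableSet.iUnion fun v => measurableSet_lt (by fun_prop) (by fun_prop)
  have hfar : (scaledLaw L t).real {x | ∃ v, (R : ℝ≥0) < x v} ≤ Fintype.card V * (2 / R) := by
    have h3 : ∀ v, scaledLaw L t {x | (R : ℝ≥0) < x v} ≤ ENNReal.ofReal (2 / R) := by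
      intro v
      have h4 := h2 v
      rw [scaledLaw_lt L ht]
      rw [ENNReal.ofReal_div_of_pos (by exact_mod_cast hR2),
        ENNReal.le_div_iff_mul_le (Or.inl (by simpa using hR2.ne')) (Or.inl (by simp))]
      simp only [ENNReal.coe_mul, ENNReal.coe_natCast] at h4
      simp only [ENNReal.ofReal_ofNat, ENNReal.ofReal_natCast]
      calc _ = (R : ℝ≥0∞) * t * L {x | (R : ℝ≥0) * t < x v} := by ring
        _ ≤ 2 := h4
    refine ENNReal.toReal_le_of_le_ofReal (by positivity) ?_
    rw [Set.ofPred_exists]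
    refine (measure_iUnion_fintype_le _ _).trans ((Finset.sum_le_sum fun v _ => h3 v).trans ?_)
    rw [Finset.sum_const, nsmul_eq_mul, ENNReal.ofReal_mul (by positivity)]
    simp
  have h5 : |∫ x, f x ∂scaledLaw L t - ∫ x, f x * ψ R x ∂scaledLaw L t| < η / 3 := by
    rw [← integral_sub (hf.integrable hfin) ((hft R).integrable hfin)]
    refine lt_of_le_of_lt (abs_integral_le_integral_abs.trans ?_) hR3
    have hb : Integrable ({x : V → ℝ≥0 | ∃ v, (R : ℝ≥0) < x v}.indicator fun _ => B)
        (scaledLaw L t) := (integrable_indicator_iff hms).2 (integrableOn_const (measure_ne_top _ _))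
    refine (integral_mono ((hf.integrable hfin).sub ((hft R).integrable hfin)).abs hb
      fun x => ?_).trans ?_
    · by_cases hx : ∃ v, (R : ℝ≥0) < x v
      · rw [Set.indicator_of_mem (show x ∈ {x : V → ℝ≥0 | ∃ v, (R : ℝ≥0) < x v} from hx)]
        simp only [Pi.sub_apply]
        rw [← mul_one_sub, abs_mul]
        refine (mul_le_of_le_one_right (abs_nonneg _) ?_).trans (hB x)
        rw [abs_le]; constructor <;> linarith [hψ0 R x, hψ1 R x]
      · rw [Set.indicator_of_notMem (show x ∉ {x : V → ℝ≥0 | ∃ v, (R : ℝ≥0) < x v} from hx)]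
        push Not at hx
        simp only [Pi.sub_apply]
        rw [hψe R x]
        · simp
        · rw [dist_pi_le_iff (by positivity)]
          intro v
          rw [Pi.zero_apply, NNReal.dist_eq]
          simpa using (show ((x v : ℝ≥0) : ℝ) ≤ R by exact_mod_cast hx v)
    · rw [integral_indicator_const _ hms, smul_eq_mul, mul_comm]
      gcongr
  rw [Real.dist_eq] at h1 ⊢
  rw [abs_lt] at h1 h5 hR1 ⊢
  constructor <;> linarith [h1.1, h1.2, h5.1, h5.2, hR1.1, hR1.2]

end TailLimit

/-! ### Attaching a block of coordinates -/

section Glue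

variable {V : Type*} [Fintype V] {D : Set V}

open Classical in
/-- The vector `x`, with the coordinates in `D` replaced by `y`. -/
def glue (D : Set V) (x : V → ℝ≥0) (y : ↥D → ℝ≥0) : V → ℝ≥0 := fun v =>
  if h : v ∈ D then y ⟨v, h⟩ else x v

theorem glue_of_mem {x : V → ℝ≥0} {y : ↥D → ℝ≥0} {v : V} (h : v ∈ D) :
    glue D x y v = y ⟨v, h⟩ := dif_pos h

theorem glue_of_notMem {x : V → ℝ≥0} {y : ↥D → ℝ≥0} {v : V} (h : v ∉ D) :
    glue D x y v = x v := dif_neg h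

@[fun_prop]
theorem continuous_glue {T : Type*} [TopologicalSpace T] {x : T → V → ℝ≥0} {y : T → ↥D → ℝ≥0}
    (hx : Continuous x) (hy : Continuous y) : Continuous fun t => glue D (x t) (y t) := by
  refine continuous_pi fun v => ?_
  by_cases h : v ∈ D
  · simp only [glue_of_mem h]; fun_prop
  · simp only [glue_of_notMem h]; fun_prop

@[fun_prop]
theorem measurable_glue {T : Type*} [MeasurableSpace T] {x : T → V → ℝ≥0} {y : T → ↥D → ℝ≥0}
    (hx : Measurable x) (hy : Measurable y) : Measurable fun t => glue D (x t) (y t) := by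
  refine measurable_pi_lambda _ fun v => ?_
  by_cases h : v ∈ D
  · simp only [glue_of_mem h]; fun_prop
  · simp only [glue_of_notMem h]; fun_prop

theorem map_glue (φ : ℝ≥0 → ℝ≥0) (x : V → ℝ≥0) (y : ↥D → ℝ≥0) :
    (fun v => φ (glue D x y v)) = glue D (fun v => φ (x v)) (fun v => φ (y v)) := by
  ext v
  by_cases h : v ∈ D
  · simp only [glue_of_mem h]
  · simp only [glue_of_notMem h]

theorem dist_glue_lt [Fintype ↥D] {x x' : V → ℝ≥0} {y y' : ↥D → ℝ≥0} {r : ℝ} (hr : 0 < r)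
    (hx : dist x x' < r) (hy : ∀ v, dist (y v) (y' v) < r) :
    dist (glue D x y) (glue D x' y') < r := by
  rw [dist_pi_lt_iff hr]
  intro v
  by_cases h : v ∈ D
  · simp only [glue_of_mem h]; exact hy _
  · simp only [glue_of_notMem h]; exact (dist_le_pi_dist x x' v).trans_lt hx

/-- The law of a vector with law `L`, after the coordinates in `D` have been drawn from the
kernel `κ`, given the coordinate `s`. -/
def attachLaw (D : Set V) (s : V) (L : Measure (V → ℝ≥0)) (κ : Kernel ℝ≥0 (↥D → ℝ≥0)) :
    Measure (V → ℝ≥0) :=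
  (L ⊗ₘ κ.comap (fun x => x s) (measurable_pi_apply s)).map fun p => glue D p.1 p.2

/-- The law of a vector `a` with law `α`, after the coordinates in `D` have been set to `a_s Z` for
an independent `Z` with law `ν`. -/
def attachLimit (D : Set V) (s : V) (α : Measure (V → ℝ≥0)) (ν : Measure (↥D → ℝ≥0)) :
    Measure (V → ℝ≥0) :=
  (α.prod ν).map fun p => glue D p.1 fun v => p.1 s * p.2 v

/-- The conditional mean of `f(X / t)` given the coordinates of `X / t` outside `D`, as a function
of `X / t`; `κ` is the conditional law of the coordinates of `X` in `D` given `X_s`. -/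
def condMean (s : V) (κ : Kernel ℝ≥0 (↥D → ℝ≥0)) (f : (V → ℝ≥0) → ℝ) (t : ℝ≥0) (x : V → ℝ≥0) : ℝ :=
  ∫ y, f (glue D x fun v => y v / t) ∂κ (t * x s)

/-- The limit of `condMean` as `t → ∞`. -/
def limitMean (s : V) (ν : Measure (↥D → ℝ≥0)) (f : (V → ℝ≥0) → ℝ) (x : V → ℝ≥0) : ℝ :=
  ∫ y, f (glue D x fun v => x s * y v) ∂ν

variable {s u : V} {L α : Measure (V → ℝ≥0)} [IsProbabilityMeasure L] [IsProbabilityMeasure α]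
  {κ : Kernel ℝ≥0 (↥D → ℝ≥0)} [IsMarkovKernel κ] {ν : Measure (↥D → ℝ≥0)} [IsProbabilityMeasure ν]
  {f : (V → ℝ≥0) → ℝ}

instance : IsProbabilityMeasure (attachLaw D s L κ) := by
  unfold attachLaw; exact Measure.isProbabilityMeasure_map (Measurable.aemeasurable (by fun_prop))

instance : IsProbabilityMeasure (attachLimit D s α ν) := by
  unfold attachLimit; exact Measure.isProbabilityMeasure_map (Measurable.aemeasurable (by fun_prop))

theorem measurable_condMean (hf : Measurable f) (t : ℝ≥0) : Measurable (condMean s κ f t) := by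
  have h1 : Measurable fun x : V → ℝ≥0 => t * x s := by fun_prop
  have h2 : StronglyMeasurable
      (fun p : (V → ℝ≥0) × (↥D → ℝ≥0) => f (glue D p.1 fun v => p.2 v / t)) :=
    Measurable.stronglyMeasurable (by fun_prop)
  exact (h2.integral_kernel_prod_right' (κ := κ.comap _ h1)).measurable

theorem integral_scaledLaw_attachLaw {B : ℝ} (hf : Measurable f) (hB : ∀ x, |f x| ≤ B) {t : ℝ≥0}
    (ht : 0 < t) :
    ∫ x, f x ∂scaledLaw (attachLaw D s L κ) t = ∫ x, condMean s κ f t x ∂scaledLaw L t := by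
  rw [integral_scaledLaw _ _ hf, integral_scaledLaw _ _ (measurable_condMean hf t), attachLaw,
    integral_map (Measurable.aemeasurable (by fun_prop))
      (Measurable.aestronglyMeasurable (by fun_prop)), Measure.integral_compProd]
  · congr 1
    refine integral_congr_ae (ae_of_all _ fun x => ?_)
    simp only [condMean, Kernel.comap_apply, mul_div_cancel₀ _ ht.ne']
    refine integral_congr_ae (ae_of_all _ fun y => ?_)
    simp only [map_glue fun z => z / t]
  · refine Integrable.of_bound (C := B) (Measurable.aestronglyMeasurable (by fun_prop))
      (ae_of_all _ fun p => hB _)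

/-- Multiplication by a common factor commutes with attaching a block of coordinates. -/
theorem radialMeasure_attachLimit :
    radialMeasure (attachLimit D s α ν) =
      ((radialMeasure α).prod ν).map fun p => glue D p.1 fun v => p.1 s * p.2 v := by
  have hsf : SFinite (radialMeasure α) := by unfold radialMeasure; infer_instance
  refine Measure.ext_of_lintegral _ fun f hf => ?_
  have hm1 : Measurable fun p : ((V → ℝ≥0) × (↥D → ℝ≥0)) × ℝ≥0 =>
      f fun v => p.2 * glue D p.1.1 (fun v => p.1.1 s * p.1.2 v) v := by
    refine hf.comp (measurable_pi_lambda _ fun v => ?_)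
    have : Measurable fun p : ((V → ℝ≥0) × (↥D → ℝ≥0)) × ℝ≥0 =>
      glue D p.1.1 (fun v => p.1.1 s * p.1.2 v) := by fun_prop
    fun_prop
  have hm3 : Measurable fun p : ((V → ℝ≥0) × ℝ≥0) × (↥D → ℝ≥0) =>
      f fun v => p.1.2 * glue D p.1.1 (fun v => p.1.1 s * p.2 v) v := by
    refine hf.comp (measurable_pi_lambda _ fun v => ?_)
    have : Measurable fun p : ((V → ℝ≥0) × ℝ≥0) × (↥D → ℝ≥0) =>
      glue D p.1.1 (fun v => p.1.1 s * p.2 v) := by fun_prop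
    fun_prop
  have hm2 : Measurable fun a : V → ℝ≥0 => ∫⁻ z, f (fun v => z * a v) ∂paretoMeasure :=
    Measurable.lintegral_prod_right' (f := fun p : (V → ℝ≥0) × ℝ≥0 => f fun v => p.2 * p.1 v)
      (by fun_prop)
  have hm4 : Measurable fun x : V → ℝ≥0 => ∫⁻ y, f (glue D x fun v => x s * y v) ∂ν :=
    Measurable.lintegral_prod_right'
      (f := fun p : (V → ℝ≥0) × (↥D → ℝ≥0) => f (glue D p.1 fun v => p.1 s * p.2 v)) (by fun_prop)
  rw [lintegral_radialMeasure _ hf, attachLimit, lintegral_map hm2 (by fun_prop),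
    lintegral_prod _ (by fun_prop), lintegral_map hf (by fun_prop), lintegral_prod _ (by fun_prop),
    lintegral_radialMeasure _ hm4]
  refine lintegral_congr fun a => ?_
  rw [lintegral_lintegral_swap]
  · refine lintegral_congr fun z => lintegral_congr fun y => ?_
    rw [map_glue fun w => z * w]
    simp only [mul_assoc]
  · exact Measurable.aemeasurable (hm1.comp (f := fun q : (↥D → ℝ≥0) × ℝ≥0 => ((a, q.1), q.2))
      (by fun_prop))

theorem attachLimit_source (huD : u ∉ D) (hu : ∀ᵐ a ∂α, a u = 1) :
    ∀ᵐ a ∂attachLimit D s α ν, a u = 1 := by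
  rw [attachLimit, ae_map_iff (Measurable.aemeasurable (by fun_prop))
    (measurableSet_eq_fun (by fun_prop) (by fun_prop))]
  simp only [glue_of_notMem huD]
  exact Measure.quasiMeasurePreserving_fst.ae hu

theorem radialMeasure_source_ne_top (hu : ∀ᵐ a ∂α, a u = 1) (c : ℝ≥0) (hc : 0 < c) :
    radialMeasure α {x | c < x u} ≠ ∞ := by
  rw [radialMeasure_source_lt hu hc]
  simpa using hc.ne'

theorem integral_radialMeasure_attachLimit (huD : u ∉ D) (hu : ∀ᵐ a ∂α, a u = 1)
    (hf : IsTailTest u f) :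
    ∫ x, f x ∂radialMeasure (attachLimit D s α ν) =
      ∫ x, limitMean s ν f x ∂radialMeasure α := by
  have hsf : SFinite (radialMeasure α) := by unfold radialMeasure; infer_instance
  have hi : Integrable f (radialMeasure (attachLimit D s α ν)) :=
    hf.integrable (radialMeasure_source_ne_top (attachLimit_source huD hu))
  have hm : Measurable fun p : (V → ℝ≥0) × (↥D → ℝ≥0) => glue D p.1 fun v => p.1 s * p.2 v := by
    fun_prop
  rw [radialMeasure_attachLimit] at hi ⊢
  rw [integral_map hm.aemeasurable hf.continuous.aestronglyMeasurable, integral_prod]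
  · rfl
  · exact hi.comp_measurable hm

/-- The limit of the conditional means of a test function is again a test function, because `D` does
not contain the source. -/
theorem isTailTest_limitMean (huD : u ∉ D) (hf : IsTailTest u f) :
    IsTailTest u (limitMean s ν f) := by
  obtain ⟨B, hB0, hB⟩ := hf.bounded
  obtain ⟨ε, hε, h0⟩ := hf.vanish
  have hfc := hf.continuous
  refine ⟨?_, ⟨B, hB0, fun x => ?_⟩, ε, hε, fun x hx => ?_⟩
  · refine continuous_of_dominated (bound := fun _ => B)
      (fun x => Continuous.aestronglyMeasurable (by fun_prop))
      (fun x => ae_of_all _ fun y => hB _) (integrable_const _) (ae_of_all _ fun y => by fun_prop)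
  · have := norm_integral_le_of_norm_le_const (μ := ν)
      (f := fun y => f (glue D x fun v => x s * y v)) (ae_of_all _ fun y => hB _)
    simpa [limitMean] using this
  · have : ∀ y : ↥D → ℝ≥0, f (glue D x fun v => x s * y v) = 0 := fun y =>
      h0 _ (by rw [glue_of_notMem huD]; exact hx)
    simp [limitMean, this]

end Glue

/-! ### Uniform convergence of conditional means and the recursion step -/

section Step

variable {V : Type*} [Fintype V] {D : Set V}
variable {s u : V} {L α : Measure (V → ℝ≥0)} [IsProbabilityMeasure L] [IsProbabilityMeasure α]
  {κ : Kernel ℝ≥0 (↥D → ℝ≥0)} [IsMarkovKernel κ] {ν : Measure (↥D → ℝ≥0)} [IsProbabilityMeasure ν]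
  {f : (V → ℝ≥0) → ℝ}

theorem abs_integral_sub_le {T : Type*} [MeasurableSpace T] {μ : Measure T}
    [IsProbabilityMeasure μ] {F H : T → ℝ} (hF : Integrable F μ) (hH : Integrable H μ) {c : ℝ}
    (h : ∀ y, |F y - H y| ≤ c) : |∫ y, F y ∂μ - ∫ y, H y ∂μ| ≤ c := by
  rw [← integral_sub hF hH]
  have := norm_integral_le_of_norm_le_const (μ := μ) (f := fun y => F y - H y)
    (ae_of_all _ fun y => h y)
  simpa using this

theorem exists_forall_eq_zero_of_hasCompactSupport (hfs : HasCompactSupport f) :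
    ∃ R : ℝ≥0, ∀ x, (∃ v, R < x v) → f x = 0 := by
  obtain ⟨r, hr⟩ := hfs.isCompact.isBounded.subset_closedBall (0 : V → ℝ≥0)
  refine ⟨r.toNNReal, fun x ⟨v, hv⟩ => ?_⟩
  by_contra hx
  have h1 := hr (subset_tsupport _ hx)
  rw [Metric.mem_closedBall] at h1
  have h2 := (dist_le_pi_dist x 0 v).trans h1
  rw [Pi.zero_apply, NNReal.dist_eq, NNReal.coe_zero, sub_zero, NNReal.abs_eq] at h2
  exact absurd (NNReal.le_toNNReal_of_coe_le h2) (not_le.2 hv)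

theorem glue_glue (x : V → ℝ≥0) (y y' : ↥D → ℝ≥0) : glue D (glue D x y') y = glue D x y := by
  ext v
  by_cases h : v ∈ D
  · simp only [glue_of_mem h]
  · simp only [glue_of_notMem h]

/-- Weak convergence of the rescaled transition kernel `κ_r(r ·)` to `ν` as `r → ∞`. -/
def KernelLimit (κ : Kernel ℝ≥0 (↥D → ℝ≥0)) (ν : Measure (↥D → ℝ≥0)) : Prop :=
  ∀ F : (↥D → ℝ≥0) → ℝ, Continuous F → (∃ B, ∀ y, |F y| ≤ B) →
    Tendsto (fun r : ℝ≥0 => ∫ y, F (fun v => y v / r) ∂κ r) atTop (𝓝 (∫ y, F y ∂ν))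

/-- The conditional means converge uniformly on sets where the coordinate `s` is bounded away from
zero. By compactness it suffices to look at a neighbourhood of a single point, where the functions
`y ↦ f (glue D x (x_s y))` are uniformly close to each other. -/
theorem eventually_condMean_of_le (hs : s ∉ D) (hν : KernelLimit κ ν)
    (hf : Continuous f) (huc : UniformContinuous f) {B : ℝ} (hB : ∀ x, |f x| ≤ B) {R : ℝ≥0}
    (hR : ∀ x, (∃ v, R < x v) → f x = 0) {δ : ℝ≥0} (hδ : 0 < δ) {η : ℝ} (hη : 0 < η) :
    ∀ᶠ t : ℝ≥0 in atTop, ∀ x : V → ℝ≥0, δ ≤ x s →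
      |condMean s κ f t x - limitMean s ν f x| ≤ η := by
  classical
  have hint : ∀ {T : Type _} [MeasurableSpace T] {μ : Measure T} [IsProbabilityMeasure μ]
      {h : T → V → ℝ≥0}, Measurable h → Integrable (fun y => f (h y)) μ := fun hh =>
    Integrable.of_bound (C := B) (hf.measurable.comp hh).aestronglyMeasurable
      (ae_of_all _ fun y => hB _)
  let K : Set (V → ℝ≥0) := Set.Icc 0 (fun _ => R) ∩ {x | δ ≤ x s}
  have hK : IsCompact K := isCompact_Icc.inter_right (isClosed_le (by fun_prop) (by fun_prop))
  have key : TendstoLocallyUniformlyOn (condMean s κ f) (limitMean s ν f) atTop K := by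
    rw [Metric.tendstoLocallyUniformlyOn_iff]
    intro η' hη' x₀ hx₀
    obtain ⟨ρ, hρ, hfρ⟩ := Metric.uniformContinuous_iff.1 huc (η' / 3) (by positivity)
    -- unless `f` vanishes, `y_v ≤ R / δ`, so that `x_s y_v` moves by at most `r R / δ < ρ`
    let r : ℝ := ρ / (1 + R / δ)
    have hr : 0 < r := by positivity
    -- the integrands for `x` and `x₀` are uniformly close
    have hclose : ∀ x ∈ K, dist x x₀ < r → ∀ y : ↥D → ℝ≥0,
        |f (glue D x fun v => x s * y v) - f (glue D x₀ fun v => x₀ s * y v)| ≤ η' / 3 := by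
      intro x hx hxr y
      by_cases hy : ∃ v, R / δ < y v
      · obtain ⟨v, hv⟩ := hy
        have hlarge : ∀ z ∈ K, f (glue D z fun v => z s * y v) = 0 := by
          intro z hz
          refine hR _ ⟨v, ?_⟩
          rw [glue_of_mem v.2]
          calc R = δ * (R / δ) := by field_simp
            _ < δ * y v := by gcongr
            _ ≤ z s * y v := by gcongr; exact hz.2
        rw [hlarge x hx, hlarge x₀ hx₀]; simp; positivity
      · push Not at hy
        rw [← Real.dist_eq]
        have hle : r ≤ ρ := div_le_self hρ.le (le_add_of_nonneg_right (by positivity))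
        refine (hfρ (dist_glue_lt hρ (hxr.trans_le hle) fun v => ?_)).le
        rw [NNReal.dist_eq, NNReal.coe_mul, NNReal.coe_mul, ← sub_mul, abs_mul, NNReal.abs_eq]
        have h1 : |(x s : ℝ) - x₀ s| < r := by
          rw [← NNReal.dist_eq]; exact (dist_le_pi_dist x x₀ s).trans_lt hxr
        have h2 : (y v : ℝ) ≤ R / δ := by exact_mod_cast hy v
        calc |(x s : ℝ) - x₀ s| * y v ≤ r * (R / δ) := by gcongr
          _ < r * (1 + R / δ) := by gcongr; linarith
          _ = ρ := by simp only [r]; field_simp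
    have hlim := Metric.tendsto_nhds.1 (hν (fun y => f (glue D x₀ fun v => x₀ s * y v))
      (by fun_prop) ⟨B, fun y => hB _⟩) (η' / 3) (by positivity)
    obtain ⟨r₀, hr₀⟩ := eventually_atTop.1 hlim
    refine ⟨K ∩ Metric.ball x₀ r, inter_mem self_mem_nhdsWithin
      (mem_nhdsWithin_of_mem_nhds (Metric.ball_mem_nhds _ hr)), ?_⟩
    filter_upwards [eventually_ge_atTop (r₀ / δ), eventually_gt_atTop 0] with t ht ht0 x hx
    have hxs : 0 < x s := hδ.trans_le hx.1.2
    have htx : r₀ ≤ t * x s := by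
      calc r₀ = r₀ / δ * δ := by field_simp
        _ ≤ t * x s := by gcongr; exact hx.1.2
    -- `t x_s` is the starting point of the kernel, and tends to infinity uniformly in `x ∈ K`
    have e0 : condMean s κ f t x =
        ∫ y, f (glue D x fun v => x s * (y v / (t * x s))) ∂κ (t * x s) := by
      simp only [condMean]
      congr 1
      ext y
      congr 2
      ext v
      congr 1
      field_simp
    have e1 : |condMean s κ f t x -
        ∫ y, f (glue D x₀ fun v => x₀ s * (y v / (t * x s))) ∂κ (t * x s)| ≤ η' / 3 := by
      rw [e0]
      exact abs_integral_sub_le (hint (by fun_prop)) (hint (by fun_prop))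
        fun y => hclose x hx.1 hx.2 fun v => y v / (t * x s)
    have e2 : |limitMean s ν f x - limitMean s ν f x₀| ≤ η' / 3 :=
      abs_integral_sub_le (hint (by fun_prop)) (hint (by fun_prop)) fun y => hclose x hx.1 hx.2 y
    have e3 := hr₀ _ htx
    rw [Real.dist_eq] at e3 ⊢
    change |_ - limitMean s ν f x₀| < _ at e3
    rw [abs_le] at e1 e2
    rw [abs_lt] at e3 ⊢
    constructor <;> linarith [e1.1, e1.2, e2.1, e2.2, e3.1, e3.2]
  rw [tendstoLocallyUniformlyOn_iff_tendstoUniformlyOn_of_compact hK,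
    Metric.tendstoUniformlyOn_iff] at key
  filter_upwards [key η hη] with t ht x hx
  by_cases hxK : ∃ v, v ∉ D ∧ R < x v
  · obtain ⟨v, hv, hvx⟩ := hxK
    have h0 : ∀ y : ↥D → ℝ≥0, f (glue D x y) = 0 := fun y =>
      hR _ ⟨v, by rwa [glue_of_notMem hv]⟩
    simp [condMean, limitMean, h0, hη.le]
  · push Not at hxK
    -- the coordinates in `D` are irrelevant and may be set to zero
    have hx' : glue D x (0 : ↥D → ℝ≥0) ∈ K := by
      refine ⟨⟨fun _ => zero_le, fun v => ?_⟩, ?_⟩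
      · by_cases h : v ∈ D
        · rw [glue_of_mem h]; exact zero_le
        · rw [glue_of_notMem h]; exact hxK v h
      · change δ ≤ glue D x 0 s
        rwa [glue_of_notMem hs]
    have h1 := ht _ hx'
    simp only [condMean, limitMean, glue_glue, glue_of_notMem hs] at h1
    rw [dist_comm, Real.dist_eq] at h1
    exact h1.le

/-- Starting from a small value of the coordinate `s`, the coordinates in `D` remain small,
uniformly in the starting value. -/
def StaysSmall (κ : Kernel ℝ≥0 (↥D → ℝ≥0)) : Prop :=
  ∀ η : ℝ≥0, 0 < η → ∀ θ : ℝ≥0∞, 0 < θ → ∃ δ : ℝ≥0, 0 < δ ∧ ∀ᶠ t : ℝ≥0 in atTop,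
    ∀ x ≤ δ, κ (t * x) {y | ∃ v, η < y v / t} ≤ θ

/-- If the kernel stays small, then both conditional mean and limit are close to the value of `f`
with the coordinates in `D` set to zero, uniformly for small values of the coordinate `s`. -/
theorem exists_condMean_of_staysSmall (hs : s ∉ D) (hν : KernelLimit κ ν) (hκ : StaysSmall κ)
    (hf : Continuous f) (huc : UniformContinuous f) {B : ℝ} (hB0 : 0 < B) (hB : ∀ x, |f x| ≤ B)
    {R : ℝ≥0} (hR : ∀ x, (∃ v, R < x v) → f x = 0) {η : ℝ} (hη : 0 < η) :
    ∃ δ : ℝ≥0, 0 < δ ∧ ∀ᶠ t : ℝ≥0 in atTop, ∀ x : V → ℝ≥0, x s ≤ δ →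
      |condMean s κ f t x - limitMean s ν f x| ≤ η := by
  classical
  have hint : ∀ {T : Type _} [MeasurableSpace T] {μ : Measure T} [IsProbabilityMeasure μ]
      {h : T → V → ℝ≥0}, Measurable h → Integrable (fun y => f (h y)) μ := fun hh =>
    Integrable.of_bound (C := B) (hf.measurable.comp hh).aestronglyMeasurable
      (ae_of_all _ fun y => hB _)
  obtain ⟨ρ, hρ, hfρ⟩ := Metric.uniformContinuous_iff.1 huc (η / 4) (by positivity)
  lift ρ to ℝ≥0 using hρ.le
  have hρ' : (0 : ℝ≥0) < ρ := by exact_mod_cast hρ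
  obtain ⟨δ, hδ, hδκ⟩ := hκ (ρ / 2) (by positivity) (ENNReal.ofReal (η / (8 * B)))
    (by rw [ENNReal.ofReal_pos]; positivity)
  have hzero : ∀ᶠ t : ℝ≥0 in atTop, ∀ x : V → ℝ≥0, x s ≤ δ →
      |condMean s κ f t x - f (glue D x 0)| ≤ η / 2 := by
    filter_upwards [hδκ] with t ht x hx
    let S : Set (↥D → ℝ≥0) := {y | ∃ v, ρ / 2 < y v / t}
    have hS : MeasurableSet S := by
      simp only [S]
      rw [Set.ofPred_exists]
      exact MeasurableSet.iUnion fun v => measurableSet_lt (by fun_prop) (by fun_prop)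
    have hSm : (κ (t * x s)).real S ≤ η / (8 * B) :=
      ENNReal.toReal_le_of_le_ofReal (by positivity) (ht _ hx)
    have hc : f (glue D x 0) = ∫ _, f (glue D x 0) ∂κ (t * x s) := by simp
    have hb : ∀ y : ↥D → ℝ≥0, |f (glue D x fun v => y v / t) - f (glue D x 0)| ≤
        η / 4 + S.indicator (fun _ => 2 * B) y := by
      intro y
      by_cases hy : y ∈ S
      · rw [Set.indicator_of_mem hy]
        refine (abs_sub _ _).trans ?_
        linarith [hB (glue D x fun v => y v / t), hB (glue D x 0)]
      · rw [Set.indicator_of_notMem hy, add_zero, ← Real.dist_eq]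
        refine (hfρ (dist_glue_lt hρ (by simpa using hρ) fun v => ?_)).le
        have h1 : y v / t ≤ ρ / 2 := not_lt.1 fun h => hy ⟨v, h⟩
        have h2 : ((y v / t : ℝ≥0) : ℝ) ≤ ρ / 2 := by exact_mod_cast h1
        rw [Pi.zero_apply, NNReal.dist_eq, NNReal.coe_zero, sub_zero, NNReal.abs_eq]
        linarith
    have hi1 : Integrable (fun y : ↥D → ℝ≥0 => f (glue D x fun v => y v / t)) (κ (t * x s)) :=
      hint (by fun_prop)
    have hi2 : Integrable (S.indicator fun _ => 2 * B) (κ (t * x s)) :=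
      (integrable_const _).indicator hS
    rw [hc, condMean, ← integral_sub hi1 (integrable_const _)]
    refine abs_integral_le_integral_abs.trans ((integral_mono
      (hi1.sub (integrable_const _)).abs ((integrable_const _).add hi2) hb).trans ?_)
    simp only [Pi.add_apply]
    rw [integral_add (integrable_const _) hi2, integral_indicator_const _ hS]
    simp only [integral_const, probReal_univ, smul_eq_mul, one_mul]
    have : (κ (t * x s)).real S * (2 * B) ≤ η / (8 * B) * (2 * B) := by gcongr
    have e : η / (8 * B) * (2 * B) = η / 4 := by field_simp; norm_num
    linarith
  refine ⟨δ, hδ, ?_⟩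
  filter_upwards [hzero] with t ht x hx
  have hlim : |limitMean s ν f x - f (glue D x 0)| ≤ η / 2 := by
    rcases eq_or_ne (x s) 0 with h0 | h0
    · have : limitMean s ν f x = f (glue D x 0) := by
        have : ∀ y : ↥D → ℝ≥0, (fun v => x s * y v) = 0 := fun y => by ext v; simp [h0]
        simp [limitMean, this]
      rw [this]; simp; positivity
    · have hconv : Tendsto (fun t => condMean s κ f t x) atTop (𝓝 (limitMean s ν f x)) := by
        rw [Metric.tendsto_nhds]
        intro e he
        filter_upwards [eventually_condMean_of_le hs hν hf huc hB hR (pos_iff_ne_zero.2 h0)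
          (half_pos he)] with t ht
        rw [Real.dist_eq]
        exact (ht x le_rfl).trans_lt (half_lt_self he)
      exact le_of_tendsto ((hconv.sub_const _).abs) (hzero.mono fun t ht => ht x hx)
  have h1 := ht x hx
  rw [abs_le] at h1 hlim ⊢
  constructor <;> linarith [h1.1, h1.2, hlim.1, hlim.2]

/-- If the limit coordinate `s` is positive, then little mass is lost by restricting to the
complement of `{x_s ≤ δ}`. -/
theorem exists_cutoff (hu : ∀ᵐ a ∂α, a u = 1) (hs : ∀ᵐ a ∂α, 0 < a s) {ε : ℝ≥0} (hε : 0 < ε)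
    {η : ℝ} (hη : 0 < η) :
    ∃ δ : ℝ≥0, 0 < δ ∧ ∃ h : (V → ℝ≥0) → ℝ, IsTailTest u h ∧ (∀ x, 0 ≤ h x) ∧
      (∀ x : V → ℝ≥0, ε ≤ x u → x s ≤ δ → h x = 1) ∧ ∫ x, h x ∂radialMeasure α < η := by
  let h : ℕ → (V → ℝ≥0) → ℝ := fun n x => ramp ε (x u) * (1 - ramp (2 / (n + 1)) (x s))
  have hb : ∀ n (x : V → ℝ≥0), |1 - ramp (2 / ((n : ℝ≥0) + 1)) (x s)| ≤ 1 := fun n x => by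
    rw [abs_le]
    constructor <;> linarith [ramp_nonneg (2 / ((n : ℝ≥0) + 1)) (x s),
      ramp_le_one (2 / ((n : ℝ≥0) + 1)) (x s)]
  have ht : ∀ n, IsTailTest u (h n) := fun n =>
    (isTailTest_ramp u hε).mul (by have := continuous_ramp (2 / ((n : ℝ≥0) + 1)); fun_prop) (hb n)
  have hlim : Tendsto (fun n => ∫ x, h n x ∂radialMeasure α) atTop (𝓝 0) := by
    rw [← integral_zero (V → ℝ≥0) ℝ (μ := radialMeasure α)]
    refine tendsto_integral_of_dominated_convergence (fun x => ramp ε (x u))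
      (fun n => (ht n).continuous.aestronglyMeasurable)
      ((isTailTest_ramp u hε).integrable (radialMeasure_source_ne_top hu))
      (fun n => ae_of_all _ fun x => ?_) ?_
    · rw [Real.norm_eq_abs, abs_mul, abs_of_nonneg (ramp_nonneg _ _)]
      exact mul_le_of_le_one_right (ramp_nonneg _ _) (hb n x)
    · have h0 : ∀ᵐ x ∂radialMeasure α, x s ≠ 0 := by
        rw [ae_iff]; simpa using radialMeasure_eq_zero_of_pos hs
      filter_upwards [h0] with x hx
      refine tendsto_const_nhds.congr' ?_
      have h1 : Tendsto (fun n : ℕ => (2 : ℝ≥0) / (n + 1)) atTop (𝓝 0) :=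
        tendsto_const_div_atTop_nhds_zero_nat (2 : ℝ≥0) |>.comp (tendsto_add_atTop_nat 1) |>.congr
          fun n => by simp
      filter_upwards [h1.eventually_lt_const (pos_iff_ne_zero.2 hx)] with n hn
      simp only [h]
      rw [ramp_eq_one (by positivity) hn.le]; simp
  obtain ⟨n, hn⟩ := (hlim.eventually_lt_const hη).exists
  refine ⟨2 / (n + 1) / 2, by positivity, h n, ht n, fun x => ?_, fun x h1 h2 => ?_, hn⟩
  · exact mul_nonneg (ramp_nonneg _ _) (by linarith [ramp_le_one (2 / ((n : ℝ≥0) + 1)) (x s)])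
  · simp only [h]
    rw [ramp_eq_one hε h1, ramp_eq_zero h2]; simp

/-- One step of the recursion: the tail limit is inherited when a block of coordinates is
attached. Conditional means are replaced by their limits, which is justified where `x_s` is not
small; small values of `x_s` are negligible in the limit, or else do no harm. -/
theorem TailLimit.attach (hs : s ∉ D) (huD : u ∉ D) (hu : ∀ᵐ a ∂α, a u = 1)
    (hν : KernelLimit κ ν) (hκ : (∀ᵐ a ∂α, 0 < a s) ∨ StaysSmall κ)
    (hL : ∀ v, ∀ᶠ t : ℝ≥0 in atTop, (t : ℝ≥0∞) * attachLaw D s L κ {x | t < x v} ≤ 2)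
    (h : TailLimit u L α) : TailLimit u (attachLaw D s L κ) (attachLimit D s α ν) := by
  refine tailLimit_of_hasCompactSupport hL
    (radialMeasure_source_ne_top (attachLimit_source huD hu)) fun f hf hfs => ?_
  rw [integral_radialMeasure_attachLimit huD hu hf]
  have hg : IsTailTest u (limitMean s ν f) := isTailTest_limitMean huD hf
  obtain ⟨B, hB0, hB⟩ := hf.bounded
  obtain ⟨ε, hε, h0⟩ := hf.vanish
  have huc : UniformContinuous f := hfs.uniformContinuous_of_continuous hf.continuous
  obtain ⟨R, hR⟩ := exists_forall_eq_zero_of_hasCompactSupport hfs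
  have hvan : ∀ t x, x u < ε → condMean s κ f t x = 0 ∧ limitMean s ν f x = 0 := by
    intro t x hx
    have : ∀ y : ↥D → ℝ≥0, f (glue D x y) = 0 := fun y =>
      h0 _ (by rw [glue_of_notMem huD]; exact hx)
    simp [condMean, limitMean, this]
  have hcB : ∀ t x, |condMean s κ f t x| ≤ B := by
    intro t x
    have := norm_integral_le_of_norm_le_const (μ := κ (t * x s))
      (f := fun y => f (glue D x fun v => y v / t)) (ae_of_all _ fun y => hB _)
    simpa [condMean] using this
  have hgB : ∀ x, |limitMean s ν f x| ≤ B := by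
    intro x
    have := norm_integral_le_of_norm_le_const (μ := ν)
      (f := fun y => f (glue D x fun v => x s * y v)) (ae_of_all _ fun y => hB _)
    simpa [limitMean] using this
  -- the approximation error is small up to a set of small mass near `{x_s = 0}`
  have herr : ∀ η : ℝ, 0 < η → ∃ k : (V → ℝ≥0) → ℝ, IsTailTest u k ∧
      ∫ x, k x ∂radialMeasure α ≤ η ∧ ∀ᶠ t : ℝ≥0 in atTop, ∀ x,
        |condMean s κ f t x - limitMean s ν f x| ≤ k x := by
    intro η hη
    set m := ∫ x, ramp ε (x u) ∂radialMeasure α with hm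
    have hm0 : 0 ≤ m := integral_nonneg fun x => ramp_nonneg _ _
    let η' := η / (2 * (m + 1))
    have hη' : 0 < η' := by positivity
    have hη'm : η' * m ≤ η / 2 := by
      calc η' * m ≤ η' * (m + 1) := by gcongr; linarith
        _ = η / 2 := by simp only [η']; field_simp
    have hramp := isTailTest_ramp (V := V) u hε
    have hri := hramp.integrable (radialMeasure_source_ne_top hu)
    have hkη : IsTailTest u fun x => ramp ε (x u) * η' :=
      hramp.mul continuous_const (K := |η'|) fun _ => le_rfl
    rcases hκ with hpos | hsm
    · obtain ⟨δ, hδ, k, hk, hk0, hk1, hkint⟩ := exists_cutoff hu hpos hε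
        (show 0 < η / (4 * B) by positivity)
      have hk2 : IsTailTest u fun x => k x * (2 * B) :=
        hk.mul continuous_const (K := |2 * B|) fun _ => le_rfl
      refine ⟨fun x => ramp ε (x u) * η' + k x * (2 * B), ?_, ?_, ?_⟩
      · obtain ⟨B1, h10, h1⟩ := hkη.bounded
        obtain ⟨B2, h20, h2⟩ := hk2.bounded
        obtain ⟨ε1, e1, v1⟩ := hkη.vanish
        obtain ⟨ε2, e2, v2⟩ := hk2.vanish
        refine ⟨hkη.continuous.add hk2.continuous, ⟨B1 + B2, by positivity, fun x =>
          (abs_add_le _ _).trans (add_le_add (h1 x) (h2 x))⟩, min ε1 ε2, lt_min e1 e2,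
          fun x hx => ?_⟩
        rw [v1 x (hx.trans_le (min_le_left _ _)), v2 x (hx.trans_le (min_le_right _ _)), add_zero]
      · rw [integral_add (hkη.integrable (radialMeasure_source_ne_top hu))
          (hk2.integrable (radialMeasure_source_ne_top hu)), integral_mul_const,
          integral_mul_const, ← hm]
        have : (∫ x, k x ∂radialMeasure α) * (2 * B) ≤ η / (4 * B) * (2 * B) := by gcongr
        have e : η / (4 * B) * (2 * B) = η / 2 := by field_simp; norm_num
        linarith
      · filter_upwards [eventually_condMean_of_le hs hν hf.continuous huc hB hR hδ hη']
          with t ht x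
        by_cases hxu : x u < ε
        · rw [(hvan t x hxu).1, (hvan t x hxu).2, sub_zero, abs_zero]
          exact add_nonneg (mul_nonneg (ramp_nonneg _ _) hη'.le)
            (mul_nonneg (hk0 x) (by positivity))
        push Not at hxu
        rw [ramp_eq_one hε hxu, one_mul]
        rcases le_total δ (x s) with hx | hx
        · exact (ht x hx).trans (le_add_of_nonneg_right (mul_nonneg (hk0 x) (by positivity)))
        · rw [hk1 x hxu hx, one_mul]
          refine (abs_sub _ _).trans ?_
          linarith [hcB t x, hgB x]
    · obtain ⟨δ, hδ, hδc⟩ := exists_condMean_of_staysSmall hs hν hsm hf.continuous huc hB0 hB hR hη'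
      refine ⟨_, hkη, ?_, ?_⟩
      · rw [integral_mul_const, ← hm]; linarith
      · filter_upwards [hδc, eventually_condMean_of_le hs hν hf.continuous huc hB hR hδ hη']
          with t ht1 ht2 x
        by_cases hxu : x u < ε
        · rw [(hvan t x hxu).1, (hvan t x hxu).2, sub_zero, abs_zero]
          exact mul_nonneg (ramp_nonneg _ _) hη'.le
        push Not at hxu
        rw [ramp_eq_one hε hxu, one_mul]
        rcases le_total δ (x s) with hx | hx
        · exact ht2 x hx
        · exact ht1 x hx
  rw [Metric.tendsto_nhds]
  intro η hη
  obtain ⟨k, hk, hkint, hkev⟩ := herr (η / 3) (by positivity)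
  filter_upwards [Metric.tendsto_nhds.1 (h _ hg) (η / 3) (by positivity),
    Metric.tendsto_nhds.1 (h _ hk) (η / 3) (by positivity), hkev, eventually_gt_atTop 0]
    with t h1 h2 h3 ht
  have hfin : ∀ c : ℝ≥0, 0 < c → scaledLaw L t {x | c < x u} ≠ ∞ := fun c _ => measure_ne_top _ _
  rw [integral_scaledLaw_attachLaw hf.continuous.measurable hB ht]
  have hci : Integrable (condMean s κ f t) (scaledLaw L t) :=
    Integrable.of_bound (C := B) (measurable_condMean hf.continuous.measurable t).aestronglyMeasurable
      (ae_of_all _ fun x => hcB t x)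
  have h4 : |∫ x, condMean s κ f t x ∂scaledLaw L t - ∫ x, limitMean s ν f x ∂scaledLaw L t| ≤
      ∫ x, k x ∂scaledLaw L t := by
    rw [← integral_sub hci (hg.integrable hfin)]
    exact abs_integral_le_integral_abs.trans
      (integral_mono (hci.sub (hg.integrable hfin)).abs (hk.integrable hfin) h3)
  rw [Real.dist_eq] at h1 h2 ⊢
  rw [abs_lt] at h1 h2 ⊢
  rw [abs_le] at h4
  constructor <;> linarith [h1.1, h1.2, h2.1, h2.2, h4.1, h4.2]

end Step

/-! ### The field and its limit along the recursion -/

section Coordinates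

variable {V : Type*} [Fintype V]

/-- The vector `x` with the coordinates outside `W` set to zero. -/
def keep (W : Set V) (x : V → ℝ≥0) : V → ℝ≥0 := W.indicator x

theorem keep_of_mem {W : Set V} {x : V → ℝ≥0} {v : V} (h : v ∈ W) : keep W x v = x v :=
  Set.indicator_of_mem h x

theorem keep_of_notMem {W : Set V} {x : V → ℝ≥0} {v : V} (h : v ∉ W) : keep W x v = 0 :=
  Set.indicator_of_notMem h x

@[fun_prop]
theorem measurable_keep {T : Type*} [MeasurableSpace T] {W : Set V} {x : T → V → ℝ≥0}
    (hx : Measurable x) : Measurable fun t => keep W (x t) := by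
  refine measurable_pi_lambda _ fun v => ?_
  by_cases h : v ∈ W
  · simp only [keep_of_mem h]; fun_prop
  · simp only [keep_of_notMem h]; fun_prop

theorem scaledLaw_map_keep (W : Set V) (L : Measure (V → ℝ≥0)) (t : ℝ≥0) :
    scaledLaw (L.map (keep W)) t = (scaledLaw L t).map (keep W) := by
  have hm : Measurable (keep W) := by fun_prop
  rw [scaledLaw, scaledLaw, Measure.map_smul, Measure.map_map (by fun_prop) hm,
    Measure.map_map hm (by fun_prop)]
  congr 2
  ext x v
  by_cases h : v ∈ W
  · simp [keep_of_mem h]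
  · simp [keep_of_notMem h]

theorem radialMeasure_map_keep (W : Set V) (α : Measure (V → ℝ≥0)) :
    radialMeasure (α.map (keep W)) = (radialMeasure α).map (keep W) := by
  have hm : Measurable (keep W) := by fun_prop
  refine Measure.ext_of_lintegral _ fun f hf => ?_
  rw [lintegral_radialMeasure _ hf, lintegral_map (Measurable.lintegral_prod_right'
    (f := fun p : (V → ℝ≥0) × ℝ≥0 => f fun v => p.2 * p.1 v) (by fun_prop)) hm,
    lintegral_map hf hm,
    lintegral_radialMeasure (f := fun x => f (keep W x)) _ (by fun_prop)]
  refine lintegral_congr fun a => lintegral_congr fun z => ?_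
  congr 1
  ext v
  by_cases h : v ∈ W
  · simp [keep_of_mem h]
  · simp [keep_of_notMem h]

theorem keep_univ : (keep (Set.univ : Set V)) = id := by
  ext x v; simp [keep_of_mem (Set.mem_univ v)]

/-- Keeping only the coordinate `u`, the tail limit holds if the tail of that coordinate is
standard Pareto. -/
theorem tailLimit_keep_singleton {u : V} {L α : Measure (V → ℝ≥0)} [IsProbabilityMeasure L]
    [IsProbabilityMeasure α] (hu : ∀ᵐ a ∂α, a u = 1)
    (hL : Tendsto (fun t : ℝ≥0 => (t : ℝ≥0∞) * L {x | t < x u}) atTop (𝓝 1)) :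
    TailLimit u (L.map (keep {u})) (α.map (keep {u})) := by
  classical
  have hm : Measurable (keep ({u} : Set V)) := by fun_prop
  have : IsProbabilityMeasure (L.map (keep {u})) := Measure.isProbabilityMeasure_map hm.aemeasurable
  have : IsProbabilityMeasure (α.map (keep {u})) := Measure.isProbabilityMeasure_map hm.aemeasurable
  have hmeas : ∀ (v : V) (c : ℝ≥0), MeasurableSet {x : V → ℝ≥0 | c < x v} := fun v c =>
    measurableSet_lt (by fun_prop) (by fun_prop)
  refine tailLimit_of_hasCompactSupport (fun v => ?_) (radialMeasure_source_ne_top ?_)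
    fun f hf hfs => ?_
  · by_cases hv : v = u
    · subst hv
      filter_upwards [hL.eventually_le_const (show (1 : ℝ≥0∞) < 2 by norm_num)] with t ht
      rw [Measure.map_apply hm (hmeas _ _)]
      refine (mul_le_mul' le_rfl (measure_mono fun x hx => ?_)).trans ht
      have hx' : t < keep {v} x v := hx
      rwa [keep_of_mem (Set.mem_singleton v)] at hx'
    · refine Eventually.of_forall fun t => ?_
      rw [Measure.map_apply hm (hmeas _ _)]
      have : keep {u} ⁻¹' {x : V → ℝ≥0 | t < x v} = ∅ := by
        ext x
        simp [keep_of_notMem (show v ∉ ({u} : Set V) from hv)]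
      rw [this]; simp
  · rw [ae_map_iff hm.aemeasurable (measurableSet_eq_fun (by fun_prop) (by fun_prop))]
    simpa only [keep_of_mem (Set.mem_singleton u)] using hu
  obtain ⟨ε, hε, h0⟩ := hf.vanish
  obtain ⟨R, hR⟩ := exists_forall_eq_zero_of_hasCompactSupport hfs
  have hu' : Measurable fun x : V → ℝ≥0 => x u := by fun_prop
  let φ : ℝ≥0 → ℝ := fun z => f (Pi.single u z)
  have hφ : Continuous φ := hf.continuous.comp (continuous_const.update u continuous_id)
  have hk : ∀ x : V → ℝ≥0, f (keep {u} x) = φ (x u) := by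
    intro x
    simp only [φ]
    congr 1
    ext v
    by_cases hv : v = u
    · subst hv; simp [keep_of_mem (Set.mem_singleton v)]
    · rw [keep_of_notMem (show v ∉ ({u} : Set V) from hv), Pi.single_eq_of_ne hv]
  have hint : ∀ m : Measure (V → ℝ≥0),
      ∫ x, f x ∂m.map (keep {u}) = ∫ z, φ z ∂m.map fun x => x u := by
    intro m
    rw [integral_map hm.aemeasurable hf.continuous.aestronglyMeasurable,
      integral_map hu'.aemeasurable hφ.aestronglyMeasurable]
    simp only [hk]
  simp only [scaledLaw_map_keep, radialMeasure_map_keep, hint]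
  have happ : ∀ (m : Measure (V → ℝ≥0)) (c : ℝ≥0),
      (m.map fun x => x u) (Set.Ioi c) = m {x | c < x u} := fun m c => by
    rw [Measure.map_apply hu' measurableSet_Ioi]; rfl
  refine tendsto_integral_of_tendsto_Ioi (ε := ε) (R := R) ?_ ?_ ?_ hφ hε ?_ ?_
  · intro t c _; rw [happ]; exact measure_ne_top _ _
  · intro c hc; rw [happ]; exact radialMeasure_source_ne_top hu c hc
  · intro c hc
    simp only [Measure.real, happ]
    rw [radialMeasure_source_lt hu hc]
    have hne : ((c : ℝ≥0∞)⁻¹) ≠ ∞ := by simpa using hc.ne'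
    exact (ENNReal.tendsto_toReal hne).comp (tendsto_scaledLaw_lt hL hc)
  · intro z hz
    exact h0 _ (by simpa using hz)
  · intro z hz
    exact hR _ ⟨u, by simpa using hz⟩

end Coordinates

section Field

variable {V : Type*} [Fintype V] {G : SimpleGraph V} {u s : V} {W C : Set V}

theorem glue_keep (h : IsCliqueExtension G u W C s) (x : V → ℝ≥0) :
    glue (C \ {s}) (keep W x) (fun v => x v) = keep (W ∪ C) x := by
  ext v
  by_cases hv : v ∈ C \ {s}
  · rw [glue_of_mem hv, keep_of_mem (Set.mem_union_right W hv.1)]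
  · rw [glue_of_notMem hv]
    by_cases hW : v ∈ W
    · rw [keep_of_mem hW, keep_of_mem (Set.mem_union_left C hW)]
    · rw [keep_of_notMem hW, keep_of_notMem]
      rintro (h' | h')
      · exact hW h'
      · refine hv ⟨h', fun e => hW ?_⟩
        rw [Set.mem_singleton_iff.1 e]; exact h.mem_left

/-- By the Markov property, the coordinates in `C \ s` depend on those in `W` through the
coordinate `s` only. -/
theorem hasCondDistrib_keep (h : IsCliqueExtension G u W C s) {L : Measure (V → ℝ≥0)}
    [IsProbabilityMeasure L] (hL : GlobalMarkov G L)
    {κ : Kernel ℝ≥0 (↥(C \ {s}) → ℝ≥0)} [IsMarkovKernel κ]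
    (hκ : HasCondDistrib (fun x (v : ↥(C \ {s})) => x v) (fun x : V → ℝ≥0 => x s) κ L) :
    HasCondDistrib (fun x (v : ↥(C \ {s})) => x v) (keep W)
      (κ.comap (fun x => x s) (measurable_pi_apply s)) L := by
  classical
  by_cases hW : (W \ {s}).Nonempty
  · let k : (V → ℝ≥0) → ↥({s} : Set V) → ℝ≥0 := fun x v => x v
    let g : (V → ℝ≥0) → ↥(W \ {s}) → ℝ≥0 := fun x v => x v
    let f : (V → ℝ≥0) → ↥(C \ {s}) → ℝ≥0 := fun x v => x v
    have hk : Measurable k := by fun_prop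
    have hg : Measurable g := by fun_prop
    have hf : Measurable f := by fun_prop
    have hci : CondIndepFun (MeasurableSpace.comap k inferInstance) hk.comap_le g f L :=
      hL (W \ {s}) (C \ {s}) {s} hW h.nonempty ⟨s, rfl⟩
        (Set.disjoint_left.2 fun v hv hv' => h.notMem_of_mem_diff hv' hv.1)
        (Set.disjoint_left.2 fun v hv hv' => hv.2 hv')
        (Set.disjoint_left.2 fun v hv hv' => hv.2 hv') h.isSeparator
    rw [condIndepFun_iff_condDistrib_prod_ae_eq_prodMkRight hf hg hk] at hci
    let e : (↥({s} : Set V) → ℝ≥0) → ℝ≥0 := fun z => z ⟨s, rfl⟩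
    have he : Measurable e := by fun_prop
    let ei : ℝ≥0 → ↥({s} : Set V) → ℝ≥0 := fun z _ => z
    have hei : Measurable ei := by fun_prop
    have hkei : ei ∘ (fun x : V → ℝ≥0 => x s) = k := by
      ext x ⟨v, hv⟩
      simp only [ei, k, Function.comp]
      rw [Set.mem_singleton_iff.1 hv]
    -- conditioning on the one-element family `k` is conditioning on the coordinate `s`
    have hκ' : HasCondDistrib f k (κ.comap e he) L := by
      rw [← hkei]
      refine HasCondDistrib.comp_right (hf := hei) ?_
      rw [← Kernel.comap_comp_right]
      exact hκ
    have h1 : condDistrib f k L =ᵐ[L.map k] κ.comap e he :=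
      condDistrib_ae_eq_of_measure_eq_compProd k hf.aemeasurable hκ'.map_eq
    have h2 : (condDistrib f k L).prodMkRight (↥(W \ {s}) → ℝ≥0)
        =ᵐ[L.map fun x => (k x, g x)] (κ.comap e he).prodMkRight (↥(W \ {s}) → ℝ≥0) := by
      have hfst : L.map k = (L.map fun x => (k x, g x)).map Prod.fst := by
        rw [Measure.map_map measurable_fst (by fun_prop)]; rfl
      rw [hfst] at h1
      have h3 := ae_of_ae_map measurable_fst.aemeasurable h1
      filter_upwards [h3] with p hp
      simpa [Kernel.prodMkRight_apply] using hp
    have h4 : HasCondDistrib f (fun x => (k x, g x))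
        ((κ.comap e he).prodMkRight (↥(W \ {s}) → ℝ≥0)) L := by
      refine ⟨by fun_prop, ?_⟩
      rw [← compProd_map_condDistrib hf.aemeasurable]
      exact Measure.compProd_congr (hci.trans h2)
    -- `keep W x` is a function of the coordinates in `W`
    let j : (↥({s} : Set V) → ℝ≥0) × (↥(W \ {s}) → ℝ≥0) → V → ℝ≥0 := fun p v =>
      if hv : v ∈ W \ {s} then p.2 ⟨v, hv⟩ else if v = s then p.1 ⟨s, rfl⟩ else 0
    have hj : Measurable j := by
      refine measurable_pi_lambda _ fun v => ?_
      by_cases hv : v ∈ W \ {s}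
      · simp only [j, dif_pos hv]; fun_prop
      · simp only [j, dif_neg hv]
        by_cases hvs : v = s
        · simp only [if_pos hvs]; fun_prop
        · simp only [if_neg hvs]; fun_prop
    have hjk : j ∘ (fun x => (k x, g x)) = keep W := by
      ext x v
      simp only [j, Function.comp]
      by_cases hv : v ∈ W \ {s}
      · rw [dif_pos hv, keep_of_mem hv.1]
      · rw [dif_neg hv]
        by_cases hvs : v = s
        · subst hvs; rw [if_pos rfl, keep_of_mem h.mem_left]
        · rw [if_neg hvs, keep_of_notMem fun hw => hv ⟨hw, hvs⟩]
    rw [← hjk]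
    refine HasCondDistrib.comp_right (hf := hj) ?_
    convert h4 using 1
    ext p : 1
    have hjs : j p s = e p.1 := by simp [j, e]
    simp only [Kernel.comap_apply, Kernel.prodMkRight_apply, hjs]
  -- if `W = {s}`, the Markov property is void and there is nothing to prove but measurability
  · rw [Set.not_nonempty_iff_eq_empty] at hW
    let j : ℝ≥0 → V → ℝ≥0 := fun z v => if v = s then z else 0
    have hj : Measurable j := by
      refine measurable_pi_lambda _ fun v => ?_
      by_cases hvs : v = s
      · simp only [j, if_pos hvs]; fun_prop
      · simp only [j, if_neg hvs]; fun_prop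
    have hjk : j ∘ (fun x : V → ℝ≥0 => x s) = keep W := by
      ext x v
      simp only [j, Function.comp]
      by_cases hvs : v = s
      · subst hvs; rw [if_pos rfl, keep_of_mem h.mem_left]
      · rw [if_neg hvs, keep_of_notMem fun hw => (hW.le ⟨hw, hvs⟩ : v ∈ (∅ : Set V))]
    rw [← hjk]
    refine HasCondDistrib.comp_right (hf := hj) ?_
    convert hκ using 1
    ext p : 1
    simp [Kernel.comap_apply, j]

/-- Attaching a clique to the field. -/
theorem map_keep_union (h : IsCliqueExtension G u W C s) {L : Measure (V → ℝ≥0)}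
    [IsProbabilityMeasure L] (hL : GlobalMarkov G L)
    {κ : Kernel ℝ≥0 (↥(C \ {s}) → ℝ≥0)} [IsMarkovKernel κ]
    (hκ : HasCondDistrib (fun x (v : ↥(C \ {s})) => x v) (fun x : V → ℝ≥0 => x s) κ L) :
    L.map (keep (W ∪ C)) = attachLaw (C \ {s}) s (L.map (keep W)) κ := by
  have h1 := (hasCondDistrib_keep h hL hκ).map_eq
  rw [attachLaw, ← h1, Measure.map_map (by fun_prop) (by fun_prop)]
  congr 1
  ext x : 1
  exact (glue_keep h x).symm

end Field

section Increments

variable {V : Type*} [Fintype V] {G : SimpleGraph V} {u s : V} {W C : Set V}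
  {Ω : Type*} [MeasurableSpace Ω] {Q : Measure Ω} {Z : V → V → Ω → ℝ≥0}
  {ν : (C : Set V) → (s : V) → ProbabilityMeasure (↥(C \ {s}) → ℝ≥0)}

theorem limitField_self (Z : V → V → Ω → ℝ≥0) (u : V) (ω : Ω) : limitField G Z u ω u = 1 := by
  classical
  unfold limitField
  refine Finset.prod_eq_one fun e he => ?_
  rw [Set.mem_toFinset, pathEdges_self] at he
  exact absurd he (Set.notMem_empty e)

/-- The shortest path to a node of the new clique is the one to `s`, followed by one edge. -/
theorem limitField_extension (h : IsCliqueExtension G u W C s) (hG : G.Connected)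
    (Z : V → V → Ω → ℝ≥0) (ω : Ω) {v : V} (hv : v ∈ C \ {s}) :
    limitField G Z u ω v = limitField G Z u ω s * Z s v ω := by
  classical
  obtain ⟨h1, h2⟩ := h.pathEdges_eq hG hv
  unfold limitField
  have : (pathEdges G u v).toFinset = insert (s, v) (pathEdges G u s).toFinset := by
    ext e; simp [h2]
  rw [this, Finset.prod_insert (by simpa using h1), mul_comm]

theorem IsIncrement.aemeasurable (hZ : IsIncrement G ν u Q Z) {C : Set V} {a b : V}
    (hC : IsMaxClique G C) (ha : IsEntryNode G u C a) (hb : b ∈ C \ {a}) :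
    AEMeasurable (Z a b) Q :=
  (measurable_pi_apply (⟨b, hb⟩ : ↥(C \ {a}))).comp_aemeasurable
    (hZ.hasLaw ⟨(C, a), hC, ha⟩).aemeasurable

/-- The law of a single increment is a marginal of `ν`. -/
theorem IsIncrement.map_eq (hZ : IsIncrement G ν u Q Z) {C : Set V} {a b : V}
    (hC : IsMaxClique G C) (ha : IsEntryNode G u C a) (hb : b ∈ C \ {a}) :
    Q.map (Z a b) = (ν C a : Measure (↥(C \ {a}) → ℝ≥0)).map fun y => y ⟨b, hb⟩ := by
  have hl := hZ.hasLaw ⟨(C, a), hC, ha⟩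
  rw [← hl.map_eq, AEMeasurable.map_map_of_aemeasurable (measurable_pi_apply _).aemeasurable
    hl.aemeasurable]
  rfl

theorem IsIncrement.aemeasurable_of_mem (hZ : IsIncrement G ν u Q Z) (hG : G.Connected)
    (hb : IsBlockGraph G) {v : V} {e : V × V} (he : e ∈ pathEdges G u v) :
    AEMeasurable (Z e.1 e.2) Q := by
  obtain ⟨C, hC, h1, -, h2⟩ := hb.exists_entry hG he
  exact hZ.aemeasurable hC h1 h2

theorem IsIncrement.aemeasurable_limitField (hZ : IsIncrement G ν u Q Z) (hG : G.Connected)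
    (hb : IsBlockGraph G) : AEMeasurable (limitField G Z u) Q := by
  classical
  refine aemeasurable_pi_lambda _ fun v => ?_
  unfold limitField
  refine Finset.aemeasurable_fun_prod _ fun e he => ?_
  exact hZ.aemeasurable_of_mem hG hb (Set.mem_toFinset.1 he)

theorem IsIncrement.isProbabilityMeasure_map (hZ : IsIncrement G ν u Q Z) [IsProbabilityMeasure Q]
    (hG : G.Connected) (hb : IsBlockGraph G) : IsProbabilityMeasure (Q.map (limitField G Z u)) :=
  Measure.isProbabilityMeasure_map (hZ.aemeasurable_limitField hG hb)

/-- The field on `W` is built from the cliques inside `W`, hence independent of the increments on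
a new clique. -/
theorem IsIncrement.indepFun (hZ : IsIncrement G ν u Q Z) (h : IsCliqueExtension G u W C s) :
    IndepFun (fun ω => keep W (limitField G Z u ω)) (fun ω (v : ↥(C \ {s})) => Z s v ω) Q := by
  classical
  have hfin : Finite (EntryPair G u) := by unfold EntryPair; infer_instance
  have := Fintype.ofFinite (EntryPair G u)
  let q₀ : EntryPair G u := ⟨(C, s), h.isMaxClique, h.isEntryNode⟩
  let S : Finset (EntryPair G u) := Finset.univ.filter fun q => q.1.1 ⊆ W
  have hST : Disjoint S {q₀} := by
    rw [Finset.disjoint_singleton_right, Finset.mem_filter]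
    exact fun hq => h.not_subset hq.2
  have hind := hZ.indep.indepFun_finset₀ S {q₀} hST fun q => (hZ.hasLaw q).aemeasurable
  -- the increment on `e`, read off from the vector of increments on a clique inside `W`
  let P : V × V → Prop := fun e => ∃ q : S, q.1.1.2 = e.1 ∧ e.2 ∈ q.1.1.1 \ {q.1.1.2}
  let edgeValue : V × V → ((q : S) → ↥(q.1.1.1 \ {q.1.1.2}) → ℝ≥0) → ℝ≥0 := fun e z =>
    if hq : P e then z hq.choose ⟨e.2, hq.choose_spec.2⟩ else 0
  have h_edge : ∀ e, Measurable (edgeValue e) := by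
    intro e
    by_cases hq : P e
    · simp only [edgeValue, dif_pos hq]; fun_prop
    · simp only [edgeValue, dif_neg hq]; fun_prop
  let φ : ((q : S) → ↥(q.1.1.1 \ {q.1.1.2}) → ℝ≥0) → V → ℝ≥0 := fun z =>
    keep W fun v => ∏ e ∈ (pathEdges G u v).toFinset, edgeValue e z
  have hφ : Measurable φ := by
    refine measurable_keep (measurable_pi_lambda _ fun v => ?_)
    exact Finset.measurable_fun_prod _ fun e _ => h_edge e
  let ψ : ((q : ({q₀} : Finset (EntryPair G u))) → ↥(q.1.1.1 \ {q.1.1.2}) → ℝ≥0) →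
      ↥(C \ {s}) → ℝ≥0 := fun z => z ⟨q₀, Finset.mem_singleton_self q₀⟩
  have hψ : Measurable ψ := measurable_pi_apply _
  have hfield : (fun ω => keep W (limitField G Z u ω)) =
      φ ∘ fun ω (q : S) (v : ↥(q.1.1.1 \ {q.1.1.2})) => Z q.1.1.2 v ω := by
    funext ω v
    simp only [φ, Function.comp]
    by_cases hv : v ∈ W
    · rw [keep_of_mem hv, keep_of_mem hv]
      unfold limitField
      refine Finset.prod_congr (by ext; simp) fun e he => ?_
      have he' : e ∈ pathEdges G u v := by simpa using he
      obtain ⟨C', h1, h2, h3, h4, h5⟩ := h.isCliqueUnion.exists_entry v hv e he'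
      have hP : P e := ⟨⟨⟨(C', e.1), h2, h3⟩, Finset.mem_filter.2 ⟨Finset.mem_univ _, h1⟩⟩, rfl, h5⟩
      simp only [edgeValue, dif_pos hP]
      rw [hP.choose_spec.1]
    · rw [keep_of_notMem hv, keep_of_notMem hv]
  rw [hfield]
  exact hind.comp hφ hψ

/-- Attaching a clique to the limit field. -/
theorem map_limitField_union (hZ : IsIncrement G ν u Q Z) [IsProbabilityMeasure Q]
    (h : IsCliqueExtension G u W C s) (hG : G.Connected) (hb : IsBlockGraph G) :
    (Q.map (limitField G Z u)).map (keep (W ∪ C)) =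
      attachLimit (C \ {s}) s ((Q.map (limitField G Z u)).map (keep W)) (ν C s) := by
  have hA := hZ.aemeasurable_limitField hG hb
  have hl := hZ.hasLaw ⟨(C, s), h.isMaxClique, h.isEntryNode⟩
  have hk : ∀ W : Set V, Measurable (keep W) := fun W => by fun_prop
  have h1 := (indepFun_iff_map_prod_eq_prod_map_map ((hk W).comp_aemeasurable hA)
    hl.aemeasurable).1 (hZ.indepFun h)
  have h2 := hl.map_eq
  simp only at h2
  rw [attachLimit, AEMeasurable.map_map_of_aemeasurable (hk _).aemeasurable hA,
    AEMeasurable.map_map_of_aemeasurable (hk _).aemeasurable hA]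
  rw [h2] at h1
  rw [← h1, AEMeasurable.map_map_of_aemeasurable (Measurable.aemeasurable (by fun_prop))
    (((hk W).comp_aemeasurable hA).prodMk hl.aemeasurable)]
  congr 1
  ext ω : 1
  simp only [Function.comp]
  rw [← glue_keep h]
  congr 1
  ext v
  rw [keep_of_mem h.mem_left, limitField_extension h hG Z ω v.2]

/-- If all increments on paths from `u` have unit mean, then so have the coordinates of the limit
field. -/
theorem lintegral_limitField_eq_one (hZ : IsIncrement G ν u Q Z) [IsProbabilityMeasure Q]
    (hG : G.Connected) (hb : IsBlockGraph G)
    (h1 : ∀ v, v ≠ u → ∀ e ∈ pathEdges G u v, ∫⁻ ω, (Z e.1 e.2 ω : ℝ≥0∞) ∂Q = 1) (v : V) :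
    ∫⁻ ω, (limitField G Z u ω v : ℝ≥0∞) ∂Q = 1 := by
  have hA := hZ.aemeasurable_limitField hG hb
  have key : ∀ v ∈ Set.univ, ∫⁻ ω, (limitField G Z u ω v : ℝ≥0∞) ∂Q = 1 := by
    refine hb.clique_induction hG u
      (motive := fun W => ∀ v ∈ W, ∫⁻ ω, (limitField G Z u ω v : ℝ≥0∞) ∂Q = 1) ?_ ?_
    · rintro v rfl
      simp [limitField_self]
    · intro W C s h ih v hv
      by_cases hvW : v ∈ W
      · exact ih v hvW
      have hvC : v ∈ C \ {s} :=
        ⟨hv.resolve_left hvW, fun e => hvW (by rw [Set.mem_singleton_iff.1 e]; exact h.mem_left)⟩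
      have hZm := hZ.aemeasurable h.isMaxClique h.isEntryNode hvC
      have hind : IndepFun (fun ω => (limitField G Z u ω s : ℝ≥0∞)) (fun ω => (Z s v ω : ℝ≥0∞)) Q := by
        have := (hZ.indepFun h).comp (φ := fun x : V → ℝ≥0 => (x s : ℝ≥0∞))
          (ψ := fun y : ↥(C \ {s}) → ℝ≥0 => (y ⟨v, hvC⟩ : ℝ≥0∞)) (by fun_prop) (by fun_prop)
        simpa only [Function.comp_def, keep_of_mem h.mem_left] using this
      simp only [limitField_extension h hG Z _ hvC, ENNReal.coe_mul]
      refine (lintegral_mul_eq_lintegral_mul_lintegral_of_indepFun'' ?_ ?_ hind).trans ?_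
      · exact ((measurable_pi_apply s).comp_aemeasurable hA).coe_nnreal_ennreal
      · exact hZm.coe_nnreal_ennreal
      · rw [ih s h.mem_left, h1 v (fun e => hvW (e ▸ h.isCliqueUnion.mem)) (s, v)
          (by rw [(h.pathEdges_eq hG hvC).2]; exact Set.mem_insert _ _), one_mul]
  exact key v trivial

end Increments

/-! ### The tail limit of the field with one source node -/

section FieldLimit

variable {V : Type*} [Fintype V] {G : SimpleGraph V}

theorem CliqueTailLimit.kernelLimit
    {κ : (C : Set V) → (s : V) → Kernel ℝ≥0 (↥(C \ {s}) → ℝ≥0)} [∀ C s, IsMarkovKernel (κ C s)]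
    {ν : (C : Set V) → (s : V) → ProbabilityMeasure (↥(C \ {s}) → ℝ≥0)}
    (hν : CliqueTailLimit G κ ν) {C : Set V} {s : V} (hC : IsMaxClique G C) (hs : s ∈ C) :
    KernelLimit (κ C s) (ν C s : Measure (↥(C \ {s}) → ℝ≥0)) := by
  rintro F hF ⟨B, hB⟩
  have h := (hν C hC s hs).tendsto
  have h1 := ProbabilityMeasure.tendsto_iff_forall_integral_tendsto.1 h
    (BoundedContinuousFunction.ofNormedAddCommGroup F hF B hB)
  simp only [BoundedContinuousFunction.coe_ofNormedAddCommGroup, ProbabilityMeasure.coe_mk,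
    Measure.map_id] at h1
  refine h1.congr fun t => ?_
  rw [integral_map (Measurable.aemeasurable (by fun_prop)) hF.aestronglyMeasurable]

/-- The condition on kernels in `ZeroCondition`, in terms of `ε` and `δ`. -/
theorem staysSmall_of_limsup {D : Set V} {κ : Kernel ℝ≥0 (↥D → ℝ≥0)}
    (h : ∀ η : ℝ≥0, 0 < η → limsup (fun δ : ℝ≥0 => limsup (fun t : ℝ≥0 =>
      ⨆ x ∈ Set.Icc (0 : ℝ≥0) δ, κ (t * x) {y | ∃ v, η < y v / t}) atTop) (𝓝[>] 0) = 0) :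
    StaysSmall κ := by
  intro η hη θ hθ
  have h1 := eventually_lt_of_limsup_lt (lt_of_eq_of_lt (h η hη) hθ)
  obtain ⟨δ, hδ, hδ0⟩ := (h1.and self_mem_nhdsWithin).exists
  refine ⟨δ, hδ0, ?_⟩
  filter_upwards [eventually_lt_of_limsup_lt hδ] with t ht x hx
  exact (le_iSup₂_of_le (f := fun x (_ : x ∈ Set.Icc (0 : ℝ≥0) δ) =>
    κ (t * x) {y | ∃ v, η < y v / t}) x ⟨zero_le, hx⟩ le_rfl).trans ht.le

variable {u : V} {Ω : Type*} [MeasurableSpace Ω] {Q : Measure Ω} {Z : V → V → Ω → ℝ≥0}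
  {ν : (C : Set V) → (s : V) → ProbabilityMeasure (↥(C \ {s}) → ℝ≥0)}

/-- If no increment on the path from `u` to `s` has an atom at zero, then `A_{us} > 0`. -/
theorem IsIncrement.limitField_pos (hZ : IsIncrement G ν u Q Z) (hG : G.Connected)
    (hb : IsBlockGraph G) {s : V}
    (h : ¬ ∃ a b : V, (a, b) ∈ pathEdges G u s ∧ ∃ C' : Set V, IsMaxClique G C' ∧ a ∈ C' ∧
      ∃ hb : b ∈ C' \ {a},
        0 < (ν C' a : Measure (↥(C' \ {a}) → ℝ≥0)) {y | y ⟨b, hb⟩ = 0}) :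
    ∀ᵐ ω ∂Q, 0 < limitField G Z u ω s := by
  classical
  have h1 : ∀ e ∈ pathEdges G u s, ∀ᵐ ω ∂Q, 0 < Z e.1 e.2 ω := by
    rintro ⟨a, b⟩ he
    obtain ⟨C, hC, hCe, ha, hbC⟩ := hb.exists_entry hG he
    have h0 : (ν C a : Measure (↥(C \ {a}) → ℝ≥0)) {y | y ⟨b, hbC⟩ = 0} = 0 := by
      by_contra hne
      exact h ⟨a, b, he, C, hC, ha, hbC, pos_iff_ne_zero.2 hne⟩
    have h2 : Q.map (Z a b) {0} = 0 := by
      rw [hZ.map_eq hC hCe hbC, Measure.map_apply (by fun_prop) (measurableSet_singleton _)]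
      exact h0
    rw [Measure.map_apply_of_aemeasurable (hZ.aemeasurable hC hCe hbC)
      (measurableSet_singleton _)] at h2
    rw [ae_iff]
    simpa [Set.preimage, pos_iff_ne_zero] using h2
  have h2 := (ae_ball_iff (Set.to_countable (pathEdges G u s))).2 h1
  filter_upwards [h2] with ω hω
  unfold limitField
  exact Finset.prod_pos fun e he => hω e (Set.mem_toFinset.1 he)

/-- The tail limit of the full field on sets where the coordinate `u` is bounded away from zero,
by induction over the cliques. -/
theorem tailLimit_limitField [IsProbabilityMeasure Q] (hG : G.Connected) (hb : IsBlockGraph G)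
    {L : Measure (V → ℝ≥0)} [IsProbabilityMeasure L] (hL : GlobalMarkov G L)
    {κ : (C : Set V) → (s : V) → Kernel ℝ≥0 (↥(C \ {s}) → ℝ≥0)} [∀ C s, IsMarkovKernel (κ C s)]
    (hκ : ∀ C, IsMaxClique G C → ∀ s ∈ C,
      HasCondDistrib (fun x (v : ↥(C \ {s})) => x v) (fun x : V → ℝ≥0 => x s) (κ C s) L)
    (hν : CliqueTailLimit G κ ν) (hzero : ZeroCondition G κ ν)
    (htail : ∀ v, Tendsto (fun t : ℝ≥0 => (t : ℝ≥0∞) * L {x | t < x v}) atTop (𝓝 1))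
    (hZ : IsIncrement G ν u Q Z) :
    TailLimit u L (Q.map (limitField G Z u)) := by
  have hA := hZ.aemeasurable_limitField hG hb
  have := hZ.isProbabilityMeasure_map hG hb
  have hk : ∀ W : Set V, Measurable (keep W) := fun W => by fun_prop
  have hsrc : ∀ᵐ a ∂Q.map (limitField G Z u), a u = 1 := by
    rw [ae_map_iff hA (measurableSet_eq_fun (by fun_prop) (by fun_prop))]
    exact ae_of_all _ fun ω => limitField_self Z u ω
  have key : TailLimit u (L.map (keep Set.univ)) ((Q.map (limitField G Z u)).map (keep Set.univ)) := by
    refine hb.clique_induction hG u (motive := fun W =>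
      TailLimit u (L.map (keep W)) ((Q.map (limitField G Z u)).map (keep W)))
      (tailLimit_keep_singleton hsrc (htail u)) ?_
    intro W C s h ih
    have hLp : ∀ W : Set V, IsProbabilityMeasure (L.map (keep W)) := fun W =>
      Measure.isProbabilityMeasure_map (hk W).aemeasurable
    have hαp : ∀ W : Set V, IsProbabilityMeasure ((Q.map (limitField G Z u)).map (keep W)) :=
      fun W => Measure.isProbabilityMeasure_map (hk W).aemeasurable
    have hunion := map_keep_union h hL (hκ C h.isMaxClique s h.mem_right)
    rw [map_limitField_union hZ h hG hb, hunion]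
    have hsu : u ∉ C \ {s} := fun hu => h.notMem_of_mem_diff hu h.isCliqueUnion.mem
    refine TailLimit.attach (fun hs => hs.2 rfl) hsu ?_
      (hν.kernelLimit h.isMaxClique h.mem_right) ?_ ?_ ih
    · rw [ae_map_iff (hk W).aemeasurable (measurableSet_eq_fun (by fun_prop) (by fun_prop))]
      simpa only [keep_of_mem h.isCliqueUnion.mem] using hsrc
    · by_cases hatom : ∃ a b : V, (a, b) ∈ pathEdges G u s ∧ ∃ C' : Set V, IsMaxClique G C' ∧
        a ∈ C' ∧ ∃ hb : b ∈ C' \ {a},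
          0 < (ν C' a : Measure (↥(C' \ {a}) → ℝ≥0)) {y | y ⟨b, hb⟩ = 0}
      · right
        have hne : s ≠ u := by
          rintro rfl
          obtain ⟨a, b, he, -⟩ := hatom
          rw [pathEdges_self] at he
          exact he
        exact staysSmall_of_limsup (hzero u s (h.mem_cliqueSeparators hne) C h.isMaxClique
          (h.inter_pathNodes hG) hatom)
      · left
        rw [ae_map_iff (hk W).aemeasurable (measurableSet_lt (by fun_prop) (by fun_prop))]
        simp only [keep_of_mem h.mem_left]
        rw [ae_map_iff hA (measurableSet_lt (by fun_prop) (by fun_prop))]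
        exact hZ.limitField_pos hG hb hatom
    · intro v
      rw [← hunion]
      filter_upwards [(htail v).eventually_le_const (show (1 : ℝ≥0∞) < 2 by norm_num)] with t ht
      rw [Measure.map_apply (hk _) (measurableSet_lt (by fun_prop) (by fun_prop))]
      refine (mul_le_mul' le_rfl (measure_mono fun x hx => ?_)).trans ht
      have hx' : t < keep (W ∪ C) x v := hx
      by_cases hv : v ∈ W ∪ C
      · rwa [keep_of_mem hv] at hx'
      · rw [keep_of_notMem hv] at hx'
        exact absurd hx' not_lt_zero
  simpa [keep_univ, Measure.map_id] using key

end FieldLimit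

/-! ### Gluing the limits for different source nodes -/

section LimitMeasure

variable {V : Type*} [Fintype V] {L : Measure (V → ℝ≥0)} {α : V → Measure (V → ℝ≥0)}
  [IsProbabilityMeasure L] [∀ u, IsProbabilityMeasure (α u)]

theorem measurableSet_lt_apply (c : ℝ≥0) (v : V) : MeasurableSet {x : V → ℝ≥0 | c < x v} :=
  measurableSet_lt (by fun_prop) (by fun_prop)

/-- Where two coordinates `u` and `v` are bounded away from zero, the tail limits with sources `u`
and `v` agree, being limits of the same measures. -/
theorem radialMeasure_eq_of_subset {u v : V} (hu : ∀ᵐ a ∂α u, a u = 1) (hv : ∀ᵐ a ∂α v, a v = 1)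
    (hTu : TailLimit u L (α u)) (hTv : TailLimit v L (α v)) {c : ℝ≥0} (hc : 0 < c)
    {S : Set (V → ℝ≥0)} (hS : MeasurableSet S) (hSu : ∀ x ∈ S, c < x u) (hSv : ∀ x ∈ S, c < x v) :
    radialMeasure (α u) S = radialMeasure (α v) S := by
  -- with this density, both measures are finite and determined by their integrals
  let χ : (V → ℝ≥0) → ℝ≥0 := fun x => (ramp c (x u) * ramp c (x v)).toNNReal
  have hχr : ∀ x, (χ x : ℝ) = ramp c (x u) * ramp c (x v) := fun x =>
    Real.coe_toNNReal _ (mul_nonneg (ramp_nonneg _ _) (ramp_nonneg _ _))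
  have hramp : ∀ w : V, Continuous fun x : V → ℝ≥0 => ramp c (x w) := fun w =>
    (continuous_ramp c).comp (continuous_apply w)
  have hχm : Measurable χ := by
    have h1 := (hramp u).measurable
    have h2 := (hramp v).measurable
    exact (h1.mul h2).real_toNNReal
  have hTest : ∀ f : BoundedContinuousFunction (V → ℝ≥0) ℝ,
      IsTailTest u (fun x => χ x * f x) ∧ IsTailTest v (fun x => χ x * f x) := by
    intro f
    have hb : ∀ w x, |ramp c (x w) * f x| ≤ ‖f‖ := fun w x => by
      rw [abs_mul]
      calc _ ≤ 1 * ‖f‖ := mul_le_mul (abs_ramp_le_one _ _) (f.norm_coe_le_norm x) (abs_nonneg _)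
            zero_le_one
        _ = ‖f‖ := one_mul _
    constructor
    · convert (isTailTest_ramp u hc).mul ((hramp v).mul f.continuous) (hb v) using 2 with x
      rw [hχr, Pi.mul_apply]; ring
    · convert (isTailTest_ramp v hc).mul ((hramp u).mul f.continuous) (hb u) using 2 with x
      rw [hχr, Pi.mul_apply]; ring
  have hfin : ∀ w : V, (∀ᵐ a ∂α w, a w = 1) → (∀ x, ramp c (x w) = 0 → χ x = 0) →
      IsFiniteMeasure ((radialMeasure (α w)).withDensity fun x => (χ x : ℝ≥0∞)) := by
    intro w hw h0
    refine isFiniteMeasure_withDensity ?_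
    refine ne_top_of_le_ne_top (radialMeasure_source_ne_top hw (c / 2) (by positivity)) ?_
    rw [← lintegral_indicator_one (measurableSet_lt_apply _ _)]
    refine lintegral_mono fun x => ?_
    by_cases hx : c / 2 < x w
    · rw [Set.indicator_of_mem (show x ∈ {x : V → ℝ≥0 | c / 2 < x w} from hx)]
      have : χ x ≤ 1 := by
        rw [← NNReal.coe_le_coe, hχr]
        exact mul_le_one₀ (ramp_le_one _ _) (ramp_nonneg _ _) (ramp_le_one _ _)
      simpa using this
    · rw [h0 x (ramp_eq_zero (not_lt.1 hx))]; simp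
  have hfu := hfin u hu fun x hx => by simp [χ, hx]
  have hfv := hfin v hv fun x hx => by simp [χ, hx]
  have heq : (radialMeasure (α u)).withDensity (fun x => (χ x : ℝ≥0∞)) =
      (radialMeasure (α v)).withDensity fun x => (χ x : ℝ≥0∞) := by
    refine ext_of_forall_integral_eq_of_IsFiniteMeasure fun f => ?_
    rw [integral_withDensity_eq_integral_smul hχm, integral_withDensity_eq_integral_smul hχm]
    simp only [NNReal.smul_def, smul_eq_mul]
    exact tendsto_nhds_unique (hTu _ (hTest f).1) (hTv _ (hTest f).2)
  have happ : ∀ m : Measure (V → ℝ≥0), (m.withDensity fun x => (χ x : ℝ≥0∞)) S = m S := by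
    intro m
    rw [withDensity_apply _ hS, setLIntegral_congr_fun (g := fun _ => 1) hS, setLIntegral_one]
    intro x hx
    have : χ x = 1 := by
      rw [← NNReal.coe_inj, hχr, ramp_eq_one hc (hSu x hx).le, ramp_eq_one hc (hSv x hx).le]
      simp
    simp [this]
  rw [← happ, heq, happ]

theorem radialMeasure_eq_of_pos {u v : V} (hu : ∀ᵐ a ∂α u, a u = 1) (hv : ∀ᵐ a ∂α v, a v = 1)
    (hTu : TailLimit u L (α u)) (hTv : TailLimit v L (α v))
    {S : Set (V → ℝ≥0)} (hS : MeasurableSet S) (hSu : ∀ x ∈ S, 0 < x u) (hSv : ∀ x ∈ S, 0 < x v) :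
    radialMeasure (α u) S = radialMeasure (α v) S := by
  let T : ℕ → Set (V → ℝ≥0) := fun n =>
    S ∩ ({x | 1 / ((n : ℝ≥0) + 1) < x u} ∩ {x | 1 / ((n : ℝ≥0) + 1) < x v})
  have hTm : ∀ n, MeasurableSet (T n) := fun n =>
    hS.inter ((measurableSet_lt_apply _ _).inter (measurableSet_lt_apply _ _))
  have hmono : Monotone T := by
    intro m n hmn x hx
    have : 1 / ((n : ℝ≥0) + 1) ≤ 1 / ((m : ℝ≥0) + 1) := by gcongr
    exact ⟨hx.1, this.trans_lt hx.2.1, this.trans_lt hx.2.2⟩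
  have hU : S = ⋃ n, T n := by
    ext x
    rw [Set.mem_iUnion]
    refine ⟨fun hx => ?_, fun ⟨n, hn⟩ => hn.1⟩
    obtain ⟨n, hn⟩ := exists_nat_one_div_lt
      (show (0 : ℝ) < min (x u) (x v) by exact lt_min (hSu x hx) (hSv x hx))
    refine ⟨n, hx, ?_, ?_⟩
    · have := hn.trans_le (min_le_left _ _)
      change 1 / ((n : ℝ≥0) + 1) < x u
      exact_mod_cast this
    · have := hn.trans_le (min_le_right _ _)
      change 1 / ((n : ℝ≥0) + 1) < x v
      exact_mod_cast this
  rw [hU, hmono.measure_iUnion, hmono.measure_iUnion]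
  refine iSup_congr fun n => radialMeasure_eq_of_subset hu hv hTu hTv
    (c := 1 / ((n : ℝ≥0) + 1)) (by positivity) (hTm n) (fun x hx => hx.2.1) fun x hx => hx.2.2

/-- There is a single measure whose restriction to `{x_u > 0}` is the tail limit with source `u`,
for every node `u`: take the mixture of the tail limits with weights `x_u / ∑ x_v`. -/
theorem exists_limitMeasure (hα : ∀ u, ∀ᵐ a ∂α u, a u = 1) (hT : ∀ u, TailLimit u L (α u)) :
    ∃ N : Measure (V → ℝ≥0), N {0} = 0 ∧
      ∀ u, N.restrict {x | 0 < x u} = radialMeasure (α u) := by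
  let w : V → (V → ℝ≥0) → ℝ≥0∞ := fun u x => ((x u / ∑ v, x v : ℝ≥0) : ℝ≥0∞)
  have hw : ∀ u, Measurable (w u) := fun u => by fun_prop
  have hw0 : ∀ u x, x u = 0 → w u x = 0 := fun u x hx => by simp [w, hx]
  have hw1 : ∀ u x, 0 < x u → ∑ v, w v x = 1 := by
    intro u x hx
    have hne : ∑ v, x v ≠ 0 := (Finset.sum_pos' (fun _ _ => zero_le) ⟨u, Finset.mem_univ u, hx⟩).ne'
    simp only [w]
    rw [← ENNReal.ofNNReal_finsetSum, ← Finset.sum_div, div_self hne, ENNReal.coe_one]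
  let N : Measure (V → ℝ≥0) := ∑ u, (radialMeasure (α u)).withDensity (w u)
  have hN : ∀ S, MeasurableSet S → N S = ∑ u, ∫⁻ x in S, w u x ∂radialMeasure (α u) := by
    intro S hS
    simp only [N, Measure.finsetSum_apply]
    exact Finset.sum_congr rfl fun u _ => withDensity_apply _ hS
  refine ⟨N, ?_, fun u => ?_⟩
  · rw [hN _ (measurableSet_singleton 0)]
    refine Finset.sum_eq_zero fun u _ => ?_
    rw [setLIntegral_congr_fun (g := fun _ => 0) (measurableSet_singleton 0), lintegral_zero]
    intro x hx
    rw [Set.mem_singleton_iff.1 hx]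
    exact hw0 u 0 rfl
  ext S hS
  rw [Measure.restrict_apply hS, hN _ (hS.inter (measurableSet_lt_apply 0 u))]
  have hsw : ∀ v, ∫⁻ x in S ∩ {x | 0 < x u}, w v x ∂radialMeasure (α v) =
      ∫⁻ x in S ∩ {x | 0 < x u}, w v x ∂radialMeasure (α u) := by
    intro v
    let S' : Set (V → ℝ≥0) := S ∩ {x | 0 < x u} ∩ {x | 0 < x v}
    have hS' : MeasurableSet S' :=
      (hS.inter (measurableSet_lt_apply 0 u)).inter (measurableSet_lt_apply 0 v)
    have hred : ∀ m : Measure (V → ℝ≥0), ∫⁻ x in S ∩ {x | 0 < x u}, w v x ∂m =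
        ∫⁻ x in S', w v x ∂m := by
      intro m
      rw [← lintegral_indicator hS', ← lintegral_indicator (hS.inter (measurableSet_lt_apply 0 u))]
      refine lintegral_congr fun x => ?_
      by_cases h1 : x ∈ S ∩ {x | 0 < x u}
      · rw [Set.indicator_of_mem h1]
        by_cases h2 : 0 < x v
        · rw [Set.indicator_of_mem (show x ∈ S' from ⟨h1, h2⟩)]
        · rw [hw0 v x (by simpa using h2), Set.indicator_of_notMem (fun h => h2 h.2)]
      · rw [Set.indicator_of_notMem h1, Set.indicator_of_notMem (fun h => h1 h.1)]
    rw [hred, hred]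
    congr 1
    ext T hTm
    rw [Measure.restrict_apply hTm, Measure.restrict_apply hTm]
    exact radialMeasure_eq_of_pos (hα v) (hα u) (hT v) (hT u) (hTm.inter hS')
      (fun x hx => hx.2.2) fun x hx => hx.2.1.2
  rw [Finset.sum_congr rfl fun v _ => hsw v, ← lintegral_finsetSum _ fun v _ => hw v,
    setLIntegral_congr_fun (g := fun _ => 1) (hS.inter (measurableSet_lt_apply 0 u))
      fun x hx => hw1 u x hx.2, setLIntegral_one]
  refine measure_inter_conull ?_
  have := radialMeasure_eq_zero_of_pos (α := α u) (v := u)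
    ((hα u).mono fun a ha => by rw [ha]; exact one_pos)
  refine measure_mono_null ?_ this
  intro x hx
  simpa using hx

variable {N : Measure (V → ℝ≥0)}

theorem limitMeasure_apply (hN : ∀ u, N.restrict {x | 0 < x u} = radialMeasure (α u)) {u : V}
    {S : Set (V → ℝ≥0)} (hS : S ⊆ {x | 0 < x u}) (hSm : MeasurableSet S) :
    N S = radialMeasure (α u) S := by
  rw [← hN u, Measure.restrict_apply hSm, Set.inter_eq_left.2 hS]

theorem limitMeasure_lt (hα : ∀ u, ∀ᵐ a ∂α u, a u = 1)
    (hN : ∀ u, N.restrict {x | 0 < x u} = radialMeasure (α u)) {c : ℝ≥0} (hc : 0 < c) (v : V) :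
    N {x | c < x v} = (c : ℝ≥0∞)⁻¹ := by
  have hS : {x : V → ℝ≥0 | c < x v} ⊆ {x | 0 < x v} := fun x hx => hc.trans hx
  rw [limitMeasure_apply hN hS (measurableSet_lt_apply _ _),
    radialMeasure_source_lt (hα v) hc]

theorem limitMeasure_exists_lt_ne_top (hα : ∀ u, ∀ᵐ a ∂α u, a u = 1)
    (hN : ∀ u, N.restrict {x | 0 < x u} = radialMeasure (α u)) {z : V → ℝ≥0} (hz : ∀ v, 0 < z v) :
    N {x | ∃ v, z v < x v} ≠ ∞ := by
  rw [Set.ofPred_exists]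
  refine ne_top_of_le_ne_top ?_ (measure_iUnion_fintype_le _ _)
  refine ENNReal.sum_ne_top.2 fun v _ => ?_
  rw [limitMeasure_lt hα hN (hz v)]
  simpa using (hz v).ne'

/-- Continuous bounded functions on the orthant that vanish near the origin. -/
structure IsOriginTest (f : (V → ℝ≥0) → ℝ) : Prop where
  continuous : Continuous f
  bounded : ∃ B : ℝ, 0 < B ∧ ∀ x, |f x| ≤ B
  vanish : ∃ ε : ℝ≥0, 0 < ε ∧ ∀ x : V → ℝ≥0, (∀ v, x v < ε) → f x = 0

theorem IsOriginTest.integrable (hα : ∀ u, ∀ᵐ a ∂α u, a u = 1)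
    (hN : ∀ u, N.restrict {x | 0 < x u} = radialMeasure (α u)) {f : (V → ℝ≥0) → ℝ}
    (hf : IsOriginTest f) : Integrable f N := by
  obtain ⟨B, -, hB⟩ := hf.bounded
  obtain ⟨ε, hε, h0⟩ := hf.vanish
  obtain ⟨c, hc, hcε⟩ := exists_between hε
  have hms : MeasurableSet {x : V → ℝ≥0 | ∃ v, c < x v} := by
    rw [Set.ofPred_exists]
    exact MeasurableSet.iUnion fun v => measurableSet_lt_apply c v
  have hb : Integrable ({x : V → ℝ≥0 | ∃ v, c < x v}.indicator fun _ => B) N :=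
    (integrable_indicator_iff hms).2 (integrableOn_const
      (limitMeasure_exists_lt_ne_top hα hN fun _ => hc))
  refine hb.mono' hf.continuous.aestronglyMeasurable (ae_of_all _ fun x => ?_)
  by_cases hx : ∃ v, c < x v
  · rw [Set.indicator_of_mem (show x ∈ {x : V → ℝ≥0 | ∃ v, c < x v} from hx)]; exact hB x
  · rw [Set.indicator_of_notMem (show x ∉ {x : V → ℝ≥0 | ∃ v, c < x v} from hx)]
    push Not at hx
    rw [h0 x fun v => (hx v).trans_lt hcε]; simp

/-- Convergence away from the origin: a partition of unity splits a test function into pieces that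
vanish where one of the coordinates is small. -/
theorem tendsto_integral_limitMeasure (hα : ∀ u, ∀ᵐ a ∂α u, a u = 1)
    (hT : ∀ u, TailLimit u L (α u))
    (hN : ∀ u, N.restrict {x | 0 < x u} = radialMeasure (α u)) {f : (V → ℝ≥0) → ℝ}
    (hf : IsOriginTest f) :
    Tendsto (fun t => ∫ x, f x ∂scaledLaw L t) atTop (𝓝 (∫ x, f x ∂N)) := by
  obtain ⟨B, hB0, hB⟩ := hf.bounded
  obtain ⟨ε, hε, h0⟩ := hf.vanish
  have hfc := hf.continuous
  have hramp : ∀ w : V, Continuous fun x : V → ℝ≥0 => ramp ε (x w) := fun w =>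
    (continuous_ramp ε).comp (continuous_apply w)
  -- the maximum with `1` is not seen by `f`, which vanishes unless some ramp equals one
  let q : (V → ℝ≥0) → ℝ := fun x => f x / max 1 (∑ v, ramp ε (x v))
  have hq1 : ∀ x : V → ℝ≥0, 1 ≤ max 1 (∑ v, ramp ε (x v)) := fun x => le_max_left _ _
  have hq : Continuous q := hfc.div₀ (by fun_prop) fun x => by have := hq1 x; positivity
  have hqB : ∀ x, |q x| ≤ B := fun x => by
    rw [abs_div, abs_of_pos (zero_lt_one.trans_le (hq1 x))]
    exact (div_le_self (abs_nonneg _) (hq1 x)).trans (hB x)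
  have hpt : ∀ u, IsTailTest u fun x => ramp ε (x u) * q x := fun u =>
    (isTailTest_ramp u hε).mul hq hqB
  have hsum : ∀ x, f x = ∑ u, ramp ε (x u) * q x := by
    intro x
    rw [← Finset.sum_mul]
    by_cases hx : ∃ v, ε ≤ x v
    · obtain ⟨v, hv⟩ := hx
      have h1 : 1 ≤ ∑ v, ramp ε (x v) := by
        rw [← ramp_eq_one hε hv]
        exact Finset.single_le_sum (f := fun v => ramp ε (x v)) (fun _ _ => ramp_nonneg _ _)
          (Finset.mem_univ v)
      simp only [q]
      rw [max_eq_right h1]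
      have : ∑ v, ramp ε (x v) ≠ 0 := by positivity
      field_simp
    · push Not at hx
      simp [q, h0 x hx]
  have hi : ∀ u, Integrable (fun x => ramp ε (x u) * q x) N := fun u => by
    refine (hpt u).integrable fun c hc => ?_
    rw [limitMeasure_lt hα hN hc]
    simpa using hc.ne'
  have hlim : ∀ u, ∫ x, ramp ε (x u) * q x ∂N = ∫ x, ramp ε (x u) * q x ∂radialMeasure (α u) := by
    intro u
    rw [← hN u, setIntegral_eq_integral_of_forall_compl_eq_zero]
    intro x hx
    rw [ramp_eq_zero (by
      have : x u = 0 := by simpa using hx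
      rw [this]; exact zero_le), zero_mul]
  simp_rw [hsum]
  rw [integral_finsetSum _ fun u _ => hi u]
  simp_rw [hlim]
  refine (tendsto_finsetSum _ fun u _ => hT u _ (hpt u)).congr fun t => ?_
  rw [integral_finsetSum]
  exact fun u _ => (hpt u).integrable fun c _ => measure_ne_top _ _

end LimitMeasure

/-! ### Exponent measure, distribution function and mass on the axes -/

section Exponent

variable {V : Type*} [Fintype V] {L : Measure (V → ℝ≥0)} {α : V → Measure (V → ℝ≥0)}
  [IsProbabilityMeasure L] [∀ u, IsProbabilityMeasure (α u)] {N : Measure (V → ℝ≥0)}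

theorem measurableSet_exists_lt (z : V → ℝ≥0) : MeasurableSet {x : V → ℝ≥0 | ∃ v, z v < x v} := by
  rw [Set.ofPred_exists]
  exact MeasurableSet.iUnion fun v => measurableSet_lt_apply _ v

/-- The boundary of `{x | ∃ v, z_v < x_v}` has no mass, whence convergence on this set, by
approximation with continuous functions from below and from above. -/
theorem tendsto_scaledLaw_exists_lt (hα : ∀ u, ∀ᵐ a ∂α u, a u = 1)
    (hT : ∀ u, TailLimit u L (α u))
    (hN : ∀ u, N.restrict {x | 0 < x u} = radialMeasure (α u)) {z : V → ℝ≥0} (hz : ∀ v, 0 < z v) :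
    Tendsto (fun t => (scaledLaw L t).real {x | ∃ v, z v < x v}) atTop
      (𝓝 (N.real {x | ∃ v, z v < x v})) := by
  let F : (V → ℝ≥0) → ℝ≥0 := fun x => Finset.univ.sup fun v => x v / z v
  have hF : Continuous F := Continuous.finset_sup_apply fun v _ => by fun_prop
  have hF1 : ∀ x, 1 < F x ↔ ∃ v, z v < x v := fun x => by
    simp only [F, Finset.lt_sup_iff, Finset.mem_univ, true_and, one_lt_div (hz _)]
  have hnull : ∀ᵐ x ∂N, F x ≠ 1 := by
    have h1 : ∀ v, ∀ᵐ x ∂N, x v ≠ z v := fun v => by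
      have hS : {x : V → ℝ≥0 | x v = z v} ⊆ {x | 0 < x v} := fun x hx => by
        have hx' : x v = z v := hx
        change 0 < x v
        rw [hx']; exact hz v
      have h2 : N {x | x v = z v} = 0 := by
        rw [limitMeasure_apply hN hS (measurableSet_eq_fun (by fun_prop) (by fun_prop)),
          radialMeasure_eq _ (hz v).ne']
      rw [ae_iff]
      simpa using h2
    filter_upwards [ae_all_iff.2 h1] with x hx h2
    have h3 : ∀ v, x v / z v < 1 := by
      intro v
      have h4 : x v / z v ≤ 1 := h2 ▸ Finset.le_sup (f := fun v => x v / z v) (Finset.mem_univ v)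
      refine lt_of_le_of_ne h4 fun h5 => hx v ?_
      rwa [div_eq_one_iff_eq (hz v).ne'] at h5
    have h4 : F x < 1 := (Finset.sup_lt_iff (by simp)).2 fun v _ => h3 v
    exact h4.ne h2
  -- `H 0 k` increases to the indicator of `{F > 1}`, and `H 1 k` decreases to that of `{F ≥ 1}`
  let H : ℝ → ℕ → (V → ℝ≥0) → ℝ := fun j k x => min 1 (max 0 ((k + 2) * ((F x : ℝ) - 1) + j))
  have hH0 : ∀ j k x, 0 ≤ H j k x := fun j k x => by simp only [H]; positivity
  have hH1 : ∀ j k x, H j k x ≤ 1 := fun j k x => min_le_left _ _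
  have hHt : ∀ j ≤ (1 : ℝ), ∀ k, IsOriginTest (H j k) := by
    intro j hj k
    refine ⟨by fun_prop, ⟨1, one_pos, fun x => by
      rw [abs_of_nonneg (hH0 j k x)]; exact hH1 j k x⟩, ?_⟩
    have h1 : ∀ᶠ ε in 𝓝[>] (0 : ℝ≥0), ∀ v, ε < z v / 2 := eventually_all.2 fun v =>
      nhdsWithin_le_nhds (Iio_mem_nhds (half_pos (hz v)))
    obtain ⟨ε, h1, h2⟩ := (h1.and self_mem_nhdsWithin).exists
    refine ⟨ε, h2, fun x hx => ?_⟩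
    have h3 : F x ≤ 1 / 2 := Finset.sup_le fun v _ => by
      rw [div_le_iff₀ (hz v)]
      exact ((hx v).trans (h1 v)).le.trans (by rw [div_mul_eq_mul_div, one_mul])
    have h4 : (F x : ℝ) ≤ 1 / 2 := by exact_mod_cast h3
    have h5 : ((k : ℝ) + 2) * ((F x : ℝ) - 1) + j ≤ 0 := by
      have : (0 : ℝ) ≤ k := by positivity
      nlinarith
    simp only [H]
    rw [max_eq_left h5]; simp
  have hlim : ∀ j, 0 ≤ j → j ≤ (1 : ℝ) → Tendsto (fun k => ∫ x, H j k x ∂N) atTop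
      (𝓝 (N.real {x | ∃ v, z v < x v})) := by
    intro j hj0 hj
    rw [← integral_indicator_one (measurableSet_exists_lt z)]
    refine tendsto_integral_of_dominated_convergence (H 1 0)
      (fun k => (hHt j hj k).continuous.aestronglyMeasurable)
      ((hHt 1 le_rfl 0).integrable hα hN) (fun k => ae_of_all _ fun x => ?_) ?_
    · rw [Real.norm_eq_abs, abs_of_nonneg (hH0 j k x)]
      rcases le_total (F x : ℝ) 1 with h | h
      · simp only [H]
        have : (0 : ℝ) ≤ k := by positivity
        have h2 : ((k : ℝ) + 2) * ((F x : ℝ) - 1) + j ≤ ((0 : ℕ) + 2) * ((F x : ℝ) - 1) + 1 := by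
          push_cast
          nlinarith
        gcongr
      · have : H 1 0 x = 1 := by
          simp only [H]
          rw [min_eq_left]
          refine le_max_of_le_right ?_
          push_cast
          linarith
        rw [this]; exact hH1 j k x
    · filter_upwards [hnull] with x hx
      refine tendsto_const_nhds.congr' ?_
      rcases lt_or_gt_of_ne hx with h | h
      · rw [Set.indicator_of_notMem (show x ∉ {x : V → ℝ≥0 | ∃ v, z v < x v} from
          fun h' => h.not_gt ((hF1 x).2 h'))]
        have h' : (0 : ℝ) < 1 - F x := sub_pos.2 (by exact_mod_cast h)
        obtain ⟨n, hn⟩ := exists_nat_ge (1 / (1 - (F x : ℝ)))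
        filter_upwards [eventually_ge_atTop n] with k hk
        have hk' : (n : ℝ) ≤ k := by exact_mod_cast hk
        rw [div_le_iff₀ h'] at hn
        simp only [H]
        rw [max_eq_left (by nlinarith)]; simp
      · rw [Set.indicator_of_mem (show x ∈ {x : V → ℝ≥0 | ∃ v, z v < x v} from (hF1 x).1 h)]
        have h' : (0 : ℝ) < F x - 1 := sub_pos.2 (by exact_mod_cast h)
        obtain ⟨n, hn⟩ := exists_nat_ge (1 / ((F x : ℝ) - 1))
        filter_upwards [eventually_ge_atTop n] with k hk
        have hk' : (n : ℝ) ≤ k := by exact_mod_cast hk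
        rw [div_le_iff₀ h'] at hn
        simp only [H, Pi.one_apply]
        rw [min_eq_left (le_max_of_le_right (by nlinarith))]
  have hsand : ∀ k t, ∫ x, H 0 k x ∂scaledLaw L t ≤ (scaledLaw L t).real {x | ∃ v, z v < x v} ∧
      (scaledLaw L t).real {x | ∃ v, z v < x v} ≤ ∫ x, H 1 k x ∂scaledLaw L t := by
    intro k t
    have hi : ∀ j ≤ (1 : ℝ), Integrable (H j k) (scaledLaw L t) := fun j hj =>
      Integrable.of_bound (C := 1) (hHt j hj k).continuous.aestronglyMeasurable
        (ae_of_all _ fun x => by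
          rw [Real.norm_eq_abs, abs_of_nonneg (hH0 j k x)]; exact hH1 j k x)
    have hind : Integrable ({x : V → ℝ≥0 | ∃ v, z v < x v}.indicator (1 : (V → ℝ≥0) → ℝ))
        (scaledLaw L t) :=
      (integrable_indicator_iff (measurableSet_exists_lt z)).2
        (integrableOn_const (measure_ne_top _ _))
    rw [← integral_indicator_one (measurableSet_exists_lt z)]
    refine ⟨integral_mono (hi 0 zero_le_one) hind fun x => ?_,
      integral_mono hind (hi 1 le_rfl) fun x => ?_⟩
    · by_cases hx : ∃ v, z v < x v
      · rw [Set.indicator_of_mem (show x ∈ {x : V → ℝ≥0 | ∃ v, z v < x v} from hx)]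
        exact hH1 0 k x
      · rw [Set.indicator_of_notMem (show x ∉ {x : V → ℝ≥0 | ∃ v, z v < x v} from hx)]
        have h1 : (F x : ℝ) ≤ 1 := by exact_mod_cast not_lt.1 fun h => hx ((hF1 x).1 h)
        simp only [H]
        rw [max_eq_left (by
          have : (0 : ℝ) ≤ k := by positivity
          nlinarith)]
        simp
    · by_cases hx : ∃ v, z v < x v
      · rw [Set.indicator_of_mem (show x ∈ {x : V → ℝ≥0 | ∃ v, z v < x v} from hx)]
        have h1 : (1 : ℝ) < F x := by exact_mod_cast (hF1 x).2 hx
        simp only [H, Pi.one_apply]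
        rw [min_eq_left (le_max_of_le_right (by
          have : (0 : ℝ) ≤ k := by positivity
          nlinarith))]
      · rw [Set.indicator_of_notMem (show x ∉ {x : V → ℝ≥0 | ∃ v, z v < x v} from hx)]
        exact hH0 1 k x
  rw [Metric.tendsto_nhds]
  intro η hη
  obtain ⟨k, hk0, hk1⟩ := ((Metric.tendsto_nhds.1 (hlim 0 le_rfl zero_le_one) (η / 2)
    (by positivity)).and (Metric.tendsto_nhds.1 (hlim 1 zero_le_one le_rfl) (η / 2)
    (by positivity))).exists
  filter_upwards [Metric.tendsto_nhds.1 (tendsto_integral_limitMeasure hα hT hN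
    (hHt 0 zero_le_one k)) (η / 2) (by positivity), Metric.tendsto_nhds.1
    (tendsto_integral_limitMeasure hα hT hN (hHt 1 le_rfl k)) (η / 2) (by positivity)]
    with t h0 h1
  have h2 := hsand k t
  rw [Real.dist_eq, abs_lt] at hk0 hk1 h0 h1 ⊢
  constructor <;> linarith [hk0.1, hk1.2, h0.1, h1.2, h2.1, h2.2]

/-- The max-domain of attraction: `P(X ≤ n z)ⁿ = (1 - P(X / n ≰ z))ⁿ`. -/
theorem tendsto_cdf_pow (hα : ∀ u, ∀ᵐ a ∂α u, a u = 1) (hT : ∀ u, TailLimit u L (α u))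
    (hN : ∀ u, N.restrict {x | 0 < x u} = radialMeasure (α u)) {z : V → ℝ≥0} (hz : ∀ v, 0 < z v) :
    Tendsto (fun n : ℕ => (L {x | ∀ v, x v ≤ n * z v}).toReal ^ n) atTop
      (𝓝 (Real.exp (-(N {x | ∃ v, z v < x v}).toReal))) := by
  have h1 := (tendsto_scaledLaw_exists_lt hα hT hN hz).comp
    (tendsto_natCast_atTop_atTop (R := ℝ≥0))
  have h2 : Tendsto (fun n : ℕ => (n : ℝ) * -(L.real {x | ∃ v, (n : ℝ≥0) * z v < x v})) atTop
      (𝓝 (-(N {x | ∃ v, z v < x v}).toReal)) := by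
    refine h1.neg.congr' ?_
    filter_upwards [eventually_gt_atTop 0] with n hn
    have hn' : (0 : ℝ≥0) < n := by exact_mod_cast hn
    rw [Function.comp, mul_neg, neg_inj, Measure.real, scaledLaw, Measure.smul_apply,
      Measure.map_apply (by fun_prop) (measurableSet_exists_lt z), ENNReal.smul_def, smul_eq_mul,
      ENNReal.toReal_mul]
    congr 3
    ext x
    simp [lt_div_iff₀ hn', mul_comm]
  refine (Real.tendsto_one_add_pow_exp_of_tendsto h2).congr fun n => ?_
  congr 1
  have h3 : {x : V → ℝ≥0 | ∀ v, x v ≤ n * z v} = {x | ∃ v, (n : ℝ≥0) * z v < x v}ᶜ := by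
    ext x; simp
  have h4 := probReal_compl_eq_one_sub (μ := L) (measurableSet_exists_lt fun v => (n : ℝ≥0) * z v)
  rw [h3]
  change 1 + _ = L.real _
  rw [h4]
  ring

/-- The marginal tail at `v` splits into the part with `x_u > 0`, of mass `E[A_{uv}] / c`, and the
part with `x_u = 0`. -/
theorem limitMeasure_split (hα : ∀ u, ∀ᵐ a ∂α u, a u = 1)
    (hN : ∀ u, N.restrict {x | 0 < x u} = radialMeasure (α u)) {c : ℝ≥0} (hc : 0 < c) (u v : V) :
    (c : ℝ≥0∞)⁻¹ = (c : ℝ≥0∞)⁻¹ * ∫⁻ a, (a v : ℝ≥0∞) ∂α u + N ({x | c < x v} ∩ {x | x u = 0}) := by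
  have h1 := measure_inter_add_sdiff (μ := N) {x : V → ℝ≥0 | c < x v} (measurableSet_lt_apply 0 u)
  rw [limitMeasure_lt hα hN hc] at h1
  rw [← radialMeasure_lt (α u) hc v, ← hN u, Measure.restrict_apply (measurableSet_lt_apply c v),
    ← h1]
  congr 2
  ext x
  simp

/-- If all `A_{uv}` have unit mean, then the marginal tails leave no mass for `{x_u = 0}`. -/
theorem limitMeasure_axis_eq_zero (hα : ∀ u, ∀ᵐ a ∂α u, a u = 1) (hN0 : N {0} = 0)
    (hN : ∀ u, N.restrict {x | 0 < x u} = radialMeasure (α u)) {u : V}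
    (h1 : ∀ v, ∫⁻ a, (a v : ℝ≥0∞) ∂α u = 1) : N {x | x u = 0} = 0 := by
  have h2 : ∀ (v : V) (n : ℕ), N ({x | 1 / ((n : ℝ≥0) + 1) < x v} ∩ {x | x u = 0}) = 0 := by
    intro v n
    have hc : (0 : ℝ≥0) < 1 / ((n : ℝ≥0) + 1) := by positivity
    have h3 := limitMeasure_split hα hN hc u v
    rw [h1 v, mul_one] at h3
    have hfin : ((1 / ((n : ℝ≥0) + 1) : ℝ≥0) : ℝ≥0∞)⁻¹ ≠ ∞ :=
      ENNReal.inv_ne_top.2 (ENNReal.coe_ne_zero.2 hc.ne')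
    exact (ENNReal.add_right_inj hfin).1 (by rw [add_zero]; exact h3.symm)
  refine measure_mono_null (t := {0} ∪ ⋃ (v : V) (n : ℕ),
    ({x | 1 / ((n : ℝ≥0) + 1) < x v} ∩ {x | x u = 0})) (fun x hx => ?_)
    (measure_union_null hN0 (measure_iUnion_null fun v => measure_iUnion_null fun n => h2 v n))
  by_cases h0 : x = 0
  · exact Or.inl h0
  · right
    obtain ⟨v, hv⟩ := Function.ne_iff.1 h0
    have hv' : 0 < x v := pos_iff_ne_zero.2 hv
    obtain ⟨n, hn⟩ := exists_nat_one_div_lt (NNReal.coe_pos.2 hv')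
    refine Set.mem_iUnion₂.2 ⟨v, n, ?_, hx⟩
    change 1 / ((n : ℝ≥0) + 1) < x v
    exact_mod_cast hn

/-- The mass of `{x_b > 1, x_a = 0}` is the probability that `A_{ba} = 0`. -/
theorem lintegral_add_measure_zero_eq_one (hα : ∀ u, ∀ᵐ a ∂α u, a u = 1)
    (hN : ∀ u, N.restrict {x | 0 < x u} = radialMeasure (α u)) (a b : V) :
    ∫⁻ x, (x b : ℝ≥0∞) ∂α a + α b {x | x a = 0} = 1 := by
  have h1 := limitMeasure_split hα hN one_pos a b
  simp only [ENNReal.coe_one, inv_one, one_mul] at h1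
  have hm : MeasurableSet {x : V → ℝ≥0 | x a = 0} :=
    measurableSet_eq_fun (by fun_prop) (by fun_prop)
  have hm' : MeasurableSet ({x : V → ℝ≥0 | 1 < x b} ∩ {x | x a = 0}) :=
    (measurableSet_lt_apply 1 b).inter hm
  have hS : {x : V → ℝ≥0 | 1 < x b} ∩ {x | x a = 0} ⊆ {x | 0 < x b} := fun x hx =>
    show 0 < x b from lt_trans zero_lt_one (show (1 : ℝ≥0) < x b from hx.1)
  rw [limitMeasure_apply hN hS hm', radialMeasure_apply _ hm'] at h1
  rw [h1, ← lintegral_indicator_one hm]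
  congr 1
  refine lintegral_congr_ae ?_
  filter_upwards [hα b] with x hx
  by_cases h0 : x a = 0
  · rw [Set.indicator_of_mem (show x ∈ {x : V → ℝ≥0 | x a = 0} from h0)]
    have : {r : ℝ≥0 | (fun v => r * x v) ∈ {x : V → ℝ≥0 | 1 < x b} ∩ {x | x a = 0}} =
        Set.Ioi 1 := by
      ext r; simp [hx, h0]
    rw [this, paretoMeasure_Ioi one_pos]; simp
  · rw [Set.indicator_of_notMem (show x ∉ {x : V → ℝ≥0 | x a = 0} from h0)]
    have : {r : ℝ≥0 | (fun v => r * x v) ∈ {x : V → ℝ≥0 | 1 < x b} ∩ {x | x a = 0}} = ∅ := by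
      ext r
      simp only [Set.mem_ofPred_eq, Set.mem_inter_iff, hx, mul_one, mul_eq_zero, h0, or_false,
        Set.mem_empty_iff_false, iff_false, not_and]
      rintro h rfl
      exact absurd h (by simp)
    rw [this]; simp

/-- This includes `x = 0`, where the left-hand side reads `∞ < r a`. -/
theorem inv_lt_mul_iff (x r a : ℝ≥0) : (x : ℝ≥0∞)⁻¹ < ((r * a : ℝ≥0) : ℝ≥0∞) ↔ 1 < r * (x * a) := by
  rcases eq_or_ne x 0 with rfl | hx
  · simp
  · rw [← ENNReal.coe_inv hx, ENNReal.coe_lt_coe, inv_lt_iff_one_lt_mul₀ (pos_iff_ne_zero.2 hx)]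
    ring_nf

theorem radialMeasure_exists_inv_lt (β : Measure (V → ℝ≥0)) (x : V → ℝ≥0) :
    radialMeasure β {y | ∃ v, (x v : ℝ≥0∞)⁻¹ < (y v : ℝ≥0∞)} =
      ∫⁻ a, ⨆ v, ((x v * a v : ℝ≥0) : ℝ≥0∞) ∂β := by
  have hm : MeasurableSet {y : V → ℝ≥0 | ∃ v, (x v : ℝ≥0∞)⁻¹ < (y v : ℝ≥0∞)} := by
    rw [Set.ofPred_exists]
    exact MeasurableSet.iUnion fun v => measurableSet_lt (by fun_prop) (by fun_prop)
  rw [radialMeasure_apply _ hm]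
  refine lintegral_congr fun a => ?_
  have h1 : {r : ℝ≥0 | (fun v => r * a v) ∈ {y : V → ℝ≥0 | ∃ v, (x v : ℝ≥0∞)⁻¹ < (y v : ℝ≥0∞)}} =
      {r | 1 < r * Finset.univ.sup fun v => x v * a v} := by
    ext r
    rw [Set.mem_ofPred_eq, Set.mem_ofPred_eq, Set.mem_ofPred_eq, NNReal.mul_finset_sup,
      Finset.lt_sup_iff]
    simp only [Finset.mem_univ, true_and, inv_lt_mul_iff]
  rw [h1, paretoMeasure_lt_mul one_pos, ENNReal.coe_one, inv_one, one_mul, ENNReal.coe_finset_sup,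
    Finset.sup_univ_eq_iSup]

end Exponent

/-! ### Measures on the punctured orthant -/

section Punctured

variable {V : Type*} [Fintype V]

theorem measurableEmbedding_punctured :
    MeasurableEmbedding (Subtype.val : Punctured V → V → ℝ≥0) :=
  MeasurableEmbedding.subtype_coe (measurableSet_singleton (0 : V → ℝ≥0)).compl

theorem map_comap_punctured {N : Measure (V → ℝ≥0)} (hN : N {0} = 0) :
    (N.comap (Subtype.val : Punctured V → V → ℝ≥0)).map Subtype.val = N := by
  rw [measurableEmbedding_punctured.map_comap, Subtype.range_coe_subtype]
  refine Measure.restrict_eq_self_of_ae_mem ?_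
  rw [ae_iff]
  simpa using hN

theorem integral_comap_punctured (m : Measure (V → ℝ≥0)) {f : (V → ℝ≥0) → ℝ} (h0 : f 0 = 0) :
    ∫ x, f x.1 ∂m.comap (Subtype.val : Punctured V → V → ℝ≥0) = ∫ x, f x ∂m := by
  rw [← measurableEmbedding_punctured.integral_map, measurableEmbedding_punctured.map_comap,
    Subtype.range_coe_subtype, setIntegral_eq_integral_of_forall_compl_eq_zero]
  intro x hx
  have : x = 0 := by simpa using hx
  rw [this, h0]

open Classical in
/-- The extension of a function on the punctured orthant by zero. -/
def extendZero (f : Punctured V → ℝ) (x : V → ℝ≥0) : ℝ :=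
  if h : x ≠ 0 then f ⟨x, h⟩ else 0

theorem extendZero_coe (f : Punctured V → ℝ) (x : Punctured V) : extendZero f x.1 = f x := by
  rw [extendZero, dif_pos x.2]

theorem extendZero_zero (f : Punctured V → ℝ) : extendZero f 0 = 0 := by simp [extendZero]

theorem isOriginTest_extendZero (f : TestFun V) : IsOriginTest (extendZero f.1) := by
  obtain ⟨f, ε, hε, h0⟩ := f
  have hvan : ∀ x : V → ℝ≥0, (∀ v, x v < ε) → extendZero f x = 0 := by
    intro x hx
    by_cases h : x = 0
    · rw [h, extendZero_zero]
    · rw [extendZero, dif_pos h]; exact h0 ⟨x, h⟩ hx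
  refine ⟨?_, ⟨‖f‖ + 1, by positivity, fun x => ?_⟩, ε, hε, hvan⟩
  · rw [continuous_iff_continuousAt]
    intro x
    by_cases h : x = 0
    · subst h
      have hev : ∀ᶠ x in 𝓝 (0 : V → ℝ≥0), ∀ v, x v < ε := eventually_all.2 fun v =>
        (continuous_apply v).continuousAt.eventually_lt_const (by simpa using hε)
      refine (continuousAt_const (y := (0 : ℝ))).congr ?_
      filter_upwards [hev] with x hx
      exact (hvan x hx).symm
    · have ho : IsOpen {x : V → ℝ≥0 | x ≠ 0} := isOpen_ne
      refine (ho.isOpenEmbedding_subtypeVal.continuousAt_iff (x := ⟨x, h⟩)).1 ?_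
      have : extendZero f ∘ (Subtype.val : Punctured V → V → ℝ≥0) = f :=
        funext fun y => extendZero_coe f y
      change ContinuousAt (extendZero f ∘ (Subtype.val : Punctured V → V → ℝ≥0)) ⟨x, h⟩
      rw [this]
      exact f.continuous.continuousAt
  · by_cases h : x = 0
    · rw [h, extendZero_zero, abs_zero]; positivity
    · rw [extendZero, dif_pos h]
      exact (f.norm_coe_le_norm _).trans (by linarith)

theorem M0.tendsto_iff {ι : Type*} {l : Filter ι} {m : ι → M0 V} {μ : M0 V} :
    Tendsto m l (𝓝 μ) ↔ ∀ f : TestFun V,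
      Tendsto (fun i => ∫ x, f.1 x ∂(m i).toMeasure) l (𝓝 (∫ x, f.1 x ∂μ.toMeasure)) := by
  rw [nhds_iInf, tendsto_iInf]
  simp only [nhds_induced, tendsto_comap_iff]
  rfl

theorem integral_scaledTail {Ω : Type*} [MeasurableSpace Ω] (P : Measure Ω)
    [IsProbabilityMeasure P] {X : Ω → V → ℝ≥0} (hX : Measurable X) (t : ℝ≥0) (f : TestFun V) :
    ∫ x, f.1 x ∂(scaledTail P X t).toMeasure = ∫ x, extendZero f.1 x ∂scaledLaw (P.map X) t := by
  have h1 : ∀ m : Measure (Punctured V), ∫ x, f.1 x ∂m = ∫ x, extendZero f.1 x.1 ∂m := fun m => by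
    simp only [extendZero_coe]
  rw [scaledTail, h1, integral_smul_nnreal_measure, integral_comap_punctured _ (extendZero_zero _),
    scaledLaw, integral_smul_nnreal_measure, Measure.map_map (by fun_prop) hX]
  rfl

end Punctured

/-! ### Increments on a single edge -/

section Edge

variable {V : Type*} [Fintype V] {G : SimpleGraph V} {Ω : Type*}

theorem limitField_of_adj (hG : G.Connected) {a b : V} (hab : G.Adj a b) (Z : V → V → Ω → ℝ≥0)
    (ω : Ω) : limitField G Z a ω b = Z a b ω := by
  classical
  have h : (pathEdges G a b).toFinset = {(a, b)} := by
    ext e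
    rw [Set.mem_toFinset, pathEdges_of_adj hG hab]
    simp
  rw [limitField]
  convert Finset.prod_singleton (fun e : V × V => Z e.1 e.2 ω) (a, b)

variable [MeasurableSpace Ω]

/-- The law of an increment on an edge does not depend on the source node. -/
theorem IsIncrement.map_eq_map_limitField {Ω' : Type*} [MeasurableSpace Ω']
    {ν : (C : Set V) → (s : V) → ProbabilityMeasure (↥(C \ {s}) → ℝ≥0)}
    (hb : IsBlockGraph G) (hG : G.Connected) {u a b v : V} {Q : Measure Ω} {Z : V → V → Ω → ℝ≥0}
    {Q' : Measure Ω'} {Z' : V → V → Ω' → ℝ≥0} (hZ : IsIncrement G ν u Q Z)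
    (hZ' : IsIncrement G ν a Q' Z') (hab : G.Adj a b) (he : (a, b) ∈ pathEdges G u v) :
    AEMeasurable (Z a b) Q ∧ Q.map (Z a b) = Q'.map fun ω => limitField G Z' a ω b := by
  obtain ⟨C, hC, hs, ha, hbC⟩ := hb.exists_entry hG he
  have h1 := hZ'.map_eq hC (Or.inl ⟨ha, rfl⟩) hbC
  refine ⟨hZ.aemeasurable hC hs hbC, (hZ.map_eq hC hs hbC).trans (h1.symm.trans ?_)⟩
  simp only [limitField_of_adj hG hab]

end Edge

end

end MarkovBlock

open MarkovBlock in
theorem mainTheorem7 {V : Type*} [Fintype V] (G : SimpleGraph V)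
    (hconn : G.Connected) (hblock : MarkovBlock.IsBlockGraph G)
    {Ω : Type*} [MeasurableSpace Ω] (P : Measure Ω) [IsProbabilityMeasure P]
    (X : Ω → V → ℝ≥0) (hX : MarkovBlock.IsMarkovField G P X)
    (κ : (C : Set V) → (s : V) → Kernel ℝ≥0 (↥(C \ {s}) → ℝ≥0))
    [∀ C s, IsMarkovKernel (κ C s)]
    (hκ : MarkovBlock.IsCliqueCondLaw G P X κ)
    (ν : (C : Set V) → (s : V) → ProbabilityMeasure (↥(C \ {s}) → ℝ≥0))
    (hν : MarkovBlock.CliqueTailLimit G κ ν)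
    (hzero : MarkovBlock.ZeroCondition G κ ν)
    (htail : ∀ v, Tendsto (fun t : ℝ≥0 => (t : ℝ≥0∞) * P {ω | t < X ω v}) atTop (𝓝 1))
    {Ω' : V → Type*} [∀ u, MeasurableSpace (Ω' u)] (Q : ∀ u, Measure (Ω' u))
    [∀ u, IsProbabilityMeasure (Q u)]
    (Z : ∀ u, V → V → Ω' u → ℝ≥0)
    (hZ : ∀ u, MarkovBlock.IsIncrement G ν u (Q u) (Z u)) :
    ∃ μ : MarkovBlock.M0 V,
      -- `μ` is the limit measure of the field, given by the formula with the indicator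
      Tendsto (fun t : ℝ≥0 => MarkovBlock.scaledTail P X t) atTop (𝓝 μ) ∧
      (∀ u : V, ∀ f : (V → ℝ≥0) → ℝ≥0∞, Measurable f →
        ∫⁻ x in {x : MarkovBlock.Punctured V | 0 < x.1 u}, f x.1 ∂μ.toMeasure =
          MarkovBlock.radialIntegral (Q u) (MarkovBlock.limitField G (Z u) u) f) ∧
      -- the max-stable distribution with exponent measure `μ` attracts the law of `X`
      (∀ x : V → ℝ≥0, (∀ v, 0 < x v) →
        Tendsto (fun n : ℕ => (P {ω | ∀ v, X ω v ≤ n * x v}).toReal ^ n) atTop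
          (𝓝 (MarkovBlock.maxStableCdf μ fun v => (x v : ℝ≥0∞)))) ∧
      -- simplifications for a source node `u` all of whose increments have unit mean
      (∀ u : V,
        (∀ v, v ≠ u → ∀ e ∈ MarkovBlock.pathEdges G u v,
          ∫⁻ ω, (Z u e.1 e.2 ω : ℝ≥0∞) ∂(Q u) = 1) →
        μ.toMeasure {x | x.1 u = 0} = 0 ∧
        (∀ f : (V → ℝ≥0) → ℝ≥0∞, Measurable f →
          ∫⁻ x, f x.1 ∂μ.toMeasure =
            MarkovBlock.radialIntegral (Q u) (MarkovBlock.limitField G (Z u) u) f) ∧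
        (∀ x : V → ℝ≥0,
          ENNReal.ofReal (MarkovBlock.stdf μ x) =
            ∫⁻ ω, ⨆ v, ((x v * MarkovBlock.limitField G (Z u) u ω v : ℝ≥0) : ℝ≥0∞) ∂(Q u))) ∧
      -- the unit-mean condition on an edge, in terms of the reversed edge
      (∀ a b : V, G.Adj a b → ∀ u u' : V,
        (∃ v, (a, b) ∈ MarkovBlock.pathEdges G u v) →
        (∃ v, (b, a) ∈ MarkovBlock.pathEdges G u' v) →
        (∫⁻ ω, (Z u a b ω : ℝ≥0∞) ∂(Q u) = 1 ↔ Q u' {ω | 0 < Z u' b a ω} = 1)) := by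
  obtain ⟨hXm, hL⟩ := hX
  have hA : ∀ u, AEMeasurable (limitField G (Z u) u) (Q u) := fun u =>
    (hZ u).aemeasurable_limitField hconn hblock
  have hmap : ∀ u, IsProbabilityMeasure ((Q u).map (limitField G (Z u) u)) := fun u =>
    (hZ u).isProbabilityMeasure_map hconn hblock
  have hprob : IsProbabilityMeasure (P.map X) := Measure.isProbabilityMeasure_map hXm.aemeasurable
  have hT : ∀ u, TailLimit u (P.map X) ((Q u).map (limitField G (Z u) u)) := by
    intro u
    refine tailLimit_limitField hconn hblock hL (κ := κ) (fun C hC s hs => ?_) hν hzero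
      (fun v => ?_) (hZ u)
    · have h := hκ C hC s hs
      have hm : Measurable fun x : V → ℝ≥0 => (x s, fun v : ↥(C \ {s}) => x v) := by fun_prop
      refine ⟨hm.aemeasurable, ?_⟩
      rw [Measure.map_map hm hXm, Measure.map_map (by fun_prop) hXm]
      exact h.map_eq
    · refine (htail v).congr fun t => ?_
      rw [Measure.map_apply hXm (measurableSet_lt (by fun_prop) (by fun_prop))]
      rfl
  have hα : ∀ u, ∀ᵐ a ∂(Q u).map (limitField G (Z u) u), a u = 1 := fun u => by
    rw [ae_map_iff (hA u) (measurableSet_eq_fun (by fun_prop) (by fun_prop))]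
    exact ae_of_all _ fun ω => limitField_self ..
  -- the limit measure is first obtained on the full orthant, without mass at the origin
  obtain ⟨N, hN0, hN⟩ := exists_limitMeasure hα hT
  have hmapN := map_comap_punctured hN0
  have hval : Measurable (Subtype.val : Punctured V → V → ℝ≥0) := measurable_subtype_coe
  have happ : ∀ S : Set (V → ℝ≥0), MeasurableSet S →
      N.comap (Subtype.val : Punctured V → V → ℝ≥0) {x | x.1 ∈ S} = N S := fun S hS => by
    rw [← hmapN, Measure.map_apply hval hS, hmapN]; rfl
  have hfin : ∀ ε : ℝ≥0, 0 < ε →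
      N.comap (Subtype.val : Punctured V → V → ℝ≥0) {x | ∃ v, ε ≤ x.1 v} < ∞ := by
    intro ε hε
    have h := limitMeasure_exists_lt_ne_top hα hN (z := fun _ => ε / 2) fun _ => half_pos hε
    rw [← happ _ (measurableSet_exists_lt _)] at h
    refine (measure_mono ?_).trans_lt h.lt_top
    rintro x ⟨v, hv⟩
    exact ⟨v, (half_lt_self hε).trans_le hv⟩
  refine ⟨⟨N.comap Subtype.val, hfin⟩, ?_, ?_, ?_, ?_, ?_⟩
  · rw [M0.tendsto_iff]
    intro f
    have h := tendsto_integral_limitMeasure hα hT hN (isOriginTest_extendZero f)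
    rw [← integral_comap_punctured N (extendZero_zero _)] at h
    simp only [extendZero_coe] at h
    exact h.congr fun t => (integral_scaledTail P hXm t f).symm
  · intro u f hf
    have hms : MeasurableSet {x : V → ℝ≥0 | 0 < x u} :=
      measurableSet_lt (by fun_prop) (by fun_prop)
    rw [radialIntegral_eq (Q u) (hA u) hf, ← hN u]
    exact (setLIntegral_map hms hf hval).symm.trans (by rw [hmapN])
  · intro x hx
    have h := tendsto_cdf_pow hα hT hN hx
    rw [← happ _ (measurableSet_exists_lt _)] at h
    have hc : maxStableCdf ⟨N.comap Subtype.val, hfin⟩ (fun v => (x v : ℝ≥0∞)) =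
        Real.exp (-(N.comap (Subtype.val : Punctured V → V → ℝ≥0)
          {y | y.1 ∈ {y : V → ℝ≥0 | ∃ v, x v < y v}}).toReal) := by
      simp only [maxStableCdf, ENNReal.coe_lt_coe, Set.mem_ofPred_eq]
    rw [hc]
    refine h.congr fun n => ?_
    have hm : MeasurableSet {y : V → ℝ≥0 | ∀ v, y v ≤ n * x v} := by
      rw [Set.ofPred_forall]
      exact MeasurableSet.iInter fun v => measurableSet_le (by fun_prop) (by fun_prop)
    rw [Measure.map_apply hXm hm]
    rfl
  · intro u hu
    have hax : N {x | x u = 0} = 0 := limitMeasure_axis_eq_zero hα hN0 hN fun v => by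
      rw [lintegral_map' (Measurable.aemeasurable (by fun_prop)) (hA u)]
      exact lintegral_limitField_eq_one (hZ u) hconn hblock hu v
    have hNu : N = radialMeasure ((Q u).map (limitField G (Z u) u)) := by
      rw [← hN u, Measure.restrict_eq_self_of_ae_mem]
      rw [ae_iff]
      refine Eq.trans ?_ hax
      simp
    refine ⟨?_, fun f hf => ?_, fun x => ?_⟩
    · rw [← hax, ← happ _ (measurableSet_eq_fun (by fun_prop) (by fun_prop))]
      rfl
    · rw [radialIntegral_eq (Q u) (hA u) hf, ← hNu]
      exact (lintegral_map hf hval).symm.trans (by rw [hmapN])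
    · have hm : MeasurableSet {y : V → ℝ≥0 | ∃ v, (x v : ℝ≥0∞)⁻¹ < (y v : ℝ≥0∞)} := by
        rw [Set.ofPred_exists]
        exact MeasurableSet.iUnion fun v => measurableSet_lt (by fun_prop) (by fun_prop)
      -- finiteness, as `1 / (x_v + 1) ≤ 1 / x_v`, also if `x_v = 0`
      have hne : N {y | ∃ v, (x v : ℝ≥0∞)⁻¹ < (y v : ℝ≥0∞)} ≠ ∞ := by
        refine ne_top_of_le_ne_top
          (limitMeasure_exists_lt_ne_top hα hN (z := fun v => (x v + 1)⁻¹) fun v => by positivity)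
          (measure_mono ?_)
        rintro y ⟨v, hv⟩
        refine ⟨v, ENNReal.coe_lt_coe.1 (lt_of_le_of_lt ?_ hv)⟩
        rw [ENNReal.coe_inv (by positivity)]
        exact ENNReal.inv_le_inv.2 (by simp)
      rw [stdf, maxStableCdf, Real.log_exp, neg_neg]
      change ENNReal.ofReal (N.comap (Subtype.val : Punctured V → V → ℝ≥0)
        {y | y.1 ∈ {y : V → ℝ≥0 | ∃ v, (x v : ℝ≥0∞)⁻¹ < (y v : ℝ≥0∞)}}).toReal = _
      rw [happ _ hm, ENNReal.ofReal_toReal hne, hNu, radialMeasure_exists_inv_lt,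
        lintegral_map' (Measurable.aemeasurable (by fun_prop)) (hA u)]
  · intro a b hab u u' ⟨v, hv⟩ ⟨v', hv'⟩
    obtain ⟨hm1, h1⟩ := (hZ u).map_eq_map_limitField hblock hconn (hZ a) hab hv
    obtain ⟨hm2, h2⟩ := (hZ u').map_eq_map_limitField hblock hconn (hZ b) hab.symm hv'
    have key := lintegral_add_measure_zero_eq_one hα hN a b
    -- `A_{ab}` and `A_{ba}` have the laws of `Z_{ab}` and `Z_{ba}`, for any sources
    have e1 : ∫⁻ x, (x b : ℝ≥0∞) ∂(Q a).map (limitField G (Z a) a) =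
        ∫⁻ ω, (Z u a b ω : ℝ≥0∞) ∂(Q u) := by
      rw [← lintegral_map' (f := fun r : ℝ≥0 => (r : ℝ≥0∞)) (by fun_prop) hm1, h1,
        lintegral_map' (Measurable.aemeasurable (by fun_prop)) (hA a),
        lintegral_map' (Measurable.aemeasurable (by fun_prop)) (by fun_prop)]
    have e2 : ((Q b).map (limitField G (Z b) b)) {x | x a = 0} = Q u' {ω | Z u' b a ω = 0} := by
      have h3 : ((Q u').map (Z u' b a)) {0} = Q u' {ω | Z u' b a ω = 0} := by
        rw [Measure.map_apply_of_aemeasurable hm2 (measurableSet_singleton 0)]; rfl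
      rw [← h3, h2, Measure.map_apply_of_aemeasurable (by fun_prop) (measurableSet_singleton 0),
        Measure.map_apply_of_aemeasurable (hA b) (measurableSet_eq_fun (by fun_prop) (by fun_prop))]
      rfl
    rw [e1, e2] at key
    have hprob' : Q u' {ω | 0 < Z u' b a ω} = 1 ↔ Q u' {ω | Z u' b a ω = 0} = 0 := by
      have h5 := prob_compl_eq_zero_iff₀ (μ := Q u') (s := {ω | 0 < Z u' b a ω})
        (nullMeasurableSet_lt aemeasurable_const hm2)
      rw [← h5]
      have : {ω | 0 < Z u' b a ω}ᶜ = {ω | Z u' b a ω = 0} := by ext ω; simp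
      rw [this]
    rw [hprob']
    refine ⟨fun h => ?_, fun h => by rwa [h, add_zero] at key⟩
    rw [h] at key
    exact (ENNReal.add_right_inj ENNReal.one_ne_top).1 (key.trans (add_zero 1).symm)
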